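/- Let $m\ge 1$ be an integer and $\alpha\in(0,m)$. For $s\ge 0$ let $(-\Delta)^{s/2}$ be the operator on functions on $\mathbb R^m$ with Fourier symbol $|\xi|^s$. For $s\in(0,m)$ and measurable $f:\mathbb R^m\to[0,\infty]$ let $$I_sf(x)=c_{m,s}\int_{\mathbb R^m}\frac{f(y)}{|x-y|^{m-s}}\,dy\in[0,\infty],\qquad c_{m,s}=\frac{\Gamma(\frac{m-s}{2})}{\pi^{m/2}\,2^{s}\,\Gamma(\frac s2)},$$ be the Riesz potential, and let $I_0f=f$. For Schwartz functions $a,b:\mathbb R^m\to\mathbb C$ put $$H_\alpha(a,b)=(-\Delta)^{\alpha/2}(ab)-a\,(-\Delta)^{\alpha/2}b-b\,(-\Delta)^{\alpha/2}a .$$ (1) Let $\varepsilon>0$ and let $\tau_1,\tau_2\in(\max\{\alpha-1,0\},\alpha]$ with $\tau_1+\tau_2>\alpha$. Then there are $L\in\mathbb N$ and numbers $s_k\in(0,\tau_1)$, $t_k\in(0,\tau_2)$ with $\tau_1+\tau_2-s_k-t_k-\alpha\in[0,\varepsilon)$ for $k=1,\dots,L$, and a constant $C<\infty$, such that for all Schwartz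 functions $a,b$ and all $x\in\mathbb R^m$ $$|H_\alpha(a,b)(x)|\le C\sum_{k=1}^L I_{\tau_1+\tau_2-s_k-t_k-\alpha}\Big(I_{s_k}\big|(-\Delta)^{\tau_1/2}a\big|\;I_{t_k}\big|(-\Delta)^{\tau_2/2}b\big|\Big)(x).$$ (2) There is $L\in\mathbb N$, depending only on $m$ and $\alpha$, such that the following holds. For all $\beta\in[0,\min\{\alpha,1\})$ with $\beta\le m-\alpha$, all $\tau\in(\max\{\beta,\alpha+\beta-1\},\alpha]$ and all $\varepsilon>0$ there are numbers $s_k\in(0,\alpha)$, $t_k\in(0,\tau)$ with $\tau-\beta-s_k-t_k\in[0,\varepsilon)$ for $k=1,\dots,L$, and a constant $C<\infty$, such that for all Schwartz functions $a,b$ and all $x\in\mathbb R^m$ $$\big|(-\Delta)^{\beta/2}H_\alpha(a,b)(x)\big|\le C\sum_{k=1}^L I_{\tau-\beta-s_k-t_k}\Big(I_{s_k}\big|(-\Delta)^{\alpha/2}a\big|\;I_{t_k}\big|(-\Delta)^{\tau/2}b\big|\Big)(x).$$ -/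

import Mathlib

open scoped FourierTransform SchwartzMap ENNReal NNReal

noncomputable section

/-- The fractional Laplacian `(-Δ)^{s/2}` on functions on `ℝ^m`, defined through its Fourier symbol.
Mathlib's Fourier transform is `𝓕 f ξ = ∫ exp (-2πi ⟪y, ξ⟫) f y dy`, so that the symbol `|ξ|^s` of
the unnormalised transform reads `(2π‖ξ‖)^s` here; for `s = 2` this is `-Δ`. -/
def fracLaplacian {m : ℕ} (s : ℝ) (f : EuclideanSpace ℝ (Fin m) → ℂ) :
    EuclideanSpace ℝ (Fin m) → ℂ :=
  𝓕⁻ (fun ξ : EuclideanSpace ℝ (Fin m) => (((2 * Real.pi * ‖ξ‖) ^ s : ℝ) : ℂ) * 𝓕 f ξ)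

/-- The fractional Leibniz remainder
`H_α(a,b) = (-Δ)^{α/2}(ab) - a (-Δ)^{α/2} b - b (-Δ)^{α/2} a`. -/
def leibnizRemainder {m : ℕ} (α : ℝ) (a b : EuclideanSpace ℝ (Fin m) → ℂ) :
    EuclideanSpace ℝ (Fin m) → ℂ :=
  fun x => fracLaplacian α (fun y => a y * b y) x
    - a x * fracLaplacian α b x - b x * fracLaplacian α a x

/-- The constant which makes the Riesz potential of order `s ∈ (0,m)` the inverse of
`(-Δ)^{s/2}`. -/
def rieszConst (m : ℕ) (s : ℝ) : ℝ :=
  Real.Gamma (((m : ℝ) - s) / 2) / (Real.pi ^ ((m : ℝ) / 2) * 2 ^ s * Real.Gamma (s / 2))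

/-- The Riesz potential `I_s f (x) = c ∫ |x - y|^{s - m} f(y) dy` of a nonnegative function, for
`s ∈ (0,m)`, with values in `[0,∞]`; `I_0` is the identity. -/
def rieszPotential {m : ℕ} (s : ℝ) (f : EuclideanSpace ℝ (Fin m) → ℝ≥0∞) :
    EuclideanSpace ℝ (Fin m) → ℝ≥0∞ :=
  fun x => if s = 0 then f x else
    ENNReal.ofReal (rieszConst m s) * ∫⁻ y, ENNReal.ofReal (‖x - y‖ ^ (s - (m : ℝ))) * f y

end

open MeasureTheory Set

/-! Everything reduces to pointwise bounds for explicit kernels. Take `N` with `α < 2N`. Integrating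
the symmetric difference of order `2N` against `‖h‖^(-α-m)` reproduces the symbol `|ξ|^α` up to a
constant (`exists_symmDiff_representation`). Its coefficients sum to zero, so applying this to `ab`,
`a` and `b` turns `H_α(a,b)(x)` into an integral of weighted sums of products `(a(x+jh) - a(x))
(b(x+jh) - b(x))` (`exists_leibnizRemainder_representation`). Each increment is in turn an integral
of `(-Δ)^(τ₁/2) a` or `(-Δ)^(τ₂/2) b` against a difference of two Riesz kernels
(`exists_sub_representation`). Hence `|H_α(a,b)(x)|` is at most a bilinear form in the absolute
values of these two functions, with a kernel in `(x, z₁, z₂)`.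

With `Θ = τ₁ + τ₂ - α` that kernel is homogeneous of degree `Θ - 2m`. For small `δ > 0` it is
dominated by `rieszMajorant δ Θ` (`exists_leibnizKernel_le`): for small `h` the cancellation of
order `2N`, obtained from Cauchy estimates in a complexified step, makes the integral converge; for
large `h` a bound on one of the two increments is enough. By Tonelli the three summands of the
majorant are the kernels of `I_δ f · I_(Θ-δ) g`, `I_(Θ-δ) f · I_δ g` and `I_δ(I_δ f · I_(Θ-2δ) g)`.
The outer orders are `0`, `0` and `δ`, so three terms suffice and any `δ < ε` is fine enough.

For the second assertion, `fracLaplacian_leibnizRemainder` writes `(-Δ)^(β/2) H_α(a,b)` as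
`H_(α+β)(a,b)` plus the commutator terms `a (-Δ)^((α+β)/2) b - (-Δ)^(β/2)(a (-Δ)^(α/2) b)` and its
mirror image. The first is covered by the previous argument with `τ₁ = α`, `τ₂ = τ`, so that now `Θ
= τ - β`. As `β < 1`, a commutator is an absolutely convergent integral of `‖h‖^(-β-m) (a(x+h) -
a(x)) (-Δ)^(α/2) b(x+h)`. When `b` is the function being differenced, its increment is expressed
through `(-Δ)^(τ/2) b` and `exists_commutatorKernel_le` applies. When `a` is differenced and `τ <
α`, there are `σ = α - τ` derivatives too many on `b`. They are written as a singular integral of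
first differences, legitimate because `σ < 1`, and moved to the other factor by symmetry
(`enorm_integral_mul_sub_le`). The resulting double difference is estimated in
`exists_doubleCommutatorKernel_le`. -/

/-- Euclidean space of dimension `m`. -/
abbrev Euc (m : ℕ) := EuclideanSpace ℝ (Fin m)

/-! ### Integrals of powers of the norm with one or two centres -/

lemma nontrivial_euc (m : ℕ) [NeZero m] : Nontrivial (Euc m) := by
  have : 0 < Module.finrank ℝ (Euc m) := by
    rw [finrank_euclideanSpace_fin]; exact Nat.pos_of_ne_zero (NeZero.ne m)
  exact Module.nontrivial_of_finrank_pos this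

lemma setLIntegral_ofReal_le {X : Type*} [MeasurableSpace X] {μ : Measure X} {S : Set X}
    (hS : MeasurableSet S) {f g : X → ℝ} {A B : ℝ} (hA : 0 ≤ A)
    (hfg : ∀ y ∈ S, f y ≤ A * g y) (hg : ∫⁻ y in S, ENNReal.ofReal (g y) ∂μ ≤ ENNReal.ofReal B) :
    ∫⁻ y in S, ENNReal.ofReal (f y) ∂μ ≤ ENNReal.ofReal (A * B) := by
  calc ∫⁻ y in S, ENNReal.ofReal (f y) ∂μ
      ≤ ∫⁻ y in S, ENNReal.ofReal A * ENNReal.ofReal (g y) ∂μ := by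
        refine setLIntegral_mono' hS fun y hy => ?_
        rw [← ENNReal.ofReal_mul hA]
        exact ENNReal.ofReal_le_ofReal (hfg y hy)
    _ = ENNReal.ofReal A * ∫⁻ y in S, ENNReal.ofReal (g y) ∂μ :=
        lintegral_const_mul' _ _ ENNReal.ofReal_ne_top
    _ ≤ ENNReal.ofReal A * ENNReal.ofReal B := by gcongr
    _ = ENNReal.ofReal (A * B) := (ENNReal.ofReal_mul hA).symm

lemma setLIntegral_le_add {X : Type*} [MeasurableSpace X] {μ : Measure X} {S S₁ S₂ : Set X}
    (h : S ⊆ S₁ ∪ S₂) {f : X → ℝ≥0∞} {A B : ℝ} (hA : 0 ≤ A) (hB : 0 ≤ B)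
    (h₁ : ∫⁻ y in S₁, f y ∂μ ≤ ENNReal.ofReal A) (h₂ : ∫⁻ y in S₂, f y ∂μ ≤ ENNReal.ofReal B) :
    ∫⁻ y in S, f y ∂μ ≤ ENNReal.ofReal (A + B) := by
  rw [ENNReal.ofReal_add hA hB]
  exact (lintegral_mono_set h).trans ((lintegral_union_le _ _ _).trans (add_le_add h₁ h₂))

lemma lintegral_comp_smul_euc {m : ℕ} (f : Euc m → ℝ≥0∞) {r : ℝ} (hr : r ≠ 0) :
    ∫⁻ x, f (r • x) = ENNReal.ofReal (|r| ^ (-(m : ℝ))) * ∫⁻ x, f x := by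
  have h1 : ∫⁻ x, f (r • x) = ∫⁻ x, f x ∂(Measure.map (r • ·) (volume : Measure (Euc m))) :=
    ((Homeomorph.smulOfNeZero r hr).toMeasurableEquiv.measurableEmbedding.lintegral_map f).symm
  rw [h1, Measure.map_addHaar_smul _ hr, lintegral_smul_measure, finrank_euclideanSpace_fin,
    smul_eq_mul, abs_inv, abs_pow, Real.rpow_neg (abs_nonneg r), Real.rpow_natCast]

/-- Translation and scaling reduce to the unit ball, where polar coordinates leave `r^(p-1)`,
integrable at `0` because `p > 0`. -/
lemma exists_lintegral_ball_le {m : ℕ} [NeZero m] {p : ℝ} (hp : 0 < p) :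
    ∃ C : ℝ, 0 < C ∧ ∀ (v : Euc m) (ρ : ℝ), 0 < ρ →
      ∫⁻ y in {y : Euc m | ‖y - v‖ < ρ}, ENNReal.ofReal (‖y - v‖ ^ (p - m)) ≤
        ENNReal.ofReal (C * ρ ^ p) := by
  have := nontrivial_euc m
  have hm : 1 ≤ m := Nat.one_le_iff_ne_zero.2 (NeZero.ne m)
  have hint : IntegrableOn (fun y : Euc m => ‖y‖ ^ (p - m)) (Metric.ball 0 1) := by
    rw [integrableOn_fun_norm_addHaar volume (f := fun r => r ^ (p - m)) (r := 1),
      finrank_euclideanSpace_fin]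
    have h1 : IntegrableOn (fun y : ℝ => y ^ (p - 1)) (Ioo 0 1) :=
      ((intervalIntegrable_iff_integrableOn_Ioo_of_le zero_le_one).1
        (intervalIntegral.intervalIntegrable_rpow' (by linarith)))
    refine h1.congr_fun (fun y hy => ?_) measurableSet_Ioo
    simp only [smul_eq_mul]
    rw [← Real.rpow_natCast, ← Real.rpow_add hy.1, Nat.cast_sub hm]
    congr 1; push_cast; ring
  set I := ∫⁻ y in {y : Euc m | ‖y‖ < 1}, ENNReal.ofReal (‖y‖ ^ (p - m)) with hI
  have hIfin : I ≠ ⊤ := by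
    have h2 : {y : Euc m | ‖y‖ < 1} = Metric.ball 0 1 := by ext; simp
    rw [hI, h2]
    exact hint.lintegral_lt_top.ne
  refine ⟨I.toReal + 1, by positivity, fun v ρ hρ => ?_⟩
  have hms : MeasurableSet {y : Euc m | ‖y‖ < 1} := measurableSet_lt (by fun_prop) (by fun_prop)
  have hms' : MeasurableSet {y : Euc m | ‖y‖ < ρ} := measurableSet_lt (by fun_prop) (by fun_prop)
  have hmv : MeasurableSet {y : Euc m | ‖y - v‖ < ρ} :=
    measurableSet_lt (by fun_prop) (by fun_prop)
  have e1 : ∫⁻ y in {y : Euc m | ‖y - v‖ < ρ}, ENNReal.ofReal (‖y - v‖ ^ (p - m)) =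
      ∫⁻ y in {y : Euc m | ‖y‖ < ρ}, ENNReal.ofReal (‖y‖ ^ (p - m)) := by
    rw [← lintegral_indicator hmv, ← lintegral_indicator hms']
    exact lintegral_sub_right_eq_self
      (({y : Euc m | ‖y‖ < ρ}).indicator fun y => ENNReal.ofReal (‖y‖ ^ (p - m))) v
  have e2 : I = ENNReal.ofReal (ρ ^ (-p)) *
      ∫⁻ y in {y : Euc m | ‖y‖ < ρ}, ENNReal.ofReal (‖y‖ ^ (p - m)) := by
    have := lintegral_comp_smul_euc
      (({y : Euc m | ‖y‖ < ρ}).indicator fun y => ENNReal.ofReal (‖y‖ ^ (p - m))) hρ.ne'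
    rw [lintegral_indicator hms', abs_of_pos hρ] at this
    have e3 : ∫⁻ x : Euc m, ({y : Euc m | ‖y‖ < ρ}).indicator
        (fun y => ENNReal.ofReal (‖y‖ ^ (p - m))) (ρ • x) = ENNReal.ofReal (ρ ^ (p - m)) * I := by
      rw [hI, ← lintegral_const_mul' _ _ ENNReal.ofReal_ne_top, ← lintegral_indicator hms]
      congr 1; ext x
      simp only [indicator, mem_ofPred_eq, norm_smul, Real.norm_eq_abs, abs_of_pos hρ,
        mul_lt_iff_lt_one_right hρ]
      split_ifs
      · rw [← ENNReal.ofReal_mul (by positivity), Real.mul_rpow hρ.le (norm_nonneg _)]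
      · rfl
    rw [e3] at this
    have h4 : ENNReal.ofReal (ρ ^ ((m:ℝ) - p)) * ENNReal.ofReal (ρ ^ (p - m)) = 1 := by
      rw [← ENNReal.ofReal_mul (by positivity), ← Real.rpow_add hρ]; simp
    calc I = ENNReal.ofReal (ρ ^ ((m:ℝ) - p)) * (ENNReal.ofReal (ρ ^ (p - m)) * I) := by
          rw [← mul_assoc, h4, one_mul]
      _ = _ := by
        rw [this, ← mul_assoc, ← ENNReal.ofReal_mul (by positivity), ← Real.rpow_add hρ]
        congr 3; ring
  rw [e1]
  calc ∫⁻ y in {y : Euc m | ‖y‖ < ρ}, ENNReal.ofReal (‖y‖ ^ (p - m))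
      = ENNReal.ofReal (ρ ^ p) * I := by
        rw [e2, ← mul_assoc, ← ENNReal.ofReal_mul (by positivity), ← Real.rpow_add hρ]; simp
    _ = ENNReal.ofReal (I.toReal * ρ ^ p) := by
        rw [ENNReal.ofReal_mul ENNReal.toReal_nonneg, ENNReal.ofReal_toReal hIfin, mul_comm]
    _ ≤ _ := by
        apply ENNReal.ofReal_le_ofReal; gcongr; linarith

/-- The counterpart at infinity: after scaling, polar coordinates leave `r^(-p-1)` on `[1, ∞)`. -/
lemma exists_lintegral_compl_ball_le {m : ℕ} [NeZero m] {p : ℝ} (hp : 0 < p) :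
    ∃ C : ℝ, 0 < C ∧ ∀ (v : Euc m) (ρ : ℝ), 0 < ρ →
      ∫⁻ y in {y : Euc m | ρ ≤ ‖y - v‖}, ENNReal.ofReal (‖y - v‖ ^ (-p - m)) ≤
        ENNReal.ofReal (C * ρ ^ (-p)) := by
  have := nontrivial_euc m
  have hm : 1 ≤ m := Nat.one_le_iff_ne_zero.2 (NeZero.ne m)
  have hms : MeasurableSet {y : Euc m | 1 ≤ ‖y‖} := measurableSet_le (by fun_prop) (by fun_prop)
  have hint : IntegrableOn (fun y : Euc m => ‖y‖ ^ (-p - m)) {y : Euc m | 1 ≤ ‖y‖} := by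
    rw [← integrable_indicator_iff hms]
    have := integrable_fun_norm_addHaar (E := Euc m) volume
      (f := (Ici (1:ℝ)).indicator fun r => r ^ (-p - m))
    have h0 : (fun x : Euc m => (Ici (1:ℝ)).indicator (fun r => r ^ (-p - m)) ‖x‖) =
        ({y : Euc m | 1 ≤ ‖y‖}).indicator fun y => ‖y‖ ^ (-p - m) := by
      ext x; simp [indicator]
    rw [← h0, this, finrank_euclideanSpace_fin]
    have h1 : IntegrableOn (fun y : ℝ => y ^ (-p - 1)) (Ici 1) := by
      rw [integrableOn_Ici_iff_integrableOn_Ioi]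
      exact integrableOn_Ioi_rpow_of_lt (by linarith) zero_lt_one
    have h2 : Integrable ((Ici (1:ℝ)).indicator (fun y : ℝ => y ^ (-p - 1))) :=
      (integrable_indicator_iff measurableSet_Ici).2 h1
    refine h2.integrableOn.congr_fun (fun y hy => ?_) measurableSet_Ioi
    simp only [smul_eq_mul, indicator]
    split_ifs with h
    · have hy0 : 0 < y := hy
      rw [← Real.rpow_natCast, ← Real.rpow_add hy0, Nat.cast_sub hm]
      congr 1; push_cast; ring
    · simp
  set I := ∫⁻ y in {y : Euc m | 1 ≤ ‖y‖}, ENNReal.ofReal (‖y‖ ^ (-p - m)) with hI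
  have hIfin : I ≠ ⊤ := hint.lintegral_lt_top.ne
  refine ⟨I.toReal + 1, by positivity, fun v ρ hρ => ?_⟩
  have hms' : MeasurableSet {y : Euc m | ρ ≤ ‖y‖} := measurableSet_le (by fun_prop) (by fun_prop)
  have hmv : MeasurableSet {y : Euc m | ρ ≤ ‖y - v‖} :=
    measurableSet_le (by fun_prop) (by fun_prop)
  have e1 : ∫⁻ y in {y : Euc m | ρ ≤ ‖y - v‖}, ENNReal.ofReal (‖y - v‖ ^ (-p - m)) =
      ∫⁻ y in {y : Euc m | ρ ≤ ‖y‖}, ENNReal.ofReal (‖y‖ ^ (-p - m)) := by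
    rw [← lintegral_indicator hmv, ← lintegral_indicator hms']
    exact lintegral_sub_right_eq_self
      (({y : Euc m | ρ ≤ ‖y‖}).indicator fun y => ENNReal.ofReal (‖y‖ ^ (-p - m))) v
  have e2 : I = ENNReal.ofReal (ρ ^ p) *
      ∫⁻ y in {y : Euc m | ρ ≤ ‖y‖}, ENNReal.ofReal (‖y‖ ^ (-p - m)) := by
    have := lintegral_comp_smul_euc
      (({y : Euc m | ρ ≤ ‖y‖}).indicator fun y => ENNReal.ofReal (‖y‖ ^ (-p - m))) hρ.ne'
    rw [lintegral_indicator hms', abs_of_pos hρ] at this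
    have e3 : ∫⁻ x : Euc m, ({y : Euc m | ρ ≤ ‖y‖}).indicator
        (fun y => ENNReal.ofReal (‖y‖ ^ (-p - m))) (ρ • x) = ENNReal.ofReal (ρ ^ (-p - m)) * I := by
      rw [hI, ← lintegral_const_mul' _ _ ENNReal.ofReal_ne_top, ← lintegral_indicator hms]
      congr 1; ext x
      simp only [indicator, mem_ofPred_eq, norm_smul, Real.norm_eq_abs, abs_of_pos hρ,
        le_mul_iff_one_le_right hρ]
      split_ifs
      · rw [← ENNReal.ofReal_mul (by positivity), Real.mul_rpow hρ.le (norm_nonneg _)]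
      · rfl
    rw [e3] at this
    have h4 : ENNReal.ofReal (ρ ^ ((m:ℝ) + p)) * ENNReal.ofReal (ρ ^ (-p - m)) = 1 := by
      rw [← ENNReal.ofReal_mul (by positivity), ← Real.rpow_add hρ]
      rw [show (m:ℝ) + p + (-p - m) = 0 by ring]; simp
    calc I = ENNReal.ofReal (ρ ^ ((m:ℝ) + p)) * (ENNReal.ofReal (ρ ^ (-p - m)) * I) := by
          rw [← mul_assoc, h4, one_mul]
      _ = _ := by
        rw [this, ← mul_assoc, ← ENNReal.ofReal_mul (by positivity), ← Real.rpow_add hρ]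
        congr 3; ring
  rw [e1]
  calc ∫⁻ y in {y : Euc m | ρ ≤ ‖y‖}, ENNReal.ofReal (‖y‖ ^ (-p - m))
      = ENNReal.ofReal (ρ ^ (-p)) * I := by
        rw [e2, ← mul_assoc, ← ENNReal.ofReal_mul (by positivity), ← Real.rpow_add hρ]; simp
    _ = ENNReal.ofReal (I.toReal * ρ ^ (-p)) := by
        rw [ENNReal.ofReal_mul ENNReal.toReal_nonneg, ENNReal.ofReal_toReal hIfin, mul_comm]
    _ ≤ _ := by
        apply ENNReal.ofReal_le_ofReal; gcongr; linarith

/-- A two-centre integral away from one of the centres. -/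
lemma exists_lintegral_two_centre_le {m : ℕ} [NeZero m] {p q : ℝ} (hp : 0 < p) (hpm : p ≤ m)
    (hq : 0 < q) :
    ∃ C : ℝ, 0 < C ∧ ∀ (x v : Euc m) (ρ : ℝ), 0 < ρ →
      ∫⁻ y in {y : Euc m | ρ ≤ ‖y - x‖},
          ENNReal.ofReal (‖y - v‖ ^ (p - m) * ‖y - x‖ ^ (-q - m)) ≤
        ENNReal.ofReal (C * ρ ^ (p - q - m)) := by
  obtain ⟨C₁, hC₁, h₁⟩ := exists_lintegral_ball_le (m := m) hp
  obtain ⟨C₂, hC₂, h₂⟩ := exists_lintegral_compl_ball_le (m := m) hq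
  refine ⟨C₁ + C₂, by positivity, fun x v ρ hρ => ?_⟩
  -- On the part near `v` the factor centred at `x` is at most its value at distance `ρ`; on the
  -- rest the factor centred at `v` is.
  have hS₁ : MeasurableSet ({y : Euc m | ρ ≤ ‖y - x‖} ∩ {y | ‖y - v‖ < ρ}) :=
    (measurableSet_le (by fun_prop) (by fun_prop)).inter
      (measurableSet_lt (by fun_prop) (by fun_prop))
  have hS₂ : MeasurableSet ({y : Euc m | ρ ≤ ‖y - x‖} ∩ {y | ρ ≤ ‖y - v‖}) :=
    (measurableSet_le (by fun_prop) (by fun_prop)).inter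
      (measurableSet_le (by fun_prop) (by fun_prop))
  have hb₁ := setLIntegral_ofReal_le (μ := volume) hS₁
    (f := fun y => ‖y - v‖ ^ (p - m) * ‖y - x‖ ^ (-q - m)) (g := fun y => ‖y - v‖ ^ (p - m))
    (A := ρ ^ (-q - m)) (B := C₁ * ρ ^ p) (by positivity)
    (fun y hy => by
      rw [mul_comm]
      exact mul_le_mul_of_nonneg_right (Real.rpow_le_rpow_of_nonpos hρ hy.1
        (by linarith [Nat.cast_nonneg (α := ℝ) m])) (by positivity))
    ((lintegral_mono_set inter_subset_right).trans (h₁ v ρ hρ))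
  have hb₂ := setLIntegral_ofReal_le (μ := volume) hS₂
    (f := fun y => ‖y - v‖ ^ (p - m) * ‖y - x‖ ^ (-q - m)) (g := fun y => ‖y - x‖ ^ (-q - m))
    (A := ρ ^ (p - m)) (B := C₂ * ρ ^ (-q)) (by positivity)
    (fun y hy => by
      exact mul_le_mul_of_nonneg_right (Real.rpow_le_rpow_of_nonpos hρ hy.2 (by linarith))
        (by positivity))
    ((lintegral_mono_set inter_subset_left).trans (h₂ x ρ hρ))
  have key := setLIntegral_le_add (S := {y : Euc m | ρ ≤ ‖y - x‖})
    (fun y hy => by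
      rcases lt_or_ge ‖y - v‖ ρ with h | h
      · exact Or.inl ⟨hy, h⟩
      · exact Or.inr ⟨hy, h⟩) (by positivity) (by positivity) hb₁ hb₂
  refine key.trans (ENNReal.ofReal_le_ofReal (le_of_eq ?_))
  have a1 : ρ ^ (-q - (m:ℝ)) * ρ ^ p = ρ ^ (p - q - m) := by
    rw [← Real.rpow_add hρ]; congr 1; ring
  have a2 : ρ ^ (p - (m:ℝ)) * ρ ^ (-q) = ρ ^ (p - q - m) := by
    rw [← Real.rpow_add hρ]; congr 1; ring
  rw [add_mul, ← a1]; nth_rewrite 2 [a1]; rw [← a2]; ring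

/-- A two-centre integral outside a ball around one of the centres that is small compared with
the distance of the centres. -/
lemma exists_lintegral_two_centre_le' {m : ℕ} [NeZero m] {p q : ℝ} (hp : 0 < p) (hpm : p ≤ m)
    (hq : 0 < q) :
    ∃ C : ℝ, 0 < C ∧ ∀ (x v : Euc m) (ρ : ℝ), 0 < ρ → ρ ≤ ‖x - v‖ →
      ∫⁻ y in {y : Euc m | ρ ≤ ‖y - x‖},
          ENNReal.ofReal (‖y - v‖ ^ (p - m) * ‖y - x‖ ^ (-q - m)) ≤
        ENNReal.ofReal (C * (‖x - v‖ ^ (p - m) * ρ ^ (-q))) := by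
  obtain ⟨C₁, hC₁, h₁⟩ := exists_lintegral_ball_le (m := m) hp
  obtain ⟨C₂, hC₂, h₂⟩ := exists_lintegral_compl_ball_le (m := m) hq
  refine ⟨(1 / 2) ^ (-q - m : ℝ) * C₁ * (1 / 2) ^ p + (1 / 2) ^ (p - m) * C₂, by positivity,
    fun x v ρ hρ hr => ?_⟩
  set r := ‖x - v‖ with hrdef
  have hr0 : 0 < r := hρ.trans_le hr
  have hS₁ : MeasurableSet ({y : Euc m | ρ ≤ ‖y - x‖} ∩ {y | ‖y - v‖ < 1 / 2 * r}) :=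
    (measurableSet_le (by fun_prop) (by fun_prop)).inter
      (measurableSet_lt (by fun_prop) (by fun_prop))
  have hS₂ : MeasurableSet ({y : Euc m | ρ ≤ ‖y - x‖} ∩ {y | 1 / 2 * r ≤ ‖y - v‖}) :=
    (measurableSet_le (by fun_prop) (by fun_prop)).inter
      (measurableSet_le (by fun_prop) (by fun_prop))
  have hb₁ := setLIntegral_ofReal_le (μ := volume) hS₁
    (f := fun y => ‖y - v‖ ^ (p - m) * ‖y - x‖ ^ (-q - m)) (g := fun y => ‖y - v‖ ^ (p - m))
    (A := (1 / 2 * r) ^ (-q - m : ℝ)) (B := C₁ * (1 / 2 * r) ^ p) (by positivity)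
    (fun y hy => by
      rw [mul_comm]
      refine mul_le_mul_of_nonneg_right (Real.rpow_le_rpow_of_nonpos (by positivity) ?_
        (by linarith [Nat.cast_nonneg (α := ℝ) m])) (by positivity)
      have h3 := hy.2
      have : ‖x - v‖ ≤ ‖y - v‖ + ‖y - x‖ := by
        have := norm_sub_le (y - v) (y - x); simpa using this
      simp only [mem_ofPred_eq] at h3
      linarith)
    ((lintegral_mono_set inter_subset_right).trans (h₁ v _ (by positivity)))
  have hb₂ := setLIntegral_ofReal_le (μ := volume) hS₂
    (f := fun y => ‖y - v‖ ^ (p - m) * ‖y - x‖ ^ (-q - m)) (g := fun y => ‖y - x‖ ^ (-q - m))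
    (A := (1 / 2 * r) ^ (p - m)) (B := C₂ * ρ ^ (-q)) (by positivity)
    (fun y hy => by
      exact mul_le_mul_of_nonneg_right (Real.rpow_le_rpow_of_nonpos (by positivity) hy.2
        (by linarith)) (by positivity))
    ((lintegral_mono_set inter_subset_left).trans (h₂ x ρ hρ))
  have key := setLIntegral_le_add (S := {y : Euc m | ρ ≤ ‖y - x‖})
    (fun y hy => by
      rcases lt_or_ge ‖y - v‖ (1 / 2 * r) with h | h
      · exact Or.inl ⟨hy, h⟩
      · exact Or.inr ⟨hy, h⟩) (by positivity) (by positivity) hb₁ hb₂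
  refine key.trans (ENNReal.ofReal_le_ofReal ?_)
  have a1 : r ^ (-q - (m:ℝ)) * r ^ p = r ^ (p - m) * r ^ (-q) := by
    rw [← Real.rpow_add hr0, ← Real.rpow_add hr0]; congr 1; ring
  have a2 : r ^ (-q) ≤ ρ ^ (-q) := Real.rpow_le_rpow_of_nonpos hρ hr (by linarith)
  rw [Real.mul_rpow (by norm_num) hr0.le, Real.mul_rpow (by norm_num) hr0.le,
    Real.mul_rpow (by norm_num) hr0.le]
  calc _ = (1 / 2) ^ (-q - m : ℝ) * C₁ * (1 / 2) ^ p * (r ^ (-q - (m:ℝ)) * r ^ p) +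
        (1 / 2) ^ (p - m) * C₂ * (r ^ (p - m) * ρ ^ (-q)) := by ring
    _ ≤ (1 / 2) ^ (-q - m : ℝ) * C₁ * (1 / 2) ^ p * (r ^ (p - m) * ρ ^ (-q)) +
        (1 / 2) ^ (p - m) * C₂ * (r ^ (p - m) * ρ ^ (-q)) := by
        rw [a1]; gcongr
    _ = _ := by ring

/-! ### Trading exponents, and increments of powers of the norm -/

/-- The trade behind all the kernel estimates: the smaller length may give up part of its exponent
to the larger one as long as the total degree is kept. -/
lemma rpow_mul_rpow_le_of_le {a R C p q p' q' : ℝ} (ha : 0 < a) (hR : 0 < R) (hC : 0 < C)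
    (haR : a ≤ C * R) (hp : p' ≤ p) (hpq : p + q = p' + q') :
    a ^ p * R ^ q ≤ C ^ (p - p') * (a ^ p' * R ^ q') := by
  have h1 : a ^ (p - p') ≤ (C * R) ^ (p - p') := Real.rpow_le_rpow ha.le haR (by linarith)
  calc a ^ p * R ^ q = a ^ p' * a ^ (p - p') * R ^ q := by
        rw [← Real.rpow_add ha]; congr 2; ring
    _ ≤ a ^ p' * (C * R) ^ (p - p') * R ^ q := by gcongr
    _ = C ^ (p - p') * (a ^ p' * (R ^ (p - p') * R ^ q)) := by
        rw [Real.mul_rpow hC.le hR.le]; ring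
    _ = _ := by rw [← Real.rpow_add hR]; congr 4; linarith

/-- Mean value theorem on `[a/2, ∞)`, where the derivative is largest at the left end. -/
lemma abs_rpow_sub_rpow_le {p : ℝ} (hp : p ≤ 0) {a b : ℝ} (ha : 0 < a) (hab : a / 2 ≤ b) :
    |b ^ p - a ^ p| ≤ |p| * (1 / 2) ^ (p - 1) * (|b - a| * a ^ (p - 1)) := by
  have h := Convex.norm_image_sub_le_of_norm_deriv_le (𝕜 := ℝ) (f := fun x : ℝ => x ^ p)
    (s := Ici (a / 2)) (x := a) (y := b) (C := |p| * (1 / 2) ^ (p - 1) * a ^ (p - 1))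
    (fun x hx => by
      have hx0 : 0 < x := lt_of_lt_of_le (by positivity) hx
      exact Real.differentiableAt_rpow_const_of_ne p hx0.ne')
    (fun x hx => by
      have hx0 : 0 < x := lt_of_lt_of_le (by positivity) hx
      rw [Real.deriv_rpow_const, norm_mul, Real.norm_eq_abs, Real.norm_eq_abs,
        abs_of_pos (Real.rpow_pos_of_pos hx0 _), mul_assoc,
        ← Real.mul_rpow (by norm_num) ha.le]
      refine mul_le_mul_of_nonneg_left ?_ (abs_nonneg _)
      exact Real.rpow_le_rpow_of_nonpos (by positivity) (by
        have : a / 2 ≤ x := hx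
        linarith) (by linarith))
    (convex_Ici _) (mem_Ici.2 (by linarith)) (mem_Ici.2 hab)
  rw [Real.norm_eq_abs, Real.norm_eq_abs] at h
  calc _ ≤ _ := h
    _ = _ := by ring

/-- Increments of a negative power of the norm along a small displacement. -/
lemma exists_abs_norm_rpow_sub_le_near (p κ : ℝ) (hp : p ≤ 0) (hκ₁ : κ ≤ 1) :
    ∃ C : ℝ, 0 < C ∧ ∀ {V : Type} [NormedAddCommGroup V] (u y : V), u ≠ 0 → ‖y‖ ≤ ‖u‖ / 2 →
      |‖u + y‖ ^ p - ‖u‖ ^ p| ≤ C * (‖y‖ ^ κ * ‖u‖ ^ (p - κ)) := by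
  refine ⟨|p| * (1 / 2) ^ (p - 1) + 1, by positivity, fun u y hu hy => ?_⟩
  have hu0 : 0 < ‖u‖ := norm_pos_iff.2 hu
  have h1 : ‖u‖ ≤ ‖u + y‖ + ‖y‖ := by simpa using norm_sub_le (u + y) y
  have h2 : |‖u + y‖ - ‖u‖| ≤ ‖y‖ := by simpa using abs_norm_sub_norm_le (u + y) u
  have h := abs_rpow_sub_rpow_le hp hu0 (b := ‖u + y‖) (by linarith)
  rcases eq_or_ne y 0 with rfl | hy0
  · simp only [add_zero, sub_self, abs_zero]; positivity
  have hy0 : 0 < ‖y‖ := norm_pos_iff.2 hy0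
  have h3 : ‖y‖ ^ (1:ℝ) * ‖u‖ ^ (p - 1) ≤ 1 ^ (1 - κ) * (‖y‖ ^ κ * ‖u‖ ^ (p - κ)) :=
    rpow_mul_rpow_le_of_le hy0 hu0 one_pos (by linarith) hκ₁ (by ring)
  rw [Real.rpow_one, Real.one_rpow, one_mul] at h3
  calc _ ≤ _ := h
    _ ≤ |p| * (1 / 2) ^ (p - 1) * (‖y‖ * ‖u‖ ^ (p - 1)) := by gcongr
    _ ≤ |p| * (1 / 2) ^ (p - 1) * (‖y‖ ^ κ * ‖u‖ ^ (p - κ)) := by gcongr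
    _ ≤ _ := by gcongr; linarith

/-- Increments of a negative power of the norm along an arbitrary displacement. -/
lemma exists_abs_norm_rpow_sub_le (p κ : ℝ) (hp : p ≤ 0) (hκ₀ : 0 ≤ κ) (hκ₁ : κ ≤ 1) :
    ∃ C : ℝ, 0 < C ∧ ∀ {V : Type} [NormedAddCommGroup V] (u y : V), u ≠ 0 →
      |‖u + y‖ ^ p - ‖u‖ ^ p| ≤ C * (‖y‖ ^ κ * ‖u‖ ^ (p - κ)) +
        {y : V | ‖u‖ / 2 ≤ ‖y‖}.indicator (fun y => ‖u + y‖ ^ p) y := by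
  obtain ⟨C, hC, h⟩ := exists_abs_norm_rpow_sub_le_near p κ hp hκ₁
  refine ⟨C + 2 ^ κ, by positivity, fun {V} _ u y hu => ?_⟩
  have hu0 : 0 < ‖u‖ := norm_pos_iff.2 hu
  rcases lt_or_ge ‖y‖ (‖u‖ / 2) with hy | hy
  · calc _ ≤ C * (‖y‖ ^ κ * ‖u‖ ^ (p - κ)) + 0 := by rw [add_zero]; exact h u y hu hy.le
      _ ≤ _ := by
        gcongr
        · exact le_add_of_nonneg_right (by positivity)
        · exact indicator_nonneg (fun y _ => by positivity) _
  · rw [indicator_of_mem (show y ∈ {y : V | ‖u‖ / 2 ≤ ‖y‖} from hy)]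
    have hy0 : 0 < ‖y‖ := lt_of_lt_of_le (by positivity) hy
    -- For `‖y‖ ≥ ‖u‖ / 2` the unshifted power already obeys the Hölder type bound; only the shifted
    -- one has to survive as the indicator term.
    have h2 : ‖u‖ ^ p ≤ 2 ^ κ * (‖y‖ ^ κ * ‖u‖ ^ (p - κ)) := by
      have h3 : ‖u‖ ^ κ * ‖y‖ ^ (0:ℝ) ≤ 2 ^ (κ - 0) * (‖u‖ ^ (0:ℝ) * ‖y‖ ^ κ) :=
        rpow_mul_rpow_le_of_le hu0 hy0 two_pos (by linarith) hκ₀ (by ring)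
      rw [Real.rpow_zero, Real.rpow_zero, one_mul, mul_one, sub_zero] at h3
      calc ‖u‖ ^ p = ‖u‖ ^ κ * ‖u‖ ^ (p - κ) := by rw [← Real.rpow_add hu0]; congr 1; ring
        _ ≤ 2 ^ κ * ‖y‖ ^ κ * ‖u‖ ^ (p - κ) := by gcongr
        _ = _ := by ring
    have h4 : |‖u + y‖ ^ p - ‖u‖ ^ p| ≤ ‖u + y‖ ^ p + ‖u‖ ^ p := by
      refine (abs_sub _ _).trans (le_of_eq ?_)
      rw [abs_of_nonneg (by positivity), abs_of_nonneg (by positivity)]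
    have h5 : 0 ≤ C * (‖y‖ ^ κ * ‖u‖ ^ (p - κ)) := by positivity
    nlinarith

/-! ### The majorizing kernel and its closed form -/

/-- The kernel of the sum of products of Riesz potentials that majorizes all the kernels below. -/
noncomputable def rieszMajorant {m : ℕ} (δ Θ : ℝ) (x z₁ z₂ : Euc m) : ℝ≥0∞ :=
  ENNReal.ofReal (‖x - z₁‖ ^ (δ - m)) * ENNReal.ofReal (‖x - z₂‖ ^ (Θ - δ - m)) +
  ENNReal.ofReal (‖x - z₁‖ ^ (Θ - δ - m)) * ENNReal.ofReal (‖x - z₂‖ ^ (δ - m)) +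
  ∫⁻ w, ENNReal.ofReal (‖x - w‖ ^ (δ - m)) *
    (ENNReal.ofReal (‖w - z₁‖ ^ (δ - m)) * ENNReal.ofReal (‖w - z₂‖ ^ (Θ - 2 * δ - m)))

/-- Keep only `w` in the ball of radius `d/2` around `z₁`, where `d = ‖z₁ - z₂‖ ≤ 2R`. There the
three distances are at most `2R`, `d/2` and `3d/2`, all exponents are negative, and the ball has
volume comparable to `d^m`. -/
lemma exists_le_lintegral_three_centre {m : ℕ} [NeZero m] {γ s t : ℝ} (hγ : γ < m) (hs : s < m)
    (ht : t < m) :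
    ∃ c : ℝ, 0 < c ∧ ∀ (x z₁ z₂ : Euc m) (R : ℝ), z₁ ≠ z₂ → ‖x - z₁‖ ≤ R → ‖x - z₂‖ ≤ R →
      ENNReal.ofReal (c * (R ^ (γ - m) * ‖z₁ - z₂‖ ^ (s + t - m))) ≤
      ∫⁻ w, ENNReal.ofReal (‖x - w‖ ^ (γ - m)) *
        (ENNReal.ofReal (‖w - z₁‖ ^ (s - m)) * ENNReal.ofReal (‖w - z₂‖ ^ (t - m))) := by
  have := nontrivial_euc m
  set v := (volume (Metric.ball (0 : Euc m) 1)).toReal with hv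
  have hvtop : volume (Metric.ball (0 : Euc m) 1) ≠ ⊤ := measure_ball_lt_top.ne
  have hv0 : 0 < v := ENNReal.toReal_pos (Metric.measure_ball_pos _ _ one_pos).ne' hvtop
  refine ⟨2 ^ (γ - m) * (1 / 2) ^ (s - m) * (3 / 2) ^ (t - m) * (1 / 2) ^ (m : ℝ) * v,
    by positivity, fun x z₁ z₂ R hz h₁ h₂ => ?_⟩
  set d := ‖z₁ - z₂‖ with hd
  have hd0 : 0 < d := norm_pos_iff.2 (sub_ne_zero.2 hz)
  have hdR : d ≤ 2 * R := by
    have : ‖z₁ - z₂‖ ≤ ‖x - z₂‖ + ‖x - z₁‖ := by simpa using norm_sub_le (x - z₂) (x - z₁)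
    linarith
  have hR : 0 < R := by linarith
  have hpt : ∀ w ∈ Metric.ball z₁ (d / 2), w ≠ x → w ≠ z₁ →
      ENNReal.ofReal ((2 * R) ^ (γ - m) * ((1 / 2 * d) ^ (s - m) * (3 / 2 * d) ^ (t - m))) ≤
      ENNReal.ofReal (‖x - w‖ ^ (γ - m)) *
        (ENNReal.ofReal (‖w - z₁‖ ^ (s - m)) * ENNReal.ofReal (‖w - z₂‖ ^ (t - m))) := by
    intro w hw hwx hwz
    rw [Metric.mem_ball, dist_eq_norm] at hw
    rw [← ENNReal.ofReal_mul (by positivity), ← ENNReal.ofReal_mul (by positivity)]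
    apply ENNReal.ofReal_le_ofReal
    have b1 : ‖x - w‖ ≤ ‖x - z₁‖ + ‖w - z₁‖ := by simpa using norm_sub_le (x - z₁) (w - z₁)
    have b2 : ‖w - z₂‖ ≤ ‖w - z₁‖ + ‖z₁ - z₂‖ := by simpa using norm_add_le (w - z₁) (z₁ - z₂)
    have b3 : ‖z₁ - z₂‖ ≤ ‖w - z₂‖ + ‖w - z₁‖ := by simpa using norm_sub_le (w - z₂) (w - z₁)
    have c1 : 0 < ‖x - w‖ := norm_pos_iff.2 (sub_ne_zero.2 hwx.symm)
    have c2 : 0 < ‖w - z₁‖ := norm_pos_iff.2 (sub_ne_zero.2 hwz)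
    have e1 := Real.rpow_le_rpow_of_nonpos c1 (show ‖x - w‖ ≤ 2 * R by linarith)
      (show γ - m ≤ 0 by linarith)
    have e2 := Real.rpow_le_rpow_of_nonpos c2 (show ‖w - z₁‖ ≤ 1 / 2 * d by linarith)
      (show s - m ≤ 0 by linarith)
    have e3 := Real.rpow_le_rpow_of_nonpos (show 0 < ‖w - z₂‖ by linarith)
      (show ‖w - z₂‖ ≤ 3 / 2 * d by linarith) (show t - m ≤ 0 by linarith)
    exact mul_le_mul e1 (mul_le_mul e2 e3 (by positivity) (by positivity)) (by positivity)
      (by positivity)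
  -- `Real.rpow` takes the value `0` at base `0` with a negative exponent, so the lower bound fails
  -- at these two points and has to be read almost everywhere.
  have hae : ∀ᵐ w ∂(volume : Measure (Euc m)), w ≠ x ∧ w ≠ z₁ :=
    (Measure.ae_ne volume x).and (Measure.ae_ne volume z₁)
  calc _ = ∫⁻ w in Metric.ball z₁ (d / 2),
        ENNReal.ofReal ((2 * R) ^ (γ - m) * ((1 / 2 * d) ^ (s - m) * (3 / 2 * d) ^ (t - m))) := by
        rw [setLIntegral_const, Measure.addHaar_ball _ _ (by positivity),
          finrank_euclideanSpace_fin, ← ENNReal.ofReal_toReal hvtop, ← hv,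
          ← ENNReal.ofReal_mul (by positivity), ← ENNReal.ofReal_mul (by positivity)]
        congr 1
        rw [Real.mul_rpow (by norm_num) hR.le, Real.mul_rpow (by norm_num) hd0.le,
          Real.mul_rpow (by norm_num) hd0.le, ← Real.rpow_natCast,
          show d / 2 = 1 / 2 * d by ring, Real.mul_rpow (by norm_num) hd0.le,
          show s + t - (m:ℝ) = (s - m) + (t - m) + m by ring, Real.rpow_add hd0,
          Real.rpow_add hd0]
        ring
    _ ≤ ∫⁻ w in Metric.ball z₁ (d / 2), ENNReal.ofReal (‖x - w‖ ^ (γ - m)) *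
        (ENNReal.ofReal (‖w - z₁‖ ^ (s - m)) * ENNReal.ofReal (‖w - z₂‖ ^ (t - m))) := by
        refine lintegral_mono_ae ?_
        filter_upwards [ae_restrict_of_ae hae, ae_restrict_mem measurableSet_ball] with w hw hwb
        exact hpt w hwb hw.1 hw.2
    _ ≤ _ := setLIntegral_le_lintegral _ _

/-- A closed form minorant of `rieszMajorant`. -/
noncomputable def closedMajorant (m : ℕ) (δ Θ r₁ r₂ d : ℝ) : ℝ :=
  min r₁ r₂ ^ (δ - m) * max r₁ r₂ ^ (Θ - δ - m) + max r₁ r₂ ^ (δ - m) * d ^ (Θ - δ - m)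

/-- The summand with `min` and `max` is one of the two product kernels, depending on which of `z₁`,
`z₂` is closer to `x`. The summand with `d` is the lower bound for the three-centre integral with `γ
= s = δ` and `t = Θ - 2δ`. Kernel estimates thus become inequalities between three lengths. -/
lemma exists_closedMajorant_le {m : ℕ} [NeZero m] {δ Θ : ℝ} (hδm : δ < m)
    (hΘ : Θ - 2 * δ < m) :
    ∃ C : ℝ, 0 < C ∧ ∀ (x z₁ z₂ : Euc m), z₁ ≠ z₂ →
      ENNReal.ofReal (closedMajorant m δ Θ ‖x - z₁‖ ‖x - z₂‖ ‖z₁ - z₂‖) ≤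
        ENNReal.ofReal C * rieszMajorant δ Θ x z₁ z₂ := by
  obtain ⟨c, hc, h⟩ := exists_le_lintegral_three_centre (m := m) hδm hδm hΘ
  refine ⟨1 + c⁻¹, by positivity, fun x z₁ z₂ hz => ?_⟩
  have h' := h x z₁ z₂ (max ‖x - z₁‖ ‖x - z₂‖) hz (le_max_left _ _) (le_max_right _ _)
  rw [show δ + (Θ - 2 * δ) - (m:ℝ) = Θ - δ - m by ring] at h'
  rw [closedMajorant, rieszMajorant, ENNReal.ofReal_add (by positivity) (by positivity)]
  set A := ENNReal.ofReal (‖x - z₁‖ ^ (δ - m)) * ENNReal.ofReal (‖x - z₂‖ ^ (Θ - δ - m))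
  set B := ENNReal.ofReal (‖x - z₁‖ ^ (Θ - δ - m)) * ENNReal.ofReal (‖x - z₂‖ ^ (δ - m))
  set D := ∫⁻ w, ENNReal.ofReal (‖x - w‖ ^ (δ - m)) *
    (ENNReal.ofReal (‖w - z₁‖ ^ (δ - m)) * ENNReal.ofReal (‖w - z₂‖ ^ (Θ - 2 * δ - m)))
  have h1 : ENNReal.ofReal (min ‖x - z₁‖ ‖x - z₂‖ ^ (δ - m) *
      max ‖x - z₁‖ ‖x - z₂‖ ^ (Θ - δ - m)) ≤ A + B := by
    rw [ENNReal.ofReal_mul (by positivity)]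
    rcases le_total ‖x - z₁‖ ‖x - z₂‖ with hr | hr
    · rw [min_eq_left hr, max_eq_right hr]; exact le_self_add
    · rw [min_eq_right hr, max_eq_left hr, mul_comm]; exact le_add_self
  have h2 : ENNReal.ofReal (max ‖x - z₁‖ ‖x - z₂‖ ^ (δ - m) * ‖z₁ - z₂‖ ^ (Θ - δ - m)) ≤
      ENNReal.ofReal c⁻¹ * D := by
    calc _ = ENNReal.ofReal c⁻¹ * ENNReal.ofReal (c * (max ‖x - z₁‖ ‖x - z₂‖ ^ (δ - m) *
          ‖z₁ - z₂‖ ^ (Θ - δ - m))) := by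
          rw [← ENNReal.ofReal_mul (by positivity), inv_mul_cancel_left₀ hc.ne']
      _ ≤ _ := by gcongr
  calc _ ≤ A + B + ENNReal.ofReal c⁻¹ * D := add_le_add h1 h2
    _ ≤ ENNReal.ofReal (1 + c⁻¹) * (A + B) + ENNReal.ofReal (1 + c⁻¹) * D := by
        refine add_le_add (le_mul_of_one_le_left (zero_le) ?_) ?_
        · rw [← ENNReal.ofReal_one]; exact ENNReal.ofReal_le_ofReal (by simp [hc.le])
        · gcongr; linarith
    _ = _ := by rw [mul_add (ENNReal.ofReal _) (A + B) D]

/-- Lower the exponent of `r` to `δ - m` in favour of the maximum, then replace `r` by the minimum.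
Any monomial of the right degree that is not too singular in `r` is therefore admissible. -/
lemma rpow_mul_max_rpow_le_closedMajorant {m : ℕ} {δ Θ r₁ r₂ d r p q : ℝ} (h₁ : 0 < r₁)
    (h₂ : 0 < r₂) (hd : 0 ≤ d) (hr : r = r₁ ∨ r = r₂) (hδ : δ - m ≤ 0) (hp : δ - m ≤ p)
    (hpq : p + q = Θ - 2 * m) :
    r ^ p * max r₁ r₂ ^ q ≤ closedMajorant m δ Θ r₁ r₂ d := by
  have hR : 0 < max r₁ r₂ := lt_max_of_lt_left h₁
  have hmin : 0 < min r₁ r₂ := lt_min h₁ h₂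
  have hr0 : 0 < r := by rcases hr with rfl | rfl <;> assumption
  have hrR : r ≤ max r₁ r₂ := by rcases hr with rfl | rfl <;> simp
  have hrm : min r₁ r₂ ≤ r := by rcases hr with rfl | rfl <;> simp
  have := rpow_mul_rpow_le_of_le (q := q) (p' := δ - m) (q' := Θ - δ - m) hr0 hR one_pos
    (by linarith) hp (by linarith)
  rw [Real.one_rpow, one_mul] at this
  calc _ ≤ _ := this
    _ ≤ min r₁ r₂ ^ (δ - m) * max r₁ r₂ ^ (Θ - δ - m) :=
      mul_le_mul_of_nonneg_right (Real.rpow_le_rpow_of_nonpos hmin hrm hδ) (by positivity)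
    _ ≤ _ := le_add_of_nonneg_right (by positivity)

/-- The analogue for the distance `d` of `z₁` and `z₂`, which is at most twice the maximum; it lands
in the second summand. -/
lemma rpow_mul_max_rpow_le_closedMajorant' {m : ℕ} {δ Θ r₁ r₂ d p q : ℝ} (h₁ : 0 < r₁)
    (h₂ : 0 < r₂) (hd : 0 < d) (hdr : d ≤ r₁ + r₂) (hp : Θ - δ - m ≤ p)
    (hpq : p + q = Θ - 2 * m) :
    d ^ p * max r₁ r₂ ^ q ≤ 2 ^ (p - (Θ - δ - m)) * closedMajorant m δ Θ r₁ r₂ d := by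
  have hR : 0 < max r₁ r₂ := lt_max_of_lt_left h₁
  have := rpow_mul_rpow_le_of_le (q := q) (p' := Θ - δ - m) (q' := δ - m) hd hR two_pos
    (by linarith [le_max_left r₁ r₂, le_max_right r₁ r₂]) hp (by linarith)
  refine this.trans (mul_le_mul_of_nonneg_left ?_ (by positivity))
  rw [mul_comm, closedMajorant]
  have : 0 < min r₁ r₂ := lt_min h₁ h₂
  exact le_add_of_nonneg_left (by positivity)

lemma closedMajorant_nonneg {m : ℕ} {δ Θ r₁ r₂ d : ℝ} (h₁ : 0 ≤ r₁) (h₂ : 0 ≤ r₂) (hd : 0 ≤ d) :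
    0 ≤ closedMajorant m δ Θ r₁ r₂ d := by
  have : 0 ≤ min r₁ r₂ := le_min h₁ h₂
  have : 0 ≤ max r₁ r₂ := le_max_of_le_left h₁
  unfold closedMajorant; positivity

/-! ### The commutator kernel -/

/-- The kernel of the commutator of a fractional Laplacian of order less than one with a
multiplication operator. -/
lemma exists_commutatorKernel_le {m : ℕ} {β τ δ : ℝ} (hβ : 0 < β)
    (hτm : τ < m) (hδβ : δ ≤ 1 - β) (hδτ : δ ≤ τ) (hδ : 0 < δ) :
    ∃ C : ℝ, 0 < C ∧ ∀ (x z₁ z₂ : Euc m), z₁ ≠ x → z₂ ≠ x → z₁ ≠ z₂ →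
      |‖x - z₂‖ ^ (τ - m) - ‖z₁ - z₂‖ ^ (τ - m)| * ‖x - z₁‖ ^ (-β - m) ≤
        C * closedMajorant m δ (τ - β) ‖x - z₁‖ ‖x - z₂‖ ‖z₁ - z₂‖ := by
  obtain ⟨C, hC, h⟩ := exists_abs_norm_rpow_sub_le_near (τ - m) 1 (by linarith) le_rfl
  refine ⟨C + (1 / 2) ^ (-β - m : ℝ) + (1 / 2) ^ (-β - m : ℝ) * 2 ^ (τ - m - (τ - β - δ - m)),
    by positivity, fun x z₁ z₂ h₁ h₂ h₁₂ => ?_⟩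
  have e1 : 0 < ‖x - z₁‖ := norm_pos_iff.2 (sub_ne_zero.2 h₁.symm)
  have e2 : 0 < ‖x - z₂‖ := norm_pos_iff.2 (sub_ne_zero.2 h₂.symm)
  have ed : 0 < ‖z₁ - z₂‖ := norm_pos_iff.2 (sub_ne_zero.2 h₁₂)
  have hd : ‖z₁ - z₂‖ ≤ ‖x - z₁‖ + ‖x - z₂‖ := by
    have : ‖z₁ - z₂‖ ≤ ‖x - z₂‖ + ‖x - z₁‖ := by simpa using norm_sub_le (x - z₂) (x - z₁)
    linarith
  set M := closedMajorant m δ (τ - β) ‖x - z₁‖ ‖x - z₂‖ ‖z₁ - z₂‖ with hM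
  have hM0 : 0 ≤ M := closedMajorant_nonneg e1.le e2.le ed.le
  -- If `z₁` is close to `x`, the mean value estimate gains a factor `‖x - z₁‖ / ‖x - z₂‖` and the
  -- exponent of `‖x - z₁‖` becomes `1 - β - m ≥ δ - m`. Otherwise `‖x - z₁‖` is at least half the
  -- maximum and the two powers are bounded separately.
  rcases le_or_gt ‖x - z₁‖ (‖x - z₂‖ / 2) with hr | hr
  · have h3 := h (x - z₂) (z₁ - x) (sub_ne_zero.2 h₂.symm) (by rwa [norm_sub_rev z₁ x])
    rw [show x - z₂ + (z₁ - x) = z₁ - z₂ by abel, abs_sub_comm, norm_sub_rev z₁ x,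
      Real.rpow_one] at h3
    have h4 : ‖x - z₁‖ ^ (1 - β - m) * max ‖x - z₁‖ ‖x - z₂‖ ^ (τ - 1 - m) ≤ M :=
      rpow_mul_max_rpow_le_closedMajorant e1 e2 ed.le (Or.inl rfl) (by linarith) (by linarith)
        (by ring)
    rw [max_eq_right (by linarith)] at h4
    calc _ ≤ C * (‖x - z₁‖ * ‖x - z₂‖ ^ (τ - m - 1)) * ‖x - z₁‖ ^ (-β - m) := by gcongr
      _ = C * (‖x - z₁‖ ^ (1 - β - m) * ‖x - z₂‖ ^ (τ - 1 - m)) := by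
        rw [show 1 - β - (m:ℝ) = 1 + (-β - m) by ring, Real.rpow_add e1, Real.rpow_one,
          show τ - m - 1 = τ - 1 - (m:ℝ) by ring]
        ring
      _ ≤ C * M := by gcongr
      _ ≤ _ := by
        rw [add_assoc]; exact mul_le_mul_of_nonneg_right (le_add_of_nonneg_right (by positivity)) hM0
  · set R := max ‖x - z₁‖ ‖x - z₂‖ with hRdef
    have hR : 0 < R := lt_max_of_lt_left e1
    have h3 : 1 / 2 * R ≤ ‖x - z₁‖ := by
      rcases max_choice ‖x - z₁‖ ‖x - z₂‖ with h | h <;> rw [hRdef, h] <;> linarith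
    have h4 : ‖x - z₁‖ ^ (-β - m) ≤ (1 / 2) ^ (-β - m : ℝ) * R ^ (-β - m) := by
      rw [← Real.mul_rpow (by norm_num) hR.le]
      exact Real.rpow_le_rpow_of_nonpos (by positivity) h3
        (by linarith [Nat.cast_nonneg (α := ℝ) m])
    have h5 : ‖x - z₂‖ ^ (τ - m) * R ^ (-β - m) ≤ M :=
      rpow_mul_max_rpow_le_closedMajorant e1 e2 ed.le (Or.inr rfl) (by linarith) (by linarith)
        (by ring)
    have h6 : ‖z₁ - z₂‖ ^ (τ - m) * R ^ (-β - m) ≤ 2 ^ (τ - m - (τ - β - δ - m)) * M :=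
      rpow_mul_max_rpow_le_closedMajorant' e1 e2 ed hd (by linarith) (by ring)
    have h7 : |‖x - z₂‖ ^ (τ - m) - ‖z₁ - z₂‖ ^ (τ - m)| ≤
        ‖x - z₂‖ ^ (τ - m) + ‖z₁ - z₂‖ ^ (τ - m) := by
      refine (abs_sub _ _).trans (le_of_eq ?_)
      rw [abs_of_nonneg (by positivity), abs_of_nonneg (by positivity)]
    calc _ ≤ (‖x - z₂‖ ^ (τ - m) + ‖z₁ - z₂‖ ^ (τ - m)) *
          ((1 / 2) ^ (-β - m : ℝ) * R ^ (-β - m)) := by gcongr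
      _ = (1 / 2) ^ (-β - m : ℝ) * (‖x - z₂‖ ^ (τ - m) * R ^ (-β - m) +
          ‖z₁ - z₂‖ ^ (τ - m) * R ^ (-β - m)) := by ring
      _ ≤ (1 / 2) ^ (-β - m : ℝ) * (M + 2 ^ (τ - m - (τ - β - δ - m)) * M) := by gcongr
      _ ≤ C * M + (1 / 2) ^ (-β - m : ℝ) * (M + 2 ^ (τ - m - (τ - β - δ - m)) * M) :=
          le_add_of_nonneg_left (by positivity)
      _ = _ := by ring

/-! ### Cancellation of order `2N` through holomorphic extension in the step -/

/-- Cauchy estimates for iterated forward differences of a bounded holomorphic function. -/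
lemma norm_fwdDiff_iter_le {L : ℝ} (hL : 0 < L) (n : ℕ) :
    ∀ {ρ M : ℝ} {G : ℂ → ℂ}, DifferentiableOn ℂ G (Metric.ball 0 ρ) →
      (∀ u ∈ Metric.ball (0 : ℂ) ρ, ‖G u‖ ≤ M) → ∀ w : ℂ, ‖w‖ + n * (1 + L) < ρ →
      ‖(fwdDiff (1 : ℂ))^[n] G w‖ ≤ M / L ^ n := by
  induction n with
  | zero =>
    intro ρ M G _ hM w hw
    simpa using hM w (by simpa using hw)
  | succ n ih =>
    intro ρ M G hG hM w hw
    rw [Function.iterate_succ_apply]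
    -- The Cauchy estimate costs `L` of the radius and the mean value inequality along `[u, u + 1]`
    -- costs `1`, which is the loss of `1 + L` per difference.
    have hderiv : ∀ v ∈ Metric.ball (0 : ℂ) (ρ - L), ‖deriv G v‖ ≤ M / L := by
      intro v hv
      have hsub : Metric.closedBall v L ⊆ Metric.ball (0 : ℂ) ρ := by
        intro y hy
        rw [Metric.mem_ball] at hv ⊢
        rw [Metric.mem_closedBall] at hy
        linarith [dist_triangle y v 0]
      exact Complex.norm_deriv_le_of_forall_mem_sphere_norm_le hL (hG.diffContOnCl_ball hsub)
        fun z hz => hM z (hsub (Metric.sphere_subset_closedBall hz))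
    have hsub : Metric.ball (0 : ℂ) (ρ - 1 - L) ⊆ Metric.ball 0 (ρ - L) :=
      Metric.ball_subset_ball (by linarith)
    have hsub' : Metric.ball (0 : ℂ) (ρ - L) ⊆ Metric.ball 0 ρ :=
      Metric.ball_subset_ball (by linarith)
    have hadd : ∀ u ∈ Metric.ball (0 : ℂ) (ρ - 1 - L), u + 1 ∈ Metric.ball (0 : ℂ) (ρ - L) := by
      intro u hu
      simp only [Metric.mem_ball, dist_zero_right] at hu ⊢
      calc ‖u + 1‖ ≤ ‖u‖ + 1 := by simpa using norm_add_le u 1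
        _ < _ := by linarith
    have h1 : DifferentiableOn ℂ (fwdDiff (1 : ℂ) G) (Metric.ball 0 (ρ - 1 - L)) := by
      refine DifferentiableOn.sub ?_ (hG.mono (hsub.trans hsub'))
      exact hG.comp (by fun_prop) fun u hu => hsub' (hadd u hu)
    have h2 : ∀ u ∈ Metric.ball (0 : ℂ) (ρ - 1 - L), ‖fwdDiff (1 : ℂ) G u‖ ≤ M / L := by
      intro u hu
      have := Convex.norm_image_sub_le_of_norm_deriv_le (𝕜 := ℂ) (f := G)
        (s := Metric.ball (0 : ℂ) (ρ - L)) (x := u) (y := u + 1) (C := M / L)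
        (fun v hv => (hG v (hsub' hv)).differentiableAt (Metric.isOpen_ball.mem_nhds (hsub' hv)))
        hderiv (convex_ball _ _) (hsub hu) (hadd u hu)
      simpa [fwdDiff] using this
    have := ih h1 h2 w (by push_cast at hw; linarith)
    rwa [div_div, ← pow_succ'] at this

/-- The complexification of `t ↦ ‖v + t • h‖ ^ 2`. -/
noncomputable def normSqPoly {m : ℕ} (v h : Euc m) (u : ℂ) : ℂ :=
  (‖v‖ ^ 2 : ℝ) + u * (2 * inner ℝ v h : ℝ) + u ^ 2 * (‖h‖ ^ 2 : ℝ)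

lemma normSqPoly_ofReal {m : ℕ} (v h : Euc m) (t : ℝ) :
    normSqPoly v h t = ((‖v + t • h‖ ^ 2 : ℝ) : ℂ) := by
  rw [norm_add_sq_real, norm_smul, inner_smul_right, normSqPoly, mul_pow, Real.norm_eq_abs, sq_abs]
  push_cast; ring

/-- By Cauchy–Schwarz the deviation is at most `(2 · 1/4 + 1/16) ‖v‖² = 9/16 ‖v‖²`. So the
polynomial stays in the right half plane, where the principal branch of its powers is holomorphic,
and its modulus stays above `3/8 ‖v‖²`. -/
lemma norm_normSqPoly_sub_le {m : ℕ} {v h : Euc m} {u : ℂ} (hu : ‖u‖ * ‖h‖ ≤ ‖v‖ / 4) :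
    ‖normSqPoly v h u - (‖v‖ ^ 2 : ℝ)‖ ≤ 5 / 8 * ‖v‖ ^ 2 := by
  have e : normSqPoly v h u - (‖v‖ ^ 2 : ℝ) =
      u * (2 * inner ℝ v h : ℝ) + u ^ 2 * (‖h‖ ^ 2 : ℝ) := by rw [normSqPoly]; ring
  have h1 : |inner ℝ v h| ≤ ‖v‖ * ‖h‖ := abs_real_inner_le_norm v h
  rw [e]
  refine (norm_add_le _ _).trans ?_
  rw [norm_mul, norm_mul, Complex.norm_real, Complex.norm_real, norm_pow, Real.norm_eq_abs,
    Real.norm_eq_abs, abs_mul, abs_two, abs_of_nonneg (sq_nonneg ‖h‖)]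
  have h2 : ‖u‖ * (2 * |inner ℝ v h|) ≤ 2 * ‖v‖ * (‖u‖ * ‖h‖) := by
    nlinarith [norm_nonneg u]
  have h3 : ‖u‖ ^ 2 * ‖h‖ ^ 2 ≤ (‖v‖ / 4) ^ 2 := by
    rw [← mul_pow]; gcongr
  nlinarith [norm_nonneg v, mul_nonneg (norm_nonneg u) (norm_nonneg h)]

lemma re_normSqPoly_pos {m : ℕ} {v h : Euc m} {u : ℂ} (hv : v ≠ 0) (hu : ‖u‖ * ‖h‖ ≤ ‖v‖ / 4) :
    0 < (normSqPoly v h u).re := by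
  have h1 := (Complex.abs_re_le_norm _).trans (norm_normSqPoly_sub_le hu)
  rw [Complex.sub_re, Complex.ofReal_re, abs_le] at h1
  have : 0 < ‖v‖ ^ 2 := by positivity
  linarith

lemma norm_normSqPoly_cpow_le {m : ℕ} {v h : Euc m} {u : ℂ} {p : ℝ} (hp : p ≤ 0) (hv : v ≠ 0)
    (hu : ‖u‖ * ‖h‖ ≤ ‖v‖ / 4) :
    ‖normSqPoly v h u ^ ((p / 2 : ℝ) : ℂ)‖ ≤ (3 / 8) ^ (p / 2) * ‖v‖ ^ p := by
  have hv0 : 0 < ‖v‖ := norm_pos_iff.2 hv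
  have hne : normSqPoly v h u ≠ 0 := fun h0 => by
    have := re_normSqPoly_pos hv hu
    rw [h0] at this; simp at this
  rw [Complex.norm_cpow_of_ne_zero hne]
  simp only [Complex.ofReal_re, Complex.ofReal_im, mul_zero, Real.exp_zero, div_one]
  have h1 := norm_normSqPoly_sub_le hu
  have h2 : ‖v‖ ^ 2 ≤ ‖normSqPoly v h u‖ + 5 / 8 * ‖v‖ ^ 2 := by
    have h3 := norm_sub_le (normSqPoly v h u) (normSqPoly v h u - (‖v‖ ^ 2 : ℝ))
    rw [sub_sub_cancel, Complex.norm_real, Real.norm_of_nonneg (by positivity)] at h3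
    linarith
  have h4 : ‖v‖ ^ p = (‖v‖ ^ 2) ^ (p / 2) := by
    rw [← Real.rpow_natCast, ← Real.rpow_mul hv0.le]; congr 1; push_cast; ring
  rw [h4, ← Real.mul_rpow (by norm_num) (by positivity)]
  exact Real.rpow_le_rpow_of_nonpos (by positivity) (by linarith) (by linarith)

lemma normSqPoly_cpow_ofReal {m : ℕ} (v h : Euc m) (p t : ℝ) :
    normSqPoly v h t ^ ((p / 2 : ℝ) : ℂ) = ((‖v + t • h‖ ^ p : ℝ) : ℂ) := by
  rw [normSqPoly_ofReal, ← Complex.ofReal_cpow (by positivity), ← Real.rpow_natCast,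
    ← Real.rpow_mul (norm_nonneg _)]
  congr 2; push_cast; ring

lemma differentiableOn_normSqPoly_cpow {m : ℕ} {v h : Euc m} (p : ℝ) (hv : v ≠ 0) {ρ : ℝ}
    (hρ : ρ * ‖h‖ ≤ ‖v‖ / 4) :
    DifferentiableOn ℂ (fun u => normSqPoly v h u ^ ((p / 2 : ℝ) : ℂ)) (Metric.ball 0 ρ) := by
  intro u hu
  rw [Metric.mem_ball, dist_zero_right] at hu
  have hu' : ‖u‖ * ‖h‖ ≤ ‖v‖ / 4 := le_trans (by gcongr) hρ
  refine DifferentiableAt.differentiableWithinAt ?_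
  refine DifferentiableAt.cpow ?_ (by fun_prop) (Or.inl (re_normSqPoly_pos hv hu'))
  unfold normSqPoly; fun_prop

/-- The coefficients of the symmetric difference of order `2 * N`. -/
def symmDiffCoeff (N i : ℕ) : ℝ := (-1) ^ i * (2 * N).choose i

lemma sum_symmDiffCoeff_eq_fwdDiff (N : ℕ) (G : ℂ → ℂ) :
    ∑ i ∈ Finset.range (2 * N + 1), (symmDiffCoeff N i : ℂ) * G ((i - N : ℝ) : ℂ) =
      (fwdDiff (1 : ℂ))^[2 * N] G (-N) := by
  rw [fwdDiff_iter_eq_sum_shift]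
  refine Finset.sum_congr rfl fun i hi => ?_
  have hi' : i ≤ 2 * N := by simpa [Nat.lt_succ_iff] using hi
  have h1 : ((-1 : ℤ)) ^ (2 * N - i) = (-1) ^ i := by
    have : Even (2 * N - i) ↔ Even i := by
      rw [Nat.even_sub hi']; simp
    rcases Nat.even_or_odd i with h | h
    · rw [(this.2 h).neg_one_pow, h.neg_one_pow]
    · have h' : Odd (2 * N - i) := by
        rw [← Nat.not_even_iff_odd, this, Nat.not_even_iff_odd]; exact h
      rw [h'.neg_one_pow, h.neg_one_pow]
  rw [h1, zsmul_eq_mul, symmDiffCoeff]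
  push_cast
  congr 2
  rw [nsmul_eq_mul]; ring

/-- The sum is the `2N`-th forward difference at `-N` of `G(u) = (φ(u) - φ(0)) (ψ(u) - ψ(0))`, with
`φ`, `ψ` the holomorphic extensions of the two powers along `v + u h`. On the disc of radius `ρ =
‖v₁‖ / (8‖h‖)` the first factor is of size `‖v₁‖^p₁`. The second vanishes at `0` and is bounded on a
disc of radius comparable to `‖v₂‖ / ‖h‖`, so the Schwarz lemma gains `‖v₁‖ / ‖v₂‖`. Cauchy
estimates at scale `ρ` supply `(‖h‖ / ‖v₁‖)^(2N)`. -/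
lemma exists_sum_symmDiffCoeff_mul_le {m : ℕ} {N : ℕ} (hN : 0 < N) {p₁ p₂ : ℝ} (hp₁ : p₁ ≤ 0)
    (hp₂ : p₂ ≤ 0) :
    ∃ C : ℝ, 0 < C ∧ ∀ (v₁ v₂ h : Euc m), v₁ ≠ 0 → ‖v₁‖ ≤ ‖v₂‖ → h ≠ 0 →
      ‖h‖ < 1 / (40 * N) * ‖v₁‖ →
      |∑ i ∈ Finset.range (2 * N + 1), symmDiffCoeff N i *
        ((‖v₁ + (i - N : ℝ) • h‖ ^ p₁ - ‖v₁‖ ^ p₁) * (‖v₂ + (i - N : ℝ) • h‖ ^ p₂ - ‖v₂‖ ^ p₂))| ≤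
      C * (‖v₁‖ ^ (p₁ + 1 - 2 * N) * ‖v₂‖ ^ (p₂ - 1)) * ‖h‖ ^ (2 * N : ℝ) := by
  set c₁ : ℝ := (3 / 8) ^ (p₁ / 2) with hc₁
  set c₂ : ℝ := (3 / 8) ^ (p₂ / 2) with hc₂
  refine ⟨2 * c₁ * (2 * c₂) * (64 * N) ^ (2 * N), by positivity, fun v₁ v₂ h hv₁ h12 hh hhv => ?_⟩
  have hN0 : (1:ℝ) ≤ N := by exact_mod_cast hN
  have e1 : 0 < ‖v₁‖ := norm_pos_iff.2 hv₁
  have e2 : 0 < ‖v₂‖ := e1.trans_le h12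
  have hv₂ : v₂ ≠ 0 := norm_pos_iff.1 e2
  have eh : 0 < ‖h‖ := norm_pos_iff.2 hh
  set φ : ℂ → ℂ := fun u => normSqPoly v₁ h u ^ ((p₁ / 2 : ℝ) : ℂ) with hφ
  set ψ : ℂ → ℂ := fun u => normSqPoly v₂ h u ^ ((p₂ / 2 : ℝ) : ℂ) with hψ
  set G : ℂ → ℂ := fun u => (φ u - φ 0) * (ψ u - ψ 0) with hG
  set ρ := ‖v₁‖ / (8 * ‖h‖) with hρdef
  set ρ' := ‖v₂‖ / (4 * ‖h‖) with hρ'def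
  have hρ0 : 0 < ρ := by positivity
  have hρ'0 : 0 < ρ' := by positivity
  have hρh : ρ * ‖h‖ = ‖v₁‖ / 8 := by rw [hρdef]; field_simp
  have hρ'h : ρ' * ‖h‖ = ‖v₂‖ / 4 := by rw [hρ'def]; field_simp
  have hρρ' : ρ ≤ ρ' := by
    rw [hρdef, hρ'def, div_le_div_iff₀ (by positivity) (by positivity)]
    nlinarith
  have hNρ : 4 * N < ρ := by
    rw [hρdef, lt_div_iff₀ (by positivity)]
    rw [div_mul_eq_mul_div, one_mul, lt_div_iff₀ (by positivity)] at hhv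
    nlinarith
  have hφd : DifferentiableOn ℂ φ (Metric.ball 0 ρ) :=
    differentiableOn_normSqPoly_cpow p₁ hv₁ (by rw [hρh]; linarith)
  have hψd : DifferentiableOn ℂ ψ (Metric.ball 0 ρ') :=
    differentiableOn_normSqPoly_cpow p₂ hv₂ (by rw [hρ'h])
  have hφb : ∀ u ∈ Metric.ball (0 : ℂ) ρ, ‖φ u‖ ≤ c₁ * ‖v₁‖ ^ p₁ := by
    intro u hu
    rw [Metric.mem_ball, dist_zero_right] at hu
    refine norm_normSqPoly_cpow_le hp₁ hv₁ ?_
    have : ‖u‖ * ‖h‖ ≤ ρ * ‖h‖ := by gcongr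
    linarith
  have hψb : ∀ u ∈ Metric.ball (0 : ℂ) ρ', ‖ψ u‖ ≤ c₂ * ‖v₂‖ ^ p₂ := by
    intro u hu
    rw [Metric.mem_ball, dist_zero_right] at hu
    refine norm_normSqPoly_cpow_le hp₂ hv₂ ?_
    have : ‖u‖ * ‖h‖ ≤ ρ' * ‖h‖ := by gcongr
    linarith
  have h0ρ : (0 : ℂ) ∈ Metric.ball (0 : ℂ) ρ := Metric.mem_ball_self hρ0
  have h0ρ' : (0 : ℂ) ∈ Metric.ball (0 : ℂ) ρ' := Metric.mem_ball_self hρ'0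
  have hψs : ∀ u ∈ Metric.ball (0 : ℂ) ρ, ‖ψ u - ψ 0‖ ≤ 2 * c₂ * (‖v₁‖ * ‖v₂‖ ^ (p₂ - 1)) := by
    intro u hu
    have hu' : u ∈ Metric.ball (0 : ℂ) ρ' := Metric.ball_subset_ball hρρ' hu
    have := Complex.dist_le_div_mul_dist_of_mapsTo_ball (R₂ := 2 * (c₂ * ‖v₂‖ ^ p₂)) hψd
      (fun w hw => by
        rw [Metric.mem_closedBall, dist_eq_norm]
        refine (norm_sub_le _ _).trans ?_
        linarith [hψb w hw, hψb 0 h0ρ']) hu'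
    rw [dist_eq_norm, dist_zero_right] at this
    rw [Metric.mem_ball, dist_zero_right] at hu
    refine this.trans ?_
    have h3 : ‖u‖ / ρ' ≤ ‖v₁‖ / ‖v₂‖ := by
      calc ‖u‖ / ρ' ≤ ρ / ρ' := by gcongr
        _ = 1 / 2 * (‖v₁‖ / ‖v₂‖) := by rw [hρdef, hρ'def]; field_simp; norm_num
        _ ≤ _ := by
          have : 0 ≤ ‖v₁‖ / ‖v₂‖ := by positivity
          linarith
    calc 2 * (c₂ * ‖v₂‖ ^ p₂) / ρ' * ‖u‖ = 2 * (c₂ * ‖v₂‖ ^ p₂) * (‖u‖ / ρ') := by ring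
      _ ≤ 2 * (c₂ * ‖v₂‖ ^ p₂) * (‖v₁‖ / ‖v₂‖) := by gcongr
      _ = _ := by rw [Real.rpow_sub_one e2.ne']; ring
  set M := 2 * (c₁ * ‖v₁‖ ^ p₁) * (2 * c₂ * (‖v₁‖ * ‖v₂‖ ^ (p₂ - 1))) with hM
  have hGd : DifferentiableOn ℂ G (Metric.ball 0 ρ) :=
    (hφd.sub_const _).mul ((hψd.mono (Metric.ball_subset_ball hρρ')).sub_const _)
  have hGb : ∀ u ∈ Metric.ball (0 : ℂ) ρ, ‖G u‖ ≤ M := by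
    intro u hu
    rw [hG, norm_mul]
    refine mul_le_mul ?_ (hψs u hu) (norm_nonneg _) (by positivity)
    refine (norm_sub_le _ _).trans ?_
    linarith [hφb u hu, hφb 0 h0ρ]
  -- The radius needed is `N + 2N (1 + L)`. With `L = ρ / (8N)` this is `3N + ρ/4`, which is less
  -- than `ρ` exactly when `4N < ρ`; the smallness of `h` ensures it.
  have key := norm_fwdDiff_iter_le (L := ρ / (8 * N)) (by positivity) (2 * N) hGd hGb (-N) (by
    rw [norm_neg, Complex.norm_natCast]
    push_cast
    have : (2 * N : ℝ) * (ρ / (8 * N)) = ρ / 4 := by field_simp; norm_num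
    rw [mul_add, this]
    linarith)
  rw [← sum_symmDiffCoeff_eq_fwdDiff] at key
  have e0 : ∀ (v : Euc m) (p : ℝ), normSqPoly v h 0 ^ ((p / 2 : ℝ) : ℂ) = ((‖v‖ ^ p : ℝ) : ℂ) := by
    intro v p
    have := normSqPoly_cpow_ofReal v h p 0
    simpa using this
  have hsum : ∑ i ∈ Finset.range (2 * N + 1), (symmDiffCoeff N i : ℂ) * G ((i - N : ℝ) : ℂ) =
      ((∑ i ∈ Finset.range (2 * N + 1), symmDiffCoeff N i *
        ((‖v₁ + (i - N : ℝ) • h‖ ^ p₁ - ‖v₁‖ ^ p₁) *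
          (‖v₂ + (i - N : ℝ) • h‖ ^ p₂ - ‖v₂‖ ^ p₂)) : ℝ) : ℂ) := by
    rw [Complex.ofReal_sum]
    refine Finset.sum_congr rfl fun i _ => ?_
    simp only [hG, hφ, hψ]
    rw [normSqPoly_cpow_ofReal, normSqPoly_cpow_ofReal, e0, e0]
    push_cast; ring
  rw [hsum, Complex.norm_real, Real.norm_eq_abs] at key
  refine key.trans (le_of_eq ?_)
  rw [hM, hρdef, Real.rpow_sub e1, Real.rpow_add e1, Real.rpow_one]
  have r1 : ‖v₁‖ ^ (2 * N : ℝ) = ‖v₁‖ ^ (2 * N) := by rw [← Real.rpow_natCast]; push_cast; rfl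
  have r2 : ‖h‖ ^ (2 * N : ℝ) = ‖h‖ ^ (2 * N) := by rw [← Real.rpow_natCast]; push_cast; rfl
  rw [r1, r2, div_div, div_pow, mul_pow (8 * ‖h‖), mul_pow 8 ‖h‖, mul_pow 64 (N:ℝ),
    mul_pow 8 (N:ℝ), show (64:ℝ) ^ (2 * N) = 8 ^ (2 * N) * 8 ^ (2 * N) by
      rw [← mul_pow]; norm_num]
  field_simp

/-! ### The kernel of the Leibniz remainder -/

/-- For steps at least comparable to `‖v₁‖` the increment at `v₁` is bounded by the sum of its two
powers, and only the increment at `v₂` is exploited, with a Hölder exponent `κ`. Of the four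
products, three integrate to monomials in `‖v₁‖`, `‖v₂‖`. The product of both shifted powers,
restricted to `‖y‖ ≥ ‖v₂‖ / 2`, leaves the three-centre integral. -/
lemma exists_lintegral_diff_mul_diff_le {m : ℕ} [NeZero m] {α τ₁ τ₂ δ γ s t c : ℝ}
    (hc : 0 < c) (hα : 0 < α) (hτ₁ : 0 < τ₁) (hτ₂ : 0 < τ₂) (hτ₁m : τ₁ < m) (hτ₂m : τ₂ < m)
    (hτ₁α : τ₁ ≤ α) (hδ : 0 < δ) (hδ₁ : δ < τ₁) (hδ₂ : δ ≤ 1 + τ₁ - α) (hs : s ≤ τ₁)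
    (ht : t ≤ τ₂) (hst : γ + s + t = τ₁ + τ₂ - α) :
    ∃ C : ℝ, 0 < C ∧ ∀ (v₁ v₂ : Euc m), v₁ ≠ 0 → ‖v₁‖ ≤ ‖v₂‖ →
      ∫⁻ y in {y : Euc m | c * ‖v₁‖ ≤ ‖y‖}, ENNReal.ofReal
        (|‖v₁ + y‖ ^ (τ₁ - m) - ‖v₁‖ ^ (τ₁ - m)| * |‖v₂ + y‖ ^ (τ₂ - m) - ‖v₂‖ ^ (τ₂ - m)| *
          ‖y‖ ^ (-α - m)) ≤
      ENNReal.ofReal (C * (‖v₁‖ ^ (δ - m) * ‖v₂‖ ^ (τ₁ + τ₂ - α - δ - m))) +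
      ENNReal.ofReal C * ∫⁻ y : Euc m, ENNReal.ofReal
        (‖y‖ ^ (γ - m) * (‖v₁ + y‖ ^ (s - m) * ‖v₂ + y‖ ^ (t - m))) := by
  -- Then `α - κ = τ₁ - δ` is positive, so the tails converge, and they produce exactly
  -- `‖v₁‖^(δ-m)`. The hypotheses `τ₁ ≤ α` and `δ ≤ 1 + τ₁ - α` put `κ` into `[0, 1]`.
  set κ := α - τ₁ + δ with hκ
  obtain ⟨C₀, hC₀, hD⟩ := exists_abs_norm_rpow_sub_le (τ₂ - m) κ (by linarith) (by linarith)
    (by linarith)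
  obtain ⟨C₁, hC₁, h₁⟩ := exists_lintegral_two_centre_le (m := m) hτ₁ hτ₁m.le
    (show 0 < α - κ by linarith)
  obtain ⟨C₂, hC₂, h₂⟩ := exists_lintegral_compl_ball_le (m := m) (show 0 < α - κ by linarith)
  obtain ⟨C₃, hC₃, h₃⟩ := exists_lintegral_two_centre_le (m := m) hτ₂ hτ₂m.le hα
  set A := C₀ * C₁ * c ^ (δ - m) + C₀ * C₂ * c ^ (-(α - κ)) + C₃ * (1 / 2) ^ (τ₂ - α - m) with hA
  have hA0 : 0 < A := by positivity
  set B := (3 : ℝ) ^ (τ₁ - s + (τ₂ - t)) with hB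
  have hB0 : 0 < B := by positivity
  refine ⟨A + B, by positivity, fun v₁ v₂ hv₁ h12 => ?_⟩
  have e1 : 0 < ‖v₁‖ := norm_pos_iff.2 hv₁
  have e2 : 0 < ‖v₂‖ := e1.trans_le h12
  have hv₂ : v₂ ≠ 0 := norm_pos_iff.1 e2
  set S := {y : Euc m | c * ‖v₁‖ ≤ ‖y‖} with hS
  have hSm : MeasurableSet S := measurableSet_le (by fun_prop) (by fun_prop)
  set U := {y : Euc m | ‖v₂‖ / 2 ≤ ‖y‖} with hU
  have hUm : MeasurableSet U := measurableSet_le (by fun_prop) (by fun_prop)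
  set f₁ : Euc m → ℝ := fun y =>
    C₀ * ‖v₂‖ ^ (τ₂ - m - κ) * (‖v₁ + y‖ ^ (τ₁ - m) * ‖y‖ ^ (-(α - κ) - m)) with hf₁
  set f₂ : Euc m → ℝ := fun y =>
    C₀ * ‖v₂‖ ^ (τ₂ - m - κ) * ‖v₁‖ ^ (τ₁ - m) * ‖y‖ ^ (-(α - κ) - m) with hf₂
  set f₃ : Euc m → ℝ := fun y =>
    ‖v₁‖ ^ (τ₁ - m) * (‖v₂ + y‖ ^ (τ₂ - m) * ‖y‖ ^ (-α - m)) with hf₃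
  set f₄ : Euc m → ℝ := fun y =>
    ‖v₁ + y‖ ^ (τ₁ - m) * ‖v₂ + y‖ ^ (τ₂ - m) * ‖y‖ ^ (-α - m) with hf₄
  have hpt : ∀ y ∈ S, ENNReal.ofReal (|‖v₁ + y‖ ^ (τ₁ - m) - ‖v₁‖ ^ (τ₁ - m)| *
      |‖v₂ + y‖ ^ (τ₂ - m) - ‖v₂‖ ^ (τ₂ - m)| * ‖y‖ ^ (-α - m)) ≤
      ENNReal.ofReal (f₁ y) + ENNReal.ofReal (f₂ y) +
        U.indicator (fun y => ENNReal.ofReal (f₃ y)) y +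
        U.indicator (fun y => ENNReal.ofReal (f₄ y)) y := by
    intro y hy
    have hy0 : 0 < ‖y‖ := lt_of_lt_of_le (by positivity) hy
    have a1 : |‖v₁ + y‖ ^ (τ₁ - m) - ‖v₁‖ ^ (τ₁ - m)| ≤ ‖v₁ + y‖ ^ (τ₁ - m) + ‖v₁‖ ^ (τ₁ - m) := by
      refine (abs_sub _ _).trans (le_of_eq ?_)
      rw [abs_of_nonneg (by positivity), abs_of_nonneg (by positivity)]
    have a2 := hD v₂ y hv₂
    have a3 : ‖y‖ ^ (-(α - κ) - m) = ‖y‖ ^ κ * ‖y‖ ^ (-α - m) := by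
      rw [← Real.rpow_add hy0]; congr 1; ring
    have n1 : 0 ≤ f₁ y := by positivity
    have n2 : 0 ≤ f₂ y := by positivity
    have n3 : 0 ≤ f₃ y := by positivity
    have n4 : 0 ≤ f₄ y := by positivity
    by_cases hyU : y ∈ U
    · rw [indicator_of_mem hyU, indicator_of_mem hyU, ← ENNReal.ofReal_add n1 n2,
        ← ENNReal.ofReal_add (by positivity) n3, ← ENNReal.ofReal_add (by positivity) n4]
      rw [indicator_of_mem hyU] at a2
      apply ENNReal.ofReal_le_ofReal
      calc _ ≤ (‖v₁ + y‖ ^ (τ₁ - m) + ‖v₁‖ ^ (τ₁ - m)) *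
            (C₀ * (‖y‖ ^ κ * ‖v₂‖ ^ (τ₂ - m - κ)) + ‖v₂ + y‖ ^ (τ₂ - m)) * ‖y‖ ^ (-α - m) := by
            gcongr
        _ = _ := by simp only [hf₁, hf₂, hf₃, hf₄, a3]; ring
    · rw [indicator_of_notMem hyU, indicator_of_notMem hyU, ← ENNReal.ofReal_add n1 n2, add_zero,
        add_zero]
      rw [indicator_of_notMem hyU, add_zero] at a2
      apply ENNReal.ofReal_le_ofReal
      calc _ ≤ (‖v₁ + y‖ ^ (τ₁ - m) + ‖v₁‖ ^ (τ₁ - m)) *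
            (C₀ * (‖y‖ ^ κ * ‖v₂‖ ^ (τ₂ - m - κ))) * ‖y‖ ^ (-α - m) := by
            gcongr
        _ = _ := by simp only [hf₁, hf₂, a3]; ring
  have i1 : ∫⁻ y in S, ENNReal.ofReal (f₁ y) ≤
      ENNReal.ofReal (C₀ * ‖v₂‖ ^ (τ₂ - m - κ) * (C₁ * (c * ‖v₁‖) ^ (τ₁ - (α - κ) - m))) := by
    refine setLIntegral_ofReal_le hSm (by positivity) (fun y _ => le_rfl) ?_
    have := h₁ 0 (-v₁) (c * ‖v₁‖) (by positivity)
    simpa [hS, add_comm] using this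
  have i2 : ∫⁻ y in S, ENNReal.ofReal (f₂ y) ≤
      ENNReal.ofReal (C₀ * ‖v₂‖ ^ (τ₂ - m - κ) * ‖v₁‖ ^ (τ₁ - m) *
        (C₂ * (c * ‖v₁‖) ^ (-(α - κ)))) := by
    refine setLIntegral_ofReal_le hSm (by positivity) (fun y _ => le_rfl) ?_
    have := h₂ 0 (c * ‖v₁‖) (by positivity)
    simpa [hS] using this
  have i3 : ∫⁻ y in S, U.indicator (fun y => ENNReal.ofReal (f₃ y)) y ≤
      ENNReal.ofReal (‖v₁‖ ^ (τ₁ - m) * (C₃ * (1 / 2 * ‖v₂‖) ^ (τ₂ - α - m))) := by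
    refine (setLIntegral_le_lintegral _ _).trans ?_
    rw [lintegral_indicator hUm]
    refine setLIntegral_ofReal_le hUm (by positivity) (fun y _ => le_rfl) ?_
    have := h₃ 0 (-v₂) (1 / 2 * ‖v₂‖) (by positivity)
    rw [show 1 / 2 * ‖v₂‖ = ‖v₂‖ / 2 by ring] at this ⊢
    simpa [hU, add_comm] using this
  have i4 : ∫⁻ y in S, U.indicator (fun y => ENNReal.ofReal (f₄ y)) y ≤
      ENNReal.ofReal B * ∫⁻ y : Euc m, ENNReal.ofReal
        (‖y‖ ^ (γ - m) * (‖v₁ + y‖ ^ (s - m) * ‖v₂ + y‖ ^ (t - m))) := by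
    refine (setLIntegral_le_lintegral _ _).trans ?_
    rw [← lintegral_const_mul' _ _ ENNReal.ofReal_ne_top]
    refine lintegral_mono fun y => ?_
    by_cases hyU : y ∈ U
    · rw [indicator_of_mem hyU, ← ENNReal.ofReal_mul hB0.le]
      apply ENNReal.ofReal_le_ofReal
      have hyU' : ‖v₂‖ / 2 ≤ ‖y‖ := hyU
      have hy0 : 0 < ‖y‖ := lt_of_lt_of_le (by positivity) hyU'
      -- At the two singular points `Real.rpow` returns `0`, so `f₄` vanishes there.
      rcases eq_or_ne (v₁ + y) 0 with h0 | h0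
      · simp only [hf₄, h0, norm_zero, Real.zero_rpow (show τ₁ - (m:ℝ) ≠ 0 by linarith), zero_mul]
        positivity
      rcases eq_or_ne (v₂ + y) 0 with h0' | h0'
      · simp only [hf₄, h0', norm_zero, Real.zero_rpow (show τ₂ - (m:ℝ) ≠ 0 by linarith), zero_mul,
          mul_zero]
        positivity
      -- Since both shifted lengths are at most `3 ‖y‖`, their exponents can be lowered to `s - m`
      -- and `t - m`; the power of `‖y‖` absorbs the difference and becomes `γ - m`.
      have k1 : ‖v₁ + y‖ ≤ 3 * ‖y‖ := (norm_add_le _ _).trans (by linarith)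
      have k2 : ‖v₂ + y‖ ≤ 3 * ‖y‖ := (norm_add_le _ _).trans (by linarith)
      have k1' : 0 < ‖v₁ + y‖ := norm_pos_iff.2 h0
      have k2' : 0 < ‖v₂ + y‖ := norm_pos_iff.2 h0'
      have l1 : ‖v₁ + y‖ ^ (τ₁ - m) * ‖y‖ ^ (-(τ₁ - s)) ≤
          3 ^ (τ₁ - m - (s - m)) * (‖v₁ + y‖ ^ (s - m) * ‖y‖ ^ (0:ℝ)) :=
        rpow_mul_rpow_le_of_le k1' hy0 (by norm_num) k1 (by linarith) (by ring)
      have l2 : ‖v₂ + y‖ ^ (τ₂ - m) * ‖y‖ ^ (-(τ₂ - t)) ≤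
          3 ^ (τ₂ - m - (t - m)) * (‖v₂ + y‖ ^ (t - m) * ‖y‖ ^ (0:ℝ)) :=
        rpow_mul_rpow_le_of_le k2' hy0 (by norm_num) k2 (by linarith) (by ring)
      rw [Real.rpow_zero, mul_one] at l1 l2
      have hsplit : ‖y‖ ^ (-α - m) = ‖y‖ ^ (-(τ₁ - s)) * ‖y‖ ^ (-(τ₂ - t)) * ‖y‖ ^ (γ - m) := by
        rw [← Real.rpow_add hy0, ← Real.rpow_add hy0]; congr 1; linarith
      have hBs : B = 3 ^ (τ₁ - m - (s - m)) * 3 ^ (τ₂ - m - (t - m)) := by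
        rw [hB, ← Real.rpow_add (by norm_num)]; congr 1; ring
      calc f₄ y = (‖v₁ + y‖ ^ (τ₁ - m) * ‖y‖ ^ (-(τ₁ - s))) *
            (‖v₂ + y‖ ^ (τ₂ - m) * ‖y‖ ^ (-(τ₂ - t))) * ‖y‖ ^ (γ - m) := by
            simp only [hf₄, hsplit]; ring
        _ ≤ (3 ^ (τ₁ - m - (s - m)) * ‖v₁ + y‖ ^ (s - m)) *
            (3 ^ (τ₂ - m - (t - m)) * ‖v₂ + y‖ ^ (t - m)) * ‖y‖ ^ (γ - m) := by gcongr
        _ = _ := by rw [hBs]; ring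
    · rw [indicator_of_notMem hyU]; exact zero_le
  set Θ := τ₁ + τ₂ - α with hΘ
  have hsum : C₀ * ‖v₂‖ ^ (τ₂ - m - κ) * (C₁ * (c * ‖v₁‖) ^ (τ₁ - (α - κ) - m)) +
      C₀ * ‖v₂‖ ^ (τ₂ - m - κ) * ‖v₁‖ ^ (τ₁ - m) * (C₂ * (c * ‖v₁‖) ^ (-(α - κ))) +
      ‖v₁‖ ^ (τ₁ - m) * (C₃ * (1 / 2 * ‖v₂‖) ^ (τ₂ - α - m)) ≤
      A * (‖v₁‖ ^ (δ - m) * ‖v₂‖ ^ (Θ - δ - m)) := by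
    have q1 : (‖v₁‖ ^ (τ₁ - m) : ℝ) * ‖v₁‖ ^ (-(α - κ)) = ‖v₁‖ ^ (δ - m) := by
      rw [← Real.rpow_add e1]; congr 1; rw [hκ]; ring
    have q2 : τ₂ - m - κ = Θ - δ - m := by rw [hκ, hΘ]; ring
    have q3 : τ₁ - (α - κ) - m = δ - m := by rw [hκ]; ring
    have q4 : ‖v₁‖ ^ (τ₁ - m) * ‖v₂‖ ^ (τ₂ - α - m) ≤ ‖v₁‖ ^ (δ - m) * ‖v₂‖ ^ (Θ - δ - m) := by
      have := rpow_mul_rpow_le_of_le (p := τ₁ - m) (q := τ₂ - α - m) (p' := δ - m)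
        (q' := Θ - δ - m) e1 e2 one_pos (by linarith) (by linarith) (by rw [hΘ]; ring)
      simpa using this
    rw [q2, q3, Real.mul_rpow hc.le e1.le, Real.mul_rpow hc.le e1.le,
      Real.mul_rpow (by norm_num) e2.le]
    calc _ = C₀ * C₁ * c ^ (δ - m) * (‖v₁‖ ^ (δ - m) * ‖v₂‖ ^ (Θ - δ - m)) +
          C₀ * C₂ * c ^ (-(α - κ)) * ((‖v₁‖ ^ (τ₁ - m) * ‖v₁‖ ^ (-(α - κ))) *
            ‖v₂‖ ^ (Θ - δ - m)) +
          C₃ * (1 / 2) ^ (τ₂ - α - m) * (‖v₁‖ ^ (τ₁ - m) * ‖v₂‖ ^ (τ₂ - α - m)) := by ring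
      _ ≤ C₀ * C₁ * c ^ (δ - m) * (‖v₁‖ ^ (δ - m) * ‖v₂‖ ^ (Θ - δ - m)) +
          C₀ * C₂ * c ^ (-(α - κ)) * (‖v₁‖ ^ (δ - m) * ‖v₂‖ ^ (Θ - δ - m)) +
          C₃ * (1 / 2) ^ (τ₂ - α - m) * (‖v₁‖ ^ (δ - m) * ‖v₂‖ ^ (Θ - δ - m)) := by
          rw [q1]; gcongr
      _ = _ := by rw [hA]; ring
  have mf₁ : Measurable fun y => ENNReal.ofReal (f₁ y) := by fun_prop
  have mf₂ : Measurable fun y => ENNReal.ofReal (f₂ y) := by fun_prop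
  have mf₃ : Measurable (U.indicator fun y => ENNReal.ofReal (f₃ y)) :=
    Measurable.indicator (by fun_prop) hUm
  calc _ ≤ ∫⁻ y in S, (ENNReal.ofReal (f₁ y) + ENNReal.ofReal (f₂ y) +
        U.indicator (fun y => ENNReal.ofReal (f₃ y)) y +
        U.indicator (fun y => ENNReal.ofReal (f₄ y)) y) := setLIntegral_mono' hSm hpt
    _ = (∫⁻ y in S, ENNReal.ofReal (f₁ y)) + (∫⁻ y in S, ENNReal.ofReal (f₂ y)) +
        (∫⁻ y in S, U.indicator (fun y => ENNReal.ofReal (f₃ y)) y) +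
        (∫⁻ y in S, U.indicator (fun y => ENNReal.ofReal (f₄ y)) y) :=
        (lintegral_add_left ((mf₁.add mf₂).add mf₃) _).trans (congrArg (· + _)
          ((lintegral_add_left (mf₁.add mf₂) _).trans (congrArg (· + _)
            (lintegral_add_left mf₁ _))))
    _ ≤ _ := add_le_add (add_le_add (add_le_add i1 i2) i3) i4
    _ ≤ ENNReal.ofReal (A * (‖v₁‖ ^ (δ - m) * ‖v₂‖ ^ (Θ - δ - m))) +
        ENNReal.ofReal B * ∫⁻ y : Euc m, ENNReal.ofReal
        (‖y‖ ^ (γ - m) * (‖v₁ + y‖ ^ (s - m) * ‖v₂ + y‖ ^ (t - m))) := by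
        rw [← ENNReal.ofReal_add (by positivity) (by positivity),
          ← ENNReal.ofReal_add (by positivity) (by positivity)]
        gcongr
    _ ≤ _ := by gcongr <;> linarith

/-- Substitute `y = j h`: as `|j| ≥ 1`, the exterior of the ball is mapped into itself. -/
lemma setLIntegral_comp_smul_le {m : ℕ} (F : Euc m → ℝ) {α a j : ℝ}
    (hj : 1 ≤ |j|) (ha : 0 ≤ a) :
    ∫⁻ h in {h : Euc m | a ≤ ‖h‖}, ENNReal.ofReal (F (j • h) * ‖h‖ ^ (-α - m)) ≤
      ENNReal.ofReal (|j| ^ α) *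
        ∫⁻ y in {y : Euc m | a ≤ ‖y‖}, ENNReal.ofReal (F y * ‖y‖ ^ (-α - m)) := by
  have hms : MeasurableSet {y : Euc m | a ≤ ‖y‖} := measurableSet_le (by fun_prop) (by fun_prop)
  have hj0 : j ≠ 0 := fun h => by rw [h] at hj; simp at hj; linarith
  have hj1 : 0 < |j| := abs_pos.2 hj0
  rw [← lintegral_indicator hms, ← lintegral_indicator hms]
  have := lintegral_comp_smul_euc
    (({y : Euc m | a ≤ ‖y‖}).indicator fun y => ENNReal.ofReal (F y * ‖y‖ ^ (-α - m))) hj0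
  have hsplit : ENNReal.ofReal (|j| ^ α) =
      ENNReal.ofReal (|j| ^ (α + m)) * ENNReal.ofReal (|j| ^ (-(m:ℝ))) := by
    rw [← ENNReal.ofReal_mul (by positivity), ← Real.rpow_add hj1]; congr 2; ring
  rw [hsplit, mul_assoc, ← this, ← lintegral_const_mul' _ _ ENNReal.ofReal_ne_top]
  refine lintegral_mono fun h => ?_
  by_cases hh : a ≤ ‖h‖
  · have hjh : a ≤ ‖j • h‖ := by
      rw [norm_smul, Real.norm_eq_abs]; nlinarith [norm_nonneg h]
    rw [indicator_of_mem (show h ∈ {y : Euc m | a ≤ ‖y‖} from hh),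
      indicator_of_mem (show j • h ∈ {y : Euc m | a ≤ ‖y‖} from hjh),
      ← ENNReal.ofReal_mul (by positivity)]
    apply ENNReal.ofReal_le_ofReal
    rw [norm_smul, Real.norm_eq_abs, Real.mul_rpow hj1.le (norm_nonneg _)]
    have : |j| ^ (α + m) * |j| ^ (-α - m) = 1 := by
      rw [← Real.rpow_add hj1]; simp
    calc F (j • h) * ‖h‖ ^ (-α - m) = (|j| ^ (α + m) * |j| ^ (-α - m)) *
        (F (j • h) * ‖h‖ ^ (-α - m)) := by rw [this, one_mul]
      _ = _ := by ring
      _ ≤ _ := le_rfl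
  · rw [indicator_of_notMem (show h ∉ {y : Euc m | a ≤ ‖y‖} from hh)]; exact zero_le

/-- Split at `‖h‖ = c ‖v₁‖` with the threshold `c` of `exists_sum_symmDiffCoeff_mul_le`. Inside, the
factor `‖h‖^(2N)` beats `‖h‖^(-α-m)`, leaving `‖v₁‖^(τ₁+1-α-m) ‖v₂‖^(τ₂-m-1)`, and `δ ≤ 1 + τ₁ - α`
allows the trade to exponent `δ - m`. Outside, each shift is rescaled to a unit shift and handled by
`exists_lintegral_diff_mul_diff_le`. -/
lemma exists_leibnizKernel_le_of_le {m N : ℕ} [NeZero m] {α τ₁ τ₂ δ γ s t : ℝ} (hN : 0 < N)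
    (hα : 0 < α) (hαN : α < 2 * N) (hτ₁ : 0 < τ₁) (hτ₂ : 0 < τ₂) (hτ₁m : τ₁ < m) (hτ₂m : τ₂ < m)
    (hτ₁α : τ₁ ≤ α) (hδ : 0 < δ) (hδ₁ : δ < τ₁) (hδ₂ : δ ≤ 1 + τ₁ - α) (hs : s ≤ τ₁)
    (ht : t ≤ τ₂) (hst : γ + s + t = τ₁ + τ₂ - α) :
    ∃ C : ℝ, 0 < C ∧ ∀ (v₁ v₂ : Euc m), v₁ ≠ 0 → ‖v₁‖ ≤ ‖v₂‖ →
      ∫⁻ h : Euc m, ENNReal.ofReal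
        (|∑ i ∈ Finset.range (2 * N + 1), symmDiffCoeff N i *
          ((‖v₁ + (i - N : ℝ) • h‖ ^ (τ₁ - m) - ‖v₁‖ ^ (τ₁ - m)) *
            (‖v₂ + (i - N : ℝ) • h‖ ^ (τ₂ - m) - ‖v₂‖ ^ (τ₂ - m)))| * ‖h‖ ^ (-α - m)) ≤
      ENNReal.ofReal (C * (‖v₁‖ ^ (δ - m) * ‖v₂‖ ^ (τ₁ + τ₂ - α - δ - m))) +
      ENNReal.ofReal C * ∫⁻ y : Euc m, ENNReal.ofReal
        (‖y‖ ^ (γ - m) * (‖v₁ + y‖ ^ (s - m) * ‖v₂ + y‖ ^ (t - m))) := by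
  have := nontrivial_euc m
  have hN0 : (1:ℝ) ≤ N := by exact_mod_cast hN
  set c : ℝ := 1 / (40 * N) with hc
  have hc0 : 0 < c := by positivity
  obtain ⟨C₁, hC₁, h₁⟩ := exists_sum_symmDiffCoeff_mul_le (m := m) hN
    (show τ₁ - (m:ℝ) ≤ 0 by linarith) (show τ₂ - (m:ℝ) ≤ 0 by linarith)
  obtain ⟨C₂, hC₂, h₂⟩ := exists_lintegral_ball_le (m := m) (show 0 < 2 * N - α by linarith)
  obtain ⟨C₃, hC₃, h₃⟩ := exists_lintegral_diff_mul_diff_le (m := m) (γ := γ) (s := s) (t := t)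
    hc0 hα hτ₁ hτ₂ hτ₁m hτ₂m hτ₁α hδ hδ₁ hδ₂ hs ht hst
  set Θ := τ₁ + τ₂ - α with hΘ
  set K : ℝ := ∑ i ∈ Finset.range (2 * N + 1), |symmDiffCoeff N i| * |(i - N : ℝ)| ^ α with hK
  have hK0 : 0 ≤ K := Finset.sum_nonneg fun i _ => by positivity
  set A := C₁ * C₂ * c ^ (2 * N - α) with hA
  have hA0 : 0 < A := by positivity
  refine ⟨A + K * C₃, by positivity, fun v₁ v₂ hv₁ h12 => ?_⟩
  have e1 : 0 < ‖v₁‖ := norm_pos_iff.2 hv₁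
  have e2 : 0 < ‖v₂‖ := e1.trans_le h12
  have h₃' := h₃ v₁ v₂ hv₁ h12
  set P := ‖v₁‖ ^ (δ - m) * ‖v₂‖ ^ (Θ - δ - m) with hP
  set E := ∫⁻ y : Euc m, ENNReal.ofReal
        (‖y‖ ^ (γ - m) * (‖v₁ + y‖ ^ (s - m) * ‖v₂ + y‖ ^ (t - m))) with hE
  set F : Euc m → ℝ := fun y => |‖v₁ + y‖ ^ (τ₁ - m) - ‖v₁‖ ^ (τ₁ - m)| *
    |‖v₂ + y‖ ^ (τ₂ - m) - ‖v₂‖ ^ (τ₂ - m)| with hF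
  set f : Euc m → ℝ := fun h => |∑ i ∈ Finset.range (2 * N + 1), symmDiffCoeff N i *
          ((‖v₁ + (i - N : ℝ) • h‖ ^ (τ₁ - m) - ‖v₁‖ ^ (τ₁ - m)) *
            (‖v₂ + (i - N : ℝ) • h‖ ^ (τ₂ - m) - ‖v₂‖ ^ (τ₂ - m)))| * ‖h‖ ^ (-α - m) with hf
  set S₁ := {y : Euc m | ‖y‖ < c * ‖v₁‖} with hS₁
  set S₂ := {y : Euc m | c * ‖v₁‖ ≤ ‖y‖} with hS₂
  have hS₁m : MeasurableSet S₁ := measurableSet_lt (by fun_prop) (by fun_prop)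
  have hS₂m : MeasurableSet S₂ := measurableSet_le (by fun_prop) (by fun_prop)
  have i1 : ∫⁻ h in S₁, ENNReal.ofReal (f h) ≤ ENNReal.ofReal (A * P) := by
    have hb : ∫⁻ h in S₁, ENNReal.ofReal (‖h‖ ^ (2 * N - α - m)) ≤
        ENNReal.ofReal (C₂ * (c * ‖v₁‖) ^ (2 * N - α)) := by
      simpa [hS₁] using h₂ 0 (c * ‖v₁‖) (by positivity)
    calc ∫⁻ h in S₁, ENNReal.ofReal (f h)
        ≤ ∫⁻ h in S₁, ENNReal.ofReal (C₁ * (‖v₁‖ ^ (τ₁ - m + 1 - 2 * N) * ‖v₂‖ ^ (τ₂ - m - 1)) *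
            ‖h‖ ^ (2 * N - α - m)) := by
          refine lintegral_mono_ae ?_
          filter_upwards [ae_restrict_of_ae (Measure.ae_ne volume (0 : Euc m)),
            ae_restrict_mem hS₁m] with h hh hhS
          apply ENNReal.ofReal_le_ofReal
          have eh : 0 < ‖h‖ := norm_pos_iff.2 hh
          have := h₁ v₁ v₂ h hv₁ h12 hh hhS
          calc f h ≤ C₁ * (‖v₁‖ ^ (τ₁ - m + 1 - 2 * N) * ‖v₂‖ ^ (τ₂ - m - 1)) *
                ‖h‖ ^ (2 * N : ℝ) * ‖h‖ ^ (-α - m) := by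
                simp only [hf]; gcongr
            _ = _ := by rw [mul_assoc, ← Real.rpow_add eh]; congr 2; ring
      _ ≤ ENNReal.ofReal (C₁ * (‖v₁‖ ^ (τ₁ - m + 1 - 2 * N) * ‖v₂‖ ^ (τ₂ - m - 1)) *
            (C₂ * (c * ‖v₁‖) ^ (2 * N - α))) :=
          setLIntegral_ofReal_le hS₁m (by positivity) (fun y _ => le_rfl) hb
      _ ≤ ENNReal.ofReal (A * P) := by
          apply ENNReal.ofReal_le_ofReal
          rw [Real.mul_rpow hc0.le e1.le]
          have q1 : ‖v₁‖ ^ (τ₁ - m + 1 - 2 * N) * ‖v₁‖ ^ (2 * N - α) =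
              ‖v₁‖ ^ (τ₁ + 1 - α - m) := by
            rw [← Real.rpow_add e1]; congr 1; ring
          have q2 : ‖v₁‖ ^ (τ₁ + 1 - α - m) * ‖v₂‖ ^ (τ₂ - m - 1) ≤ P := by
            have := rpow_mul_rpow_le_of_le (p := τ₁ + 1 - α - m) (q := τ₂ - m - 1) (p' := δ - m)
              (q' := Θ - δ - m) e1 e2 one_pos (by linarith) (by linarith) (by rw [hΘ]; ring)
            simpa using this
          calc _ = A * ((‖v₁‖ ^ (τ₁ - m + 1 - 2 * N) * ‖v₁‖ ^ (2 * N - α)) *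
                ‖v₂‖ ^ (τ₂ - m - 1)) := by rw [hA]; ring
            _ ≤ _ := by rw [q1]; gcongr
  have i2 : ∫⁻ h in S₂, ENNReal.ofReal (f h) ≤
      ENNReal.ofReal K * (ENNReal.ofReal (C₃ * P) + ENNReal.ofReal C₃ * E) := by
    calc ∫⁻ h in S₂, ENNReal.ofReal (f h)
        ≤ ∫⁻ h in S₂, ∑ i ∈ Finset.range (2 * N + 1), ENNReal.ofReal (|symmDiffCoeff N i|) *
            ENNReal.ofReal (F ((i - N : ℝ) • h) * ‖h‖ ^ (-α - m)) := by
          refine lintegral_mono fun h => ?_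
          have : f h ≤ ∑ i ∈ Finset.range (2 * N + 1), |symmDiffCoeff N i| *
              (F ((i - N : ℝ) • h) * ‖h‖ ^ (-α - m)) := by
            calc f h ≤ (∑ i ∈ Finset.range (2 * N + 1), |symmDiffCoeff N i| *
                  F ((i - N : ℝ) • h)) * ‖h‖ ^ (-α - m) := by
                  simp only [hf, hF]
                  refine mul_le_mul_of_nonneg_right ?_ (by positivity)
                  refine (Finset.abs_sum_le_sum_abs _ _).trans (le_of_eq ?_)
                  simp_rw [abs_mul]
              _ = _ := by rw [Finset.sum_mul]; simp_rw [mul_assoc]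
          refine (ENNReal.ofReal_le_ofReal this).trans (le_of_eq ?_)
          rw [ENNReal.ofReal_sum_of_nonneg (fun i _ => by simp only [hF]; positivity)]
          simp_rw [ENNReal.ofReal_mul (abs_nonneg (symmDiffCoeff N _))]
      _ = ∑ i ∈ Finset.range (2 * N + 1), ENNReal.ofReal (|symmDiffCoeff N i|) *
            ∫⁻ h in S₂, ENNReal.ofReal (F ((i - N : ℝ) • h) * ‖h‖ ^ (-α - m)) := by
          rw [lintegral_finsetSum _ (fun i _ => by simp only [hF]; fun_prop)]
          refine Finset.sum_congr rfl fun i _ => ?_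
          exact lintegral_const_mul' _ _ ENNReal.ofReal_ne_top
      _ ≤ ∑ i ∈ Finset.range (2 * N + 1), ENNReal.ofReal (|symmDiffCoeff N i|) *
            (ENNReal.ofReal (|(i - N : ℝ)| ^ α) *
              (ENNReal.ofReal (C₃ * P) + ENNReal.ofReal C₃ * E)) := by
          refine Finset.sum_le_sum fun i _ => mul_le_mul_right ?_ _
          -- The central shift contributes a zero increment; all others satisfy `|i - N| ≥ 1`, as
          -- the rescaling requires.
          by_cases hiN : i = N
          · have : ∀ h : Euc m, ENNReal.ofReal (F ((i - N : ℝ) • h) * ‖h‖ ^ (-α - m)) = 0 := by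
              intro h; simp [hF, hiN]
            simp_rw [this]; simp
          · refine (setLIntegral_comp_smul_le F ?_
              (by positivity)).trans (mul_le_mul_right ?_ _)
            · have : (1:ℤ) ≤ |(i:ℤ) - N| := Int.one_le_abs (by omega)
              exact_mod_cast this
            · exact h₃'
      _ = _ := by
          rw [hK, ENNReal.ofReal_sum_of_nonneg (fun i _ => by positivity), Finset.sum_mul]
          refine Finset.sum_congr rfl fun i _ => ?_
          rw [ENNReal.ofReal_mul (abs_nonneg _), mul_assoc]
  calc ∫⁻ h : Euc m, ENNReal.ofReal (f h)
      ≤ (∫⁻ h in S₁, ENNReal.ofReal (f h)) + ∫⁻ h in S₂, ENNReal.ofReal (f h) := by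
        rw [← setLIntegral_univ]
        refine (lintegral_mono_set (fun y _ => ?_)).trans (lintegral_union_le _ _ _)
        exact lt_or_ge ‖y‖ (c * ‖v₁‖)
    _ ≤ ENNReal.ofReal (A * P) +
        ENNReal.ofReal K * (ENNReal.ofReal (C₃ * P) + ENNReal.ofReal C₃ * E) := add_le_add i1 i2
    _ = ENNReal.ofReal ((A + K * C₃) * P) + ENNReal.ofReal (K * C₃) * E := by
        rw [mul_add, ← ENNReal.ofReal_mul hK0, ← mul_assoc (ENNReal.ofReal K),
          ← ENNReal.ofReal_mul hK0, ← add_assoc,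
          ← ENNReal.ofReal_add (by positivity) (by positivity)]
        congr 2; ring
    _ ≤ _ := by gcongr; linarith

/-- The restriction `‖v₁‖ ≤ ‖v₂‖` is removed by symmetry. In the reversed case the exponents `s` and
`t` are exchanged as well, so that the same three-centre integral appears in both cases. -/
lemma exists_leibnizKernel_le {m N : ℕ} [NeZero m] {α τ₁ τ₂ δ : ℝ} (hN : 0 < N)
    (hα : 0 < α) (hαN : α < 2 * N) (hτ₁m : τ₁ < m) (hτ₂m : τ₂ < m)
    (hτ₁α : τ₁ ≤ α) (hτ₂α : τ₂ ≤ α) (hδ : 0 < δ) (hδ₁ : δ < τ₁) (hδ₁' : δ ≤ 1 + τ₁ - α)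
    (hδ₂ : δ < τ₂) (hδ₂' : δ ≤ 1 + τ₂ - α) :
    ∃ C : ℝ, 0 < C ∧ ∀ (x z₁ z₂ : Euc m), z₁ ≠ x → z₂ ≠ x →
      ∫⁻ h : Euc m, ENNReal.ofReal
        (|∑ i ∈ Finset.range (2 * N + 1), symmDiffCoeff N i *
          ((‖x - z₁ + (i - N : ℝ) • h‖ ^ (τ₁ - m) - ‖x - z₁‖ ^ (τ₁ - m)) *
            (‖x - z₂ + (i - N : ℝ) • h‖ ^ (τ₂ - m) - ‖x - z₂‖ ^ (τ₂ - m)))| *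
              ‖h‖ ^ (-α - m)) ≤
      ENNReal.ofReal C * rieszMajorant δ (τ₁ + τ₂ - α) x z₁ z₂ := by
  set Θ := τ₁ + τ₂ - α with hΘ
  obtain ⟨C₁, hC₁, h₁⟩ := exists_leibnizKernel_le_of_le (m := m) (γ := δ) (s := δ)
    (t := Θ - 2 * δ) hN hα hαN (hδ.trans hδ₁) (hδ.trans hδ₂) hτ₁m hτ₂m hτ₁α hδ hδ₁ hδ₁' hδ₁.le
    (by linarith) (by rw [hΘ]; ring)
  obtain ⟨C₂, hC₂, h₂⟩ := exists_leibnizKernel_le_of_le (m := m) (γ := δ) (s := Θ - 2 * δ)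
    (t := δ) hN hα hαN (hδ.trans hδ₂) (hδ.trans hδ₁) hτ₂m hτ₁m hτ₂α hδ hδ₂ hδ₂' (by linarith)
    hδ₁.le (by rw [hΘ]; ring)
  refine ⟨C₁ + C₂, by positivity, fun x z₁ z₂ hz₁ hz₂ => ?_⟩
  have hE : ∫⁻ y : Euc m, ENNReal.ofReal
        (‖y‖ ^ (δ - m) * (‖x - z₁ + y‖ ^ (δ - m) * ‖x - z₂ + y‖ ^ (Θ - 2 * δ - m))) =
      ∫⁻ w, ENNReal.ofReal (‖x - w‖ ^ (δ - m)) *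
        (ENNReal.ofReal (‖w - z₁‖ ^ (δ - m)) * ENNReal.ofReal (‖w - z₂‖ ^ (Θ - 2 * δ - m))) := by
    conv_rhs => rw [← lintegral_add_left_eq_self _ x]
    refine lintegral_congr fun y => ?_
    rw [← ENNReal.ofReal_mul (by positivity), ← ENNReal.ofReal_mul (by positivity),
      show x - (x + y) = -y by abel, norm_neg, show x + y - z₁ = x - z₁ + y by abel,
      show x + y - z₂ = x - z₂ + y by abel]
  have hv₁ : x - z₁ ≠ 0 := sub_ne_zero.2 hz₁.symm
  have hv₂ : x - z₂ ≠ 0 := sub_ne_zero.2 hz₂.symm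
  rw [rieszMajorant, ← hE, ← ENNReal.ofReal_mul (by positivity), ← ENNReal.ofReal_mul (by positivity)]
  set P₁ := ‖x - z₁‖ ^ (δ - m) * ‖x - z₂‖ ^ (Θ - δ - m)
  set P₂ := ‖x - z₁‖ ^ (Θ - δ - m) * ‖x - z₂‖ ^ (δ - m)
  set E := ∫⁻ y : Euc m, ENNReal.ofReal
        (‖y‖ ^ (δ - m) * (‖x - z₁ + y‖ ^ (δ - m) * ‖x - z₂ + y‖ ^ (Θ - 2 * δ - m)))
  rcases le_total ‖x - z₁‖ ‖x - z₂‖ with hr | hr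
  · refine (h₁ _ _ hv₁ hr).trans ?_
    calc _ = ENNReal.ofReal C₁ * (ENNReal.ofReal P₁ + E) := by
          rw [mul_add, ← ENNReal.ofReal_mul hC₁.le]
      _ ≤ _ := by
          gcongr
          · linarith
          · exact le_self_add
  · have := h₂ _ _ hv₂ hr
    have hc : ∀ h : Euc m, ∀ i : ℕ,
        (‖x - z₂ + (i - N : ℝ) • h‖ ^ (τ₂ - m) - ‖x - z₂‖ ^ (τ₂ - m)) *
          (‖x - z₁ + (i - N : ℝ) • h‖ ^ (τ₁ - m) - ‖x - z₁‖ ^ (τ₁ - m)) =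
        (‖x - z₁ + (i - N : ℝ) • h‖ ^ (τ₁ - m) - ‖x - z₁‖ ^ (τ₁ - m)) *
          (‖x - z₂ + (i - N : ℝ) • h‖ ^ (τ₂ - m) - ‖x - z₂‖ ^ (τ₂ - m)) :=
      fun h i => mul_comm _ _
    have hE' : ∀ y : Euc m, ‖x - z₂ + y‖ ^ (Θ - 2 * δ - m) * ‖x - z₁ + y‖ ^ (δ - m) =
        ‖x - z₁ + y‖ ^ (δ - m) * ‖x - z₂ + y‖ ^ (Θ - 2 * δ - m) := fun y => mul_comm _ _
    simp_rw [hc, hE'] at this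
    refine this.trans ?_
    rw [show τ₂ + τ₁ - α = Θ by rw [hΘ]; ring]
    calc _ = ENNReal.ofReal C₂ * (ENNReal.ofReal P₂ + E) := by
          rw [mul_add, ← ENNReal.ofReal_mul hC₂.le, mul_comm (‖x - z₂‖ ^ (δ - m))]
      _ ≤ _ := by
          gcongr
          · linarith
          · exact le_add_self

/-! ### The double commutator kernel -/

lemma rpow_le_mul_rpow_of_nonpos {a R c p : ℝ} (hc : 0 < c) (hR : 0 < R) (h : c * R ≤ a)
    (hp : p ≤ 0) : a ^ p ≤ c ^ p * R ^ p := by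
  rw [← Real.mul_rpow hc.le hR.le]
  exact Real.rpow_le_rpow_of_nonpos (by positivity) h hp

section Triangle

variable {m : ℕ} {α β σ δ : ℝ}

/-- In the application `r₁`, `r₂`, `d` are `‖x - z₁‖`, `‖x - z₂‖`, `‖z₁ - z₂‖`. This term comes from
the ball of radius `min r₂ d / 2` around `z₂`, when the power centred at `z₁` is differenced. With
`R` the larger of `r₁`, `r₂`: if `r₂ < R/4` then `d` is comparable to `R` and the radius is absorbed
into `r₂`; otherwise `r₂` is comparable to `R` and the radius is absorbed into `d`. -/
lemma exists_triangle_bound₁ (hαm : α < m) (hβ : 0 < β) (hσ : 0 < σ) (hδ : 0 < δ)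
    (hδ₁ : β + σ + δ ≤ 1) (hδ₂ : 2 * δ ≤ α - σ - β) :
    ∃ C : ℝ, 0 < C ∧ ∀ r₁ r₂ d : ℝ, 0 < r₁ → 0 < r₂ → 0 < d → r₁ ≤ r₂ + d → r₂ ≤ r₁ + d →
      d ≤ r₁ + r₂ →
      (min r₂ d / 2) ^ (1 - σ) * (d ^ (α - m - 1) * r₂ ^ (-β - m)) ≤
        C * closedMajorant m δ (α - σ - β) r₁ r₂ d := by
  have hm := Nat.cast_nonneg (α := ℝ) m
  refine ⟨(1 / 2) ^ (α - m - 1) + (1 / 4) ^ (-β - m : ℝ) *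
    2 ^ (α - σ - m - (α - σ - β - δ - m)), by positivity, fun r₁ r₂ d h₁ h₂ hd t₁ t₂ t₃ => ?_⟩
  set M := closedMajorant m δ (α - σ - β) r₁ r₂ d with hM
  have hM0 : 0 ≤ M := closedMajorant_nonneg h₁.le h₂.le hd.le
  set R := max r₁ r₂ with hR
  have hR0 : 0 < R := lt_max_of_lt_left h₁
  have hρ0 : 0 < min r₂ d := lt_min h₂ hd
  rw [add_mul]
  rcases lt_or_ge r₂ (R / 4) with hc | hc
  · have hR1 : R = r₁ := by
      rcases max_choice r₁ r₂ with h | h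
      · exact h
      · rw [hR, h] at hc; linarith
    have hb : d ^ (α - m - 1) ≤ (1 / 2) ^ (α - m - 1) * R ^ (α - m - 1) :=
      rpow_le_mul_rpow_of_nonpos (by norm_num) hR0 (by linarith) (by linarith)
    have hb' : (min r₂ d / 2) ^ (1 - σ) ≤ r₂ ^ (1 - σ) :=
      Real.rpow_le_rpow (by positivity) (by linarith [min_le_left r₂ d]) (by linarith)
    have hk : r₂ ^ (1 - σ - β - m) * R ^ (α - m - 1) ≤ M :=
      rpow_mul_max_rpow_le_closedMajorant h₁ h₂ hd.le (Or.inr rfl) (by linarith) (by linarith)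
        (by ring)
    calc _ ≤ r₂ ^ (1 - σ) * ((1 / 2) ^ (α - m - 1) * R ^ (α - m - 1) * r₂ ^ (-β - m)) := by gcongr
      _ = (1 / 2) ^ (α - m - 1) * (r₂ ^ (1 - σ - β - m) * R ^ (α - m - 1)) := by
        rw [show 1 - σ - β - (m:ℝ) = 1 - σ + (-β - m) by ring, Real.rpow_add h₂]; ring
      _ ≤ (1 / 2) ^ (α - m - 1) * M := by gcongr
      _ ≤ _ := le_add_of_nonneg_right (by positivity)
  · have hb : r₂ ^ (-β - m) ≤ (1 / 4) ^ (-β - m : ℝ) * R ^ (-β - m) :=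
      rpow_le_mul_rpow_of_nonpos (by norm_num) hR0 (by linarith) (by linarith)
    have hb' : (min r₂ d / 2) ^ (1 - σ) ≤ d ^ (1 - σ) :=
      Real.rpow_le_rpow (by positivity) (by linarith [min_le_right r₂ d]) (by linarith)
    have hk : d ^ (α - σ - m) * R ^ (-β - m) ≤ 2 ^ (α - σ - m - (α - σ - β - δ - m)) * M :=
      rpow_mul_max_rpow_le_closedMajorant' h₁ h₂ hd t₃ (by linarith) (by ring)
    calc _ ≤ d ^ (1 - σ) * (d ^ (α - m - 1) * ((1 / 4) ^ (-β - m : ℝ) * R ^ (-β - m))) := by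
          gcongr
      _ = (1 / 4) ^ (-β - m : ℝ) * (d ^ (α - σ - m) * R ^ (-β - m)) := by
        rw [show α - σ - (m:ℝ) = 1 - σ + (α - m - 1) by ring, Real.rpow_add hd]; ring
      _ ≤ (1 / 4) ^ (-β - m : ℝ) * (2 ^ (α - σ - m - (α - σ - β - δ - m)) * M) := by gcongr
      _ = (1 / 4) ^ (-β - m : ℝ) * 2 ^ (α - σ - m - (α - σ - β - δ - m)) * M := by ring
      _ ≤ _ := le_add_of_nonneg_left (by positivity)

/-- Controls the term in which the increment between `x` and `z₂` is frozen. For `r₂` small compared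
with `r₁` the increment gains `r₂ / r₁`, without which the power of `r₂` would be too singular. For
`r₂` comparable to the maximum, the two powers are treated separately. -/
lemma exists_triangle_bound₂ {C₀ : ℝ} (hC₀ : 0 < C₀) (hαm : α < m) (hβ : 0 < β) (hσ : 0 < σ)
    (hδ : 0 < δ) (hδ₁ : β + σ + δ ≤ 1) (hδ₂ : 2 * δ ≤ α - σ - β) :
    ∃ C : ℝ, 0 < C ∧ ∀ r₁ r₂ d : ℝ, 0 < r₁ → 0 < r₂ → 0 < d → r₁ ≤ r₂ + d → r₂ ≤ r₁ + d →
      d ≤ r₁ + r₂ →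
      (r₂ ≤ r₁ / 2 → |r₁ ^ (α - m) - d ^ (α - m)| ≤ C₀ * (r₂ * r₁ ^ (α - m - 1))) →
      |r₁ ^ (α - m) - d ^ (α - m)| * r₂ ^ (-β - m) * (min r₂ d / 2) ^ (-σ) ≤
        C * closedMajorant m δ (α - σ - β) r₁ r₂ d := by
  have hm := Nat.cast_nonneg (α := ℝ) m
  set K : ℝ := (1 / 4) ^ (-β - m : ℝ) * (1 / 16) ^ (-σ) with hK
  have hK0 : 0 < K := by positivity
  set D : ℝ := 2 ^ (α - σ - m - (α - σ - β - δ - m)) with hD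
  have hD0 : 0 < D := by positivity
  refine ⟨C₀ * (1 / 2) ^ (-σ) + K * (D + D + (1 / 2) ^ (-σ)), by positivity,
    fun r₁ r₂ d h₁ h₂ hd t₁ t₂ t₃ hg => ?_⟩
  set M := closedMajorant m δ (α - σ - β) r₁ r₂ d with hM
  have hM0 : 0 ≤ M := closedMajorant_nonneg h₁.le h₂.le hd.le
  set R := max r₁ r₂ with hR
  have hR0 : 0 < R := lt_max_of_lt_left h₁
  have hρ0 : 0 < min r₂ d := lt_min h₂ hd
  rw [add_mul]
  rcases lt_or_ge r₂ (R / 4) with hc | hc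
  · have hR1 : R = r₁ := by
      rcases max_choice r₁ r₂ with h | h
      · exact h
      · rw [hR, h] at hc; linarith
    have hmin : min r₂ d = r₂ := min_eq_left (by linarith)
    have hk : r₂ ^ (1 - β - σ - m) * R ^ (α - m - 1) ≤ M :=
      rpow_mul_max_rpow_le_closedMajorant h₁ h₂ hd.le (Or.inr rfl) (by linarith) (by linarith)
        (by ring)
    have hg' := hg (by linarith)
    rw [hmin, show r₂ / 2 = 1 / 2 * r₂ by ring, Real.mul_rpow (by norm_num) h₂.le]
    rw [hR1] at hk
    calc _ ≤ C₀ * (r₂ * r₁ ^ (α - m - 1)) * r₂ ^ (-β - m) * ((1 / 2) ^ (-σ) * r₂ ^ (-σ)) := by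
          gcongr
      _ = C₀ * (1 / 2) ^ (-σ) * (r₂ ^ (1 - β - σ - m) * r₁ ^ (α - m - 1)) := by
        rw [show 1 - β - σ - (m:ℝ) = 1 + (-β - m) + -σ by ring, Real.rpow_add h₂, Real.rpow_add h₂,
          Real.rpow_one]; ring
      _ ≤ C₀ * (1 / 2) ^ (-σ) * M := by gcongr
      _ ≤ _ := le_add_of_nonneg_right (by positivity)
  · have hb : r₂ ^ (-β - m) ≤ (1 / 4) ^ (-β - m : ℝ) * R ^ (-β - m) :=
      rpow_le_mul_rpow_of_nonpos (by norm_num) hR0 (by linarith) (by linarith)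
    have hdR : d ≤ 2 * R := by linarith [le_max_left r₁ r₂, le_max_right r₁ r₂]
    have hb' : (min r₂ d / 2) ^ (-σ) ≤ (1 / 16) ^ (-σ) * d ^ (-σ) := by
      refine rpow_le_mul_rpow_of_nonpos (by norm_num) hd ?_ (by linarith)
      rcases min_choice r₂ d with h | h <;> rw [h] <;> linarith
    have hg' : |r₁ ^ (α - m) - d ^ (α - m)| ≤ r₁ ^ (α - m) + d ^ (α - m) := by
      refine (abs_sub _ _).trans (le_of_eq ?_)
      rw [abs_of_nonneg (by positivity), abs_of_nonneg (by positivity)]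
    have hk : d ^ (α - m) * (R ^ (-β - m) * d ^ (-σ)) ≤ D * M := by
      have : d ^ (α - σ - m) * R ^ (-β - m) ≤ D * M :=
        rpow_mul_max_rpow_le_closedMajorant' h₁ h₂ hd t₃ (by linarith) (by ring)
      rw [show α - σ - (m:ℝ) = α - m + -σ by ring, Real.rpow_add hd] at this
      linarith
    have hk' : r₁ ^ (α - m) * (R ^ (-β - m) * d ^ (-σ)) ≤ (D + (1 / 2) ^ (-σ)) * M := by
      rw [add_mul]
      rcases le_or_gt d r₁ with h | h
      · have : r₁ ^ (α - m) ≤ d ^ (α - m) := Real.rpow_le_rpow_of_nonpos hd h (by linarith)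
        calc _ ≤ d ^ (α - m) * (R ^ (-β - m) * d ^ (-σ)) := by gcongr
          _ ≤ D * M := hk
          _ ≤ _ := le_add_of_nonneg_right (by positivity)
      · have hRd : 1 / 2 * R ≤ d := by
          rcases max_choice r₁ r₂ with h | h <;> rw [hR, h] <;> linarith
        have h3 : d ^ (-σ) ≤ (1 / 2) ^ (-σ) * R ^ (-σ) :=
          rpow_le_mul_rpow_of_nonpos (by norm_num) hR0 hRd (by linarith)
        have h4 : r₁ ^ (α - m) * R ^ (-β - σ - m) ≤ M :=
          rpow_mul_max_rpow_le_closedMajorant h₁ h₂ hd.le (Or.inl rfl) (by linarith) (by linarith)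
            (by ring)
        calc _ ≤ r₁ ^ (α - m) * (R ^ (-β - m) * ((1 / 2) ^ (-σ) * R ^ (-σ))) := by gcongr
          _ = (1 / 2) ^ (-σ) * (r₁ ^ (α - m) * R ^ (-β - σ - m)) := by
            rw [show -β - σ - (m:ℝ) = -β - m + -σ by ring, Real.rpow_add hR0]; ring
          _ ≤ (1 / 2) ^ (-σ) * M := by gcongr
          _ ≤ _ := le_add_of_nonneg_left (by positivity)
    calc _ ≤ (r₁ ^ (α - m) + d ^ (α - m)) * ((1 / 4) ^ (-β - m : ℝ) * R ^ (-β - m)) *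
          ((1 / 16) ^ (-σ) * d ^ (-σ)) := by gcongr
      _ = K * (d ^ (α - m) * (R ^ (-β - m) * d ^ (-σ)) +
          r₁ ^ (α - m) * (R ^ (-β - m) * d ^ (-σ))) := by rw [hK]; ring
      _ ≤ K * (D * M + (D + (1 / 2) ^ (-σ)) * M) := by gcongr
      _ = K * (D + D + (1 / 2) ^ (-σ)) * M := by ring
      _ ≤ _ := le_add_of_nonneg_left (by positivity)

/-- Controls the part away from `z₂` after the Hölder bound with exponent `β + σ + δ` for the
increment of the power centred at `z₁`; the case distinction is the same. -/
lemma exists_triangle_bound₃ (hαm : α < m) (hβ : 0 < β) (hσ : 0 < σ)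
    (hδ : 0 < δ) (hδ₂ : 2 * δ ≤ α - σ - β) (hm1 : 1 ≤ m) :
    ∃ C : ℝ, 0 < C ∧ ∀ r₁ r₂ d : ℝ, 0 < r₁ → 0 < r₂ → 0 < d → r₁ ≤ r₂ + d → r₂ ≤ r₁ + d →
      d ≤ r₁ + r₂ →
      r₁ ^ (α - m - (β + σ + δ)) * (r₂ ^ (σ + δ - m) * (min r₂ d / 2) ^ (-σ)) ≤
        C * closedMajorant m δ (α - σ - β) r₁ r₂ d := by
  have hm := Nat.cast_nonneg (α := ℝ) m
  have hm1' : (1:ℝ) ≤ m := by exact_mod_cast hm1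
  set K : ℝ := (1 / 4) ^ (σ + δ - m : ℝ) * (1 / 16) ^ (-σ) with hK
  have hK0 : 0 < K := by positivity
  set D : ℝ := 2 ^ (α - σ - m - (α - σ - β - δ - m)) with hD
  have hD0 : 0 < D := by positivity
  refine ⟨(1 / 2) ^ (-σ) + K * ((1 / 2) ^ (-(β + σ + δ)) * D + (1 / 2) ^ (-σ)), by positivity,
    fun r₁ r₂ d h₁ h₂ hd t₁ t₂ t₃ => ?_⟩
  set M := closedMajorant m δ (α - σ - β) r₁ r₂ d with hM
  have hM0 : 0 ≤ M := closedMajorant_nonneg h₁.le h₂.le hd.le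
  set R := max r₁ r₂ with hR
  have hR0 : 0 < R := lt_max_of_lt_left h₁
  have hρ0 : 0 < min r₂ d := lt_min h₂ hd
  rw [add_mul]
  rcases lt_or_ge r₂ (R / 4) with hc | hc
  · have hR1 : R = r₁ := by
      rcases max_choice r₁ r₂ with h | h
      · exact h
      · rw [hR, h] at hc; linarith
    have hmin : min r₂ d = r₂ := min_eq_left (by linarith)
    have hk : r₂ ^ (δ - m) * R ^ (α - m - (β + σ + δ)) ≤ M :=
      rpow_mul_max_rpow_le_closedMajorant h₁ h₂ hd.le (Or.inr rfl) (by linarith) (by linarith)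
        (by ring)
    rw [hmin, show r₂ / 2 = 1 / 2 * r₂ by ring, Real.mul_rpow (by norm_num) h₂.le]
    rw [hR1] at hk
    calc _ = (1 / 2) ^ (-σ) * (r₂ ^ (δ - m) * r₁ ^ (α - m - (β + σ + δ))) := by
          rw [show δ - (m:ℝ) = σ + δ - m + -σ by ring, Real.rpow_add h₂]; ring
      _ ≤ (1 / 2) ^ (-σ) * M := by gcongr
      _ ≤ _ := le_add_of_nonneg_right (by positivity)
  · have hb : r₂ ^ (σ + δ - m) ≤ (1 / 4) ^ (σ + δ - m : ℝ) * R ^ (σ + δ - m) :=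
      rpow_le_mul_rpow_of_nonpos (by norm_num) hR0 (by linarith) (by linarith)
    have hdR : d ≤ 2 * R := by linarith [le_max_left r₁ r₂, le_max_right r₁ r₂]
    have hb' : (min r₂ d / 2) ^ (-σ) ≤ (1 / 16) ^ (-σ) * d ^ (-σ) := by
      refine rpow_le_mul_rpow_of_nonpos (by norm_num) hd ?_ (by linarith)
      rcases min_choice r₂ d with h | h <;> rw [h] <;> linarith
    have hk' : r₁ ^ (α - m - (β + σ + δ)) * (R ^ (σ + δ - m) * d ^ (-σ)) ≤
        ((1 / 2) ^ (-(β + σ + δ)) * D + (1 / 2) ^ (-σ)) * M := by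
      rw [add_mul]
      rcases le_or_gt d r₁ with h | h
      · have e1 : r₁ ^ (α - m) ≤ d ^ (α - m) := Real.rpow_le_rpow_of_nonpos hd h (by linarith)
        have hRr : 1 / 2 * R ≤ r₁ := by
          rcases max_choice r₁ r₂ with h | h <;> rw [hR, h] <;> linarith
        have e2 : r₁ ^ (-(β + σ + δ)) ≤ (1 / 2) ^ (-(β + σ + δ)) * R ^ (-(β + σ + δ)) :=
          rpow_le_mul_rpow_of_nonpos (by norm_num) hR0 hRr (by linarith)
        have hk : d ^ (α - σ - m) * R ^ (-β - m) ≤ D * M :=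
          rpow_mul_max_rpow_le_closedMajorant' h₁ h₂ hd t₃ (by linarith) (by ring)
        calc _ = r₁ ^ (α - m) * r₁ ^ (-(β + σ + δ)) * (R ^ (σ + δ - m) * d ^ (-σ)) := by
              rw [← Real.rpow_add h₁]; rfl
          _ ≤ d ^ (α - m) * ((1 / 2) ^ (-(β + σ + δ)) * R ^ (-(β + σ + δ))) *
              (R ^ (σ + δ - m) * d ^ (-σ)) := by gcongr
          _ = (1 / 2) ^ (-(β + σ + δ)) * (d ^ (α - σ - m) * R ^ (-β - m)) := by
              rw [show α - σ - (m:ℝ) = α - m + -σ by ring, Real.rpow_add hd,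
                show -β - (m:ℝ) = -(β + σ + δ) + (σ + δ - m) by ring, Real.rpow_add hR0]
              ring
          _ ≤ (1 / 2) ^ (-(β + σ + δ)) * (D * M) := by gcongr
          _ = (1 / 2) ^ (-(β + σ + δ)) * D * M := by ring
          _ ≤ _ := le_add_of_nonneg_right (by positivity)
      · have hRd : 1 / 2 * R ≤ d := by
          rcases max_choice r₁ r₂ with h | h <;> rw [hR, h] <;> linarith
        have h3 : d ^ (-σ) ≤ (1 / 2) ^ (-σ) * R ^ (-σ) :=
          rpow_le_mul_rpow_of_nonpos (by norm_num) hR0 hRd (by linarith)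
        have h4 : r₁ ^ (α - m - (β + σ + δ)) * R ^ (δ - m) ≤ M :=
          rpow_mul_max_rpow_le_closedMajorant h₁ h₂ hd.le (Or.inl rfl) (by linarith) (by linarith)
            (by ring)
        calc _ ≤ r₁ ^ (α - m - (β + σ + δ)) *
              (R ^ (σ + δ - m) * ((1 / 2) ^ (-σ) * R ^ (-σ))) := by gcongr
          _ = (1 / 2) ^ (-σ) * (r₁ ^ (α - m - (β + σ + δ)) * R ^ (δ - m)) := by
            rw [show δ - (m:ℝ) = σ + δ - m + -σ by ring, Real.rpow_add hR0]; ring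
          _ ≤ (1 / 2) ^ (-σ) * M := by gcongr
          _ ≤ _ := le_add_of_nonneg_left (by positivity)
    calc _ ≤ r₁ ^ (α - m - (β + σ + δ)) * (((1 / 4) ^ (σ + δ - m : ℝ) * R ^ (σ + δ - m)) *
          ((1 / 16) ^ (-σ) * d ^ (-σ))) := by gcongr
      _ = K * (r₁ ^ (α - m - (β + σ + δ)) * (R ^ (σ + δ - m) * d ^ (-σ))) := by rw [hK]; ring
      _ ≤ K * (((1 / 2) ^ (-(β + σ + δ)) * D + (1 / 2) ^ (-σ)) * M) := by gcongr
      _ = K * ((1 / 2) ^ (-(β + σ + δ)) * D + (1 / 2) ^ (-σ)) * M := by ring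
      _ ≤ _ := le_add_of_nonneg_left (by positivity)

end Triangle

/-- Neighbourhoods of `x` and `z₂`, the two non-integrable singularities, are cut out, and `y`
cannot be close to both unless `r₂` is small, in which case `y` is far from `z₂` anyway. So one of
the two singular factors is always comparable to a power of the maximal distance, and a two-centre
integral remains. -/
lemma exists_lintegral_three_centre_le {m : ℕ} [NeZero m] {α β σ δ : ℝ} (hα : 0 < α)
    (hαm : α < m) (hβ : 0 < β) (hσ : 0 < σ) (hδ : 0 < δ)
    (hδ₂ : 2 * δ ≤ α - σ - β) :
    ∃ C : ℝ, 0 < C ∧ ∀ (x z₁ z₂ : Euc m), z₁ ≠ x → z₂ ≠ x → z₁ ≠ z₂ →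
      ∫⁻ y in {y : Euc m | min ‖x - z₂‖ ‖z₁ - z₂‖ / 2 ≤ ‖y - z₂‖} ∩
          {y | ‖x - z₁‖ / 2 ≤ ‖y - x‖},
        ENNReal.ofReal (‖y - z₁‖ ^ (α - m) * ‖y - x‖ ^ (-β - m) * ‖y - z₂‖ ^ (-σ - m)) ≤
      ENNReal.ofReal (C * closedMajorant m δ (α - σ - β) ‖x - z₁‖ ‖x - z₂‖ ‖z₁ - z₂‖) := by
  have hm := Nat.cast_nonneg (α := ℝ) m
  obtain ⟨C₁, hC₁, h₁⟩ := exists_lintegral_two_centre_le (m := m) hα hαm.le hβ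
  obtain ⟨C₂, hC₂, h₂⟩ := exists_lintegral_two_centre_le (m := m) hα hαm.le hσ
  set K₁ : ℝ := (1 / 8) ^ (-σ - m) * (C₁ * (1 / 2) ^ (α - β - m)) with hK₁
  set D : ℝ := 2 ^ (α - σ - m - (α - σ - β - δ - m)) with hD
  set K₂ : ℝ := (1 / 8) ^ (-β - m) * (C₂ * (1 / 16) ^ (α - σ - m)) with hK₂
  have hK₁0 : 0 < K₁ := by positivity
  have hK₂0 : 0 < K₂ := by positivity
  have hD0 : 0 < D := by positivity
  refine ⟨K₁ + K₂ * D, by positivity, fun x z₁ z₂ hz₁ hz₂ hz => ?_⟩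
  have e1 : 0 < ‖x - z₁‖ := norm_pos_iff.2 (sub_ne_zero.2 hz₁.symm)
  have e2 : 0 < ‖x - z₂‖ := norm_pos_iff.2 (sub_ne_zero.2 hz₂.symm)
  have ed : 0 < ‖z₁ - z₂‖ := norm_pos_iff.2 (sub_ne_zero.2 hz)
  have t₃ : ‖z₁ - z₂‖ ≤ ‖x - z₁‖ + ‖x - z₂‖ := by
    have : ‖z₁ - z₂‖ ≤ ‖x - z₂‖ + ‖x - z₁‖ := by simpa using norm_sub_le (x - z₂) (x - z₁)
    linarith
  set r₁ := ‖x - z₁‖ with hr₁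
  set r₂ := ‖x - z₂‖ with hr₂
  set d := ‖z₁ - z₂‖ with hd
  set M := closedMajorant m δ (α - σ - β) r₁ r₂ d with hM
  have hM0 : 0 ≤ M := closedMajorant_nonneg e1.le e2.le ed.le
  set R := max r₁ r₂ with hR
  have hR0 : 0 < R := lt_max_of_lt_left e1
  have hρ0 : 0 < min r₂ d := lt_min e2 ed
  have hk₁ : r₁ ^ (α - β - m) * R ^ (-σ - m) ≤ M :=
    rpow_mul_max_rpow_le_closedMajorant e1 e2 ed.le (Or.inl rfl) (by linarith) (by linarith)
      (by ring)
  have hk₂ : d ^ (α - σ - m) * R ^ (-β - m) ≤ D * M :=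
    rpow_mul_max_rpow_le_closedMajorant' e1 e2 ed t₃ (by linarith) (by ring)
  set S := {y : Euc m | min r₂ d / 2 ≤ ‖y - z₂‖} ∩ {y | r₁ / 2 ≤ ‖y - x‖} with hS
  set S₁ := {y : Euc m | r₁ / 2 ≤ ‖y - x‖} ∩ {y | 1 / 8 * R ≤ ‖y - z₂‖} with hS₁
  -- The condition on `r₂` does not involve `y`; it keeps the piece empty in the case `r₂ < R/4`,
  -- where its estimate would not be available.
  set S₂ := {y : Euc m | min r₂ d / 2 ≤ ‖y - z₂‖} ∩ ({y | 1 / 8 * R ≤ ‖y - x‖} ∩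
    {_y | R / 4 ≤ r₂}) with hS₂
  have mS₁ : MeasurableSet S₁ := (measurableSet_le (by fun_prop) (by fun_prop)).inter
    (measurableSet_le (by fun_prop) (by fun_prop))
  have mS₂ : MeasurableSet S₂ := (measurableSet_le (by fun_prop) (by fun_prop)).inter
    ((measurableSet_le (by fun_prop) (by fun_prop)).inter (MeasurableSet.const _))
  have hsub : S ⊆ S₁ ∪ S₂ := by
    rintro y ⟨hy₂, hy₁⟩
    have hy₁' : r₁ / 2 ≤ ‖y - x‖ := hy₁
    have ty : ‖x - z₂‖ ≤ ‖y - z₂‖ + ‖y - x‖ := by simpa using norm_sub_le (y - z₂) (y - x)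
    have ty' : ‖y - x‖ ≤ ‖y - z₂‖ + ‖x - z₂‖ := by simpa using norm_sub_le (y - z₂) (x - z₂)
    rcases lt_or_ge r₂ (R / 4) with hc | hc
    · have hR1 : R = r₁ := by
        rcases max_choice r₁ r₂ with h | h
        · exact h
        · rw [hR, h] at hc; linarith
      exact Or.inl ⟨hy₁, show 1 / 8 * R ≤ ‖y - z₂‖ by linarith⟩
    · rcases lt_or_ge ‖y - x‖ (1 / 8 * R) with h | h
      · exact Or.inl ⟨hy₁, show 1 / 8 * R ≤ ‖y - z₂‖ by linarith⟩
      · exact Or.inr ⟨hy₂, h, hc⟩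
  have i1 : ∫⁻ y in S₁, ENNReal.ofReal
      (‖y - z₁‖ ^ (α - m) * ‖y - x‖ ^ (-β - m) * ‖y - z₂‖ ^ (-σ - m)) ≤
      ENNReal.ofReal (K₁ * M) := by
    refine (setLIntegral_ofReal_le mS₁ (g := fun y => ‖y - z₁‖ ^ (α - m) * ‖y - x‖ ^ (-β - m))
      (A := (1 / 8) ^ (-σ - m) * R ^ (-σ - m)) (B := C₁ * (1 / 2 * r₁) ^ (α - β - m))
      (by positivity) (fun y hy => ?_) ?_).trans (ENNReal.ofReal_le_ofReal ?_)
    · rw [mul_comm]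
      exact mul_le_mul_of_nonneg_right (rpow_le_mul_rpow_of_nonpos (by norm_num) hR0 hy.2
        (by linarith)) (by positivity)
    · refine (lintegral_mono_set fun y hy => ?_).trans (h₁ x z₁ (1 / 2 * r₁) (by positivity))
      rw [mem_ofPred_eq, show 1 / 2 * r₁ = r₁ / 2 by ring]; exact hy.1
    · rw [Real.mul_rpow (by norm_num) e1.le]
      calc _ = K₁ * (r₁ ^ (α - β - m) * R ^ (-σ - m)) := by rw [hK₁]; ring
        _ ≤ _ := by gcongr
  have i2 : ∫⁻ y in S₂, ENNReal.ofReal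
      (‖y - z₁‖ ^ (α - m) * ‖y - x‖ ^ (-β - m) * ‖y - z₂‖ ^ (-σ - m)) ≤
      ENNReal.ofReal (K₂ * D * M) := by
    by_cases hc : R / 4 ≤ r₂
    · refine (setLIntegral_ofReal_le mS₂ (g := fun y => ‖y - z₁‖ ^ (α - m) * ‖y - z₂‖ ^ (-σ - m))
        (A := (1 / 8) ^ (-β - m) * R ^ (-β - m)) (B := C₂ * (min r₂ d / 2) ^ (α - σ - m))
        (by positivity) (fun y hy => ?_) ?_).trans (ENNReal.ofReal_le_ofReal ?_)
      · rw [mul_right_comm, mul_comm]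
        exact mul_le_mul_of_nonneg_right (rpow_le_mul_rpow_of_nonpos (by norm_num) hR0 hy.2.1
          (by linarith)) (by positivity)
      · exact (lintegral_mono_set fun y hy => hy.1).trans (h₂ z₂ z₁ _ (by positivity))
      · have hdR : d ≤ 2 * R := by linarith [le_max_left r₁ r₂, le_max_right r₁ r₂]
        have hb' : (min r₂ d / 2) ^ (α - σ - m) ≤ (1 / 16) ^ (α - σ - m) * d ^ (α - σ - m) := by
          refine rpow_le_mul_rpow_of_nonpos (by norm_num) ed ?_ (by linarith)
          rcases min_choice r₂ d with h | h <;> rw [h] <;> linarith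
        calc _ ≤ (1 / 8) ^ (-β - m) * R ^ (-β - m) *
              (C₂ * ((1 / 16) ^ (α - σ - m) * d ^ (α - σ - m))) := by gcongr
          _ = K₂ * (d ^ (α - σ - m) * R ^ (-β - m)) := by rw [hK₂]; ring
          _ ≤ K₂ * (D * M) := by gcongr
          _ = _ := by ring
    · have : S₂ = ∅ := by
        ext y; simp [hS₂, hc]
      rw [this]; simp
  have := setLIntegral_le_add hsub (by positivity) (by positivity) i1 i2
  rwa [← add_mul] at this

-- Near `z₂` the function in the modulus is Lipschitz, so `‖y - z₂‖^(1-σ-m)` appears, which is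
-- integrable since `σ < 1`; `exists_triangle_bound₁` and `exists_triangle_bound₂` cover the two
-- terms of the product rule. Away from `z₂` the terms at `y` and at `z₂` are separated: the latter
-- falls under `exists_triangle_bound₂`, the former under `exists_triangle_bound₃` and, far from
-- `x`, `exists_lintegral_three_centre_le`.
set_option maxHeartbeats 1000000 in
lemma exists_doubleCommutatorKernel_le {m : ℕ} [NeZero m] {α β σ δ : ℝ}
    (hαm : α < m) (hβ : 0 < β) (hσ : 0 < σ) (hδ : 0 < δ) (hδ₁ : β + σ + δ ≤ 1)
    (hδ₂ : 2 * δ ≤ α - σ - β) :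
    ∃ C : ℝ, 0 < C ∧ ∀ (x z₁ z₂ : Euc m), z₁ ≠ x → z₂ ≠ x → z₁ ≠ z₂ →
      ∫⁻ y, ENNReal.ofReal
        (|(‖x - z₁‖ ^ (α - m) - ‖y - z₁‖ ^ (α - m)) * ‖y - x‖ ^ (-β - m) -
          (‖x - z₁‖ ^ (α - m) - ‖z₂ - z₁‖ ^ (α - m)) * ‖z₂ - x‖ ^ (-β - m)| *
            ‖y - z₂‖ ^ (-σ - m)) ≤
      ENNReal.ofReal (C * closedMajorant m δ (α - σ - β) ‖x - z₁‖ ‖x - z₂‖ ‖z₁ - z₂‖) := by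
  have hm := Nat.cast_nonneg (α := ℝ) m
  have hm1 : 1 ≤ m := Nat.one_le_iff_ne_zero.2 (NeZero.ne m)
  have hm1' : (1:ℝ) ≤ m := by exact_mod_cast hm1
  -- This turns `‖y - x‖^(-β-m)` into `‖y - x‖^(σ+δ-m)`, which is locally integrable and just short
  -- of the decay `‖y - z₂‖^(-σ-m)` by `δ`. The hypothesis `hδ₁` says `κ ≤ 1`.
  set κ := β + σ + δ with hκ
  obtain ⟨Ca, hCa, hDa⟩ := exists_abs_norm_rpow_sub_le_near (α - m) 1 (by linarith) le_rfl
  obtain ⟨Cb, hCb, hDb⟩ := exists_abs_norm_rpow_sub_le_near (-β - m) 1 (by linarith) le_rfl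
  obtain ⟨Cc, hCc, hDc⟩ := exists_abs_norm_rpow_sub_le (α - m) κ (by linarith) (by linarith) hδ₁
  obtain ⟨A₁, hA₁, hT₁⟩ := exists_triangle_bound₁ (m := m) hαm hβ hσ hδ hδ₁ hδ₂
  obtain ⟨A₂, hA₂, hT₂⟩ := exists_triangle_bound₂ (m := m) hCa hαm hβ hσ hδ hδ₁ hδ₂
  obtain ⟨A₃, hA₃, hT₃⟩ := exists_triangle_bound₃ (m := m) hαm hβ hσ hδ hδ₂ hm1
  obtain ⟨A₄, hA₄, hT₄⟩ := exists_lintegral_three_centre_le (m := m) (by linarith) hαm hβ hσ hδ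
    hδ₂
  obtain ⟨B₁, hB₁, hI₁⟩ := exists_lintegral_ball_le (m := m) (show 0 < 1 - σ by linarith)
  obtain ⟨B₂, hB₂, hI₂⟩ := exists_lintegral_compl_ball_le (m := m) hσ
  obtain ⟨B₃, hB₃, hI₃⟩ := exists_lintegral_two_centre_le' (m := m)
    (show 0 < σ + δ by linarith) (show σ + δ ≤ m by linarith) hσ
  set D : ℝ := (1 / 2) ^ (-β - m : ℝ) with hD
  have hD0 : 0 < D := by positivity
  refine ⟨B₁ * (Ca * D * A₁ + Cb * A₂) + (B₂ * A₂ + Cc * B₃ * A₃ + A₄), by positivity,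
    fun x z₁ z₂ hz₁ hz₂ hz => ?_⟩
  have e1 : 0 < ‖x - z₁‖ := norm_pos_iff.2 (sub_ne_zero.2 hz₁.symm)
  have e2 : 0 < ‖x - z₂‖ := norm_pos_iff.2 (sub_ne_zero.2 hz₂.symm)
  have ed : 0 < ‖z₁ - z₂‖ := norm_pos_iff.2 (sub_ne_zero.2 hz)
  have t₁ : ‖x - z₁‖ ≤ ‖x - z₂‖ + ‖z₁ - z₂‖ := by
    simpa using norm_sub_le (x - z₂) (z₁ - z₂)
  have t₂ : ‖x - z₂‖ ≤ ‖x - z₁‖ + ‖z₁ - z₂‖ := by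
    simpa using norm_add_le (x - z₁) (z₁ - z₂)
  have t₃ : ‖z₁ - z₂‖ ≤ ‖x - z₁‖ + ‖x - z₂‖ := by
    have : ‖z₁ - z₂‖ ≤ ‖x - z₂‖ + ‖x - z₁‖ := by simpa using norm_sub_le (x - z₂) (x - z₁)
    linarith
  have n₁ : ‖z₂ - z₁‖ = ‖z₁ - z₂‖ := norm_sub_rev _ _
  have n₂ : ‖z₂ - x‖ = ‖x - z₂‖ := norm_sub_rev _ _
  have hg : ‖x - z₂‖ ≤ ‖x - z₁‖ / 2 → |‖x - z₁‖ ^ (α - m) - ‖z₁ - z₂‖ ^ (α - m)| ≤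
      Ca * (‖x - z₂‖ * ‖x - z₁‖ ^ (α - m - 1)) := by
    intro h
    have := hDa (x - z₁) (z₂ - x) (sub_ne_zero.2 hz₁.symm) (by rwa [n₂])
    rwa [show x - z₁ + (z₂ - x) = z₂ - z₁ by abel, n₁, n₂, abs_sub_comm, Real.rpow_one] at this
  rw [n₁, n₂]
  have hT₁' := hT₁ _ _ _ e1 e2 ed t₁ t₂ t₃
  have hT₂' := hT₂ _ _ _ e1 e2 ed t₁ t₂ t₃ hg
  have hT₃' := hT₃ _ _ _ e1 e2 ed t₁ t₂ t₃
  have hT₄' := hT₄ x z₁ z₂ hz₁ hz₂ hz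
  set r₁ := ‖x - z₁‖ with hr₁
  set r₂ := ‖x - z₂‖ with hr₂
  set d := ‖z₁ - z₂‖ with hd
  set M := closedMajorant m δ (α - σ - β) r₁ r₂ d with hM
  have hM0 : 0 ≤ M := closedMajorant_nonneg e1.le e2.le ed.le
  set ρ := min r₂ d / 2 with hρ
  have hρ0 : 0 < ρ := by have := lt_min e2 ed; positivity
  have hρr : ρ ≤ r₂ / 2 := by rw [hρ]; linarith [min_le_left r₂ d]
  have hρd : ρ ≤ d / 2 := by rw [hρ]; linarith [min_le_right r₂ d]
  set g₂ := r₁ ^ (α - m) - d ^ (α - m) with hg₂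
  set F : Euc m → ℝ := fun y => |(r₁ ^ (α - m) - ‖y - z₁‖ ^ (α - m)) * ‖y - x‖ ^ (-β - m) -
          g₂ * r₂ ^ (-β - m)| * ‖y - z₂‖ ^ (-σ - m) with hF
  set S₁ := {y : Euc m | ‖y - z₂‖ < ρ} with hS₁
  set S₂ := {y : Euc m | ρ ≤ ‖y - z₂‖} with hS₂
  set U := {y : Euc m | ρ ≤ ‖y - z₂‖} ∩ {y | r₁ / 2 ≤ ‖y - x‖} with hU
  have mS₁ : MeasurableSet S₁ := measurableSet_lt (by fun_prop) (by fun_prop)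
  have mS₂ : MeasurableSet S₂ := measurableSet_le (by fun_prop) (by fun_prop)
  have mU : MeasurableSet U := (measurableSet_le (by fun_prop) (by fun_prop)).inter
    (measurableSet_le (by fun_prop) (by fun_prop))
  have i1 : ∫⁻ y in S₁, ENNReal.ofReal (F y) ≤
      ENNReal.ofReal (B₁ * (Ca * D * A₁ + Cb * A₂) * M) := by
    refine (setLIntegral_ofReal_le mS₁ (g := fun y => ‖y - z₂‖ ^ (1 - σ - m))
      (A := Ca * d ^ (α - m - 1) * (D * r₂ ^ (-β - m)) + |g₂| * (Cb * r₂ ^ (-β - m - 1)))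
      (B := B₁ * ρ ^ (1 - σ)) (by positivity) (fun y hy => ?_) (hI₁ z₂ ρ hρ0)).trans
        (ENNReal.ofReal_le_ofReal ?_)
    · have hy' : ‖y - z₂‖ < ρ := hy
      rcases eq_or_ne y z₂ with rfl | hyz
      · have : F y = 0 := by
          simp only [hF]
          rw [n₁, n₂, ← hg₂, sub_self, abs_zero, zero_mul]
        rw [this]; positivity
      have ey : 0 < ‖y - z₂‖ := norm_pos_iff.2 (sub_ne_zero.2 hyz)
      have b1 : |‖y - z₁‖ ^ (α - m) - d ^ (α - m)| ≤ Ca * (‖y - z₂‖ * d ^ (α - m - 1)) := by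
        have := hDa (z₂ - z₁) (y - z₂) (sub_ne_zero.2 hz.symm) (by rw [n₁]; linarith)
        rwa [show z₂ - z₁ + (y - z₂) = y - z₁ by abel, n₁, Real.rpow_one] at this
      have b2 : |‖y - x‖ ^ (-β - m) - r₂ ^ (-β - m)| ≤
          Cb * (‖y - z₂‖ * r₂ ^ (-β - m - 1)) := by
        have := hDb (z₂ - x) (y - z₂) (sub_ne_zero.2 hz₂) (by rw [n₂]; linarith)
        rwa [show z₂ - x + (y - z₂) = y - x by abel, n₂, Real.rpow_one] at this
      have b3 : ‖y - x‖ ^ (-β - m) ≤ D * r₂ ^ (-β - m) := by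
        refine rpow_le_mul_rpow_of_nonpos (by norm_num) e2 ?_ (by linarith)
        have : ‖x - z₂‖ ≤ ‖y - z₂‖ + ‖y - x‖ := by simpa using norm_sub_le (y - z₂) (y - x)
        linarith
      have hs : ‖y - z₂‖ * ‖y - z₂‖ ^ (-σ - m) = ‖y - z₂‖ ^ (1 - σ - m) := by
        rw [show 1 - σ - (m:ℝ) = 1 + (-σ - m) by ring, Real.rpow_add ey, Real.rpow_one]
      calc F y = |-((‖y - z₁‖ ^ (α - m) - d ^ (α - m)) * ‖y - x‖ ^ (-β - m)) +
            g₂ * (‖y - x‖ ^ (-β - m) - r₂ ^ (-β - m))| * ‖y - z₂‖ ^ (-σ - m) := by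
            simp only [hF, hg₂]; congr 2; ring
        _ ≤ (|‖y - z₁‖ ^ (α - m) - d ^ (α - m)| * ‖y - x‖ ^ (-β - m) +
            |g₂| * |‖y - x‖ ^ (-β - m) - r₂ ^ (-β - m)|) * ‖y - z₂‖ ^ (-σ - m) := by
            refine mul_le_mul_of_nonneg_right ((abs_add_le _ _).trans (le_of_eq ?_))
              (by positivity)
            rw [abs_neg, abs_mul, abs_mul, abs_of_nonneg (show 0 ≤ ‖y - x‖ ^ (-β - (m:ℝ)) by
              positivity)]
        _ ≤ (Ca * (‖y - z₂‖ * d ^ (α - m - 1)) * (D * r₂ ^ (-β - m)) +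
            |g₂| * (Cb * (‖y - z₂‖ * r₂ ^ (-β - m - 1)))) * ‖y - z₂‖ ^ (-σ - m) := by gcongr
        _ = _ := by rw [← hs]; ring
    · have q : ρ ^ (1 - σ) * r₂ ^ (-β - m - 1) ≤ r₂ ^ (-β - m) * ρ ^ (-σ) := by
        have := rpow_mul_rpow_le_of_le (p := 1 - σ) (q := -β - m - 1) (p' := -σ) (q' := -β - m)
          hρ0 e2 one_pos (by linarith) (by linarith) (by ring)
        rw [Real.one_rpow, one_mul] at this
        linarith
      have q' : |g₂| * (ρ ^ (1 - σ) * r₂ ^ (-β - m - 1)) ≤ A₂ * M := by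
        calc _ ≤ |g₂| * (r₂ ^ (-β - m) * ρ ^ (-σ)) := mul_le_mul_of_nonneg_left q (abs_nonneg _)
          _ = |g₂| * r₂ ^ (-β - m) * ρ ^ (-σ) := by ring
          _ ≤ _ := hT₂'
      calc _ = B₁ * (Ca * D * (ρ ^ (1 - σ) * (d ^ (α - m - 1) * r₂ ^ (-β - m))) +
            Cb * (|g₂| * (ρ ^ (1 - σ) * r₂ ^ (-β - m - 1)))) := by ring
        _ ≤ B₁ * (Ca * D * (A₁ * M) + Cb * (A₂ * M)) :=
            mul_le_mul_of_nonneg_left (add_le_add (mul_le_mul_of_nonneg_left hT₁' (by positivity))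
              (mul_le_mul_of_nonneg_left q' hCb.le)) hB₁.le
        _ = _ := by ring
  set f₁ : Euc m → ℝ := fun y => |g₂| * r₂ ^ (-β - m) * ‖y - z₂‖ ^ (-σ - m) with hf₁
  set f₂ : Euc m → ℝ := fun y => Cc * r₁ ^ (α - m - κ) *
    (‖y - x‖ ^ (σ + δ - m) * ‖y - z₂‖ ^ (-σ - m)) with hf₂
  set f₃ : Euc m → ℝ := fun y =>
    ‖y - z₁‖ ^ (α - m) * ‖y - x‖ ^ (-β - m) * ‖y - z₂‖ ^ (-σ - m) with hf₃
  have hpt : ∀ y ∈ S₂, y ≠ x → ENNReal.ofReal (F y) ≤ ENNReal.ofReal (f₁ y) +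
      ENNReal.ofReal (f₂ y) + U.indicator (fun y => ENNReal.ofReal (f₃ y)) y := by
    intro y hy hyx
    have ey : 0 < ‖y - x‖ := norm_pos_iff.2 (sub_ne_zero.2 hyx)
    have a2 := hDc (x - z₁) (y - x) (sub_ne_zero.2 hz₁.symm)
    rw [show x - z₁ + (y - x) = y - z₁ by abel, abs_sub_comm] at a2
    have a3 : ‖y - x‖ ^ (σ + δ - m) = ‖y - x‖ ^ κ * ‖y - x‖ ^ (-β - m) := by
      rw [← Real.rpow_add ey]; congr 1; rw [hκ]; ring
    have n1 : 0 ≤ f₁ y := by positivity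
    have n2 : 0 ≤ f₂ y := by positivity
    have n3 : 0 ≤ f₃ y := by positivity
    have hF' : F y ≤ f₁ y + |r₁ ^ (α - m) - ‖y - z₁‖ ^ (α - m)| *
        (‖y - x‖ ^ (-β - m) * ‖y - z₂‖ ^ (-σ - m)) := by
      calc F y ≤ (|r₁ ^ (α - m) - ‖y - z₁‖ ^ (α - m)| * ‖y - x‖ ^ (-β - m) +
            |g₂| * r₂ ^ (-β - m)) * ‖y - z₂‖ ^ (-σ - m) := by
            refine mul_le_mul_of_nonneg_right ((abs_sub _ _).trans (le_of_eq ?_))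
              (by positivity)
            rw [abs_mul, abs_mul, abs_of_nonneg (show 0 ≤ ‖y - x‖ ^ (-β - (m:ℝ)) by
              positivity), abs_of_nonneg (show 0 ≤ r₂ ^ (-β - (m:ℝ)) by positivity)]
        _ = _ := by simp only [hf₁]; ring
    by_cases hyU : y ∈ U
    · rw [indicator_of_mem hyU, ← ENNReal.ofReal_add n1 n2,
        ← ENNReal.ofReal_add (by positivity) n3]
      apply ENNReal.ofReal_le_ofReal
      have : y - x ∈ {w : Euc m | r₁ / 2 ≤ ‖w‖} := hyU.2
      rw [indicator_of_mem this, show x - z₁ + (y - x) = y - z₁ by abel] at a2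
      calc F y ≤ f₁ y + (Cc * (‖y - x‖ ^ κ * r₁ ^ (α - m - κ)) + ‖y - z₁‖ ^ (α - m)) *
          (‖y - x‖ ^ (-β - m) * ‖y - z₂‖ ^ (-σ - m)) := hF'.trans (by gcongr)
        _ = _ := by simp only [hf₂, hf₃, a3]; ring
    · rw [indicator_of_notMem hyU, ← ENNReal.ofReal_add n1 n2, add_zero]
      apply ENNReal.ofReal_le_ofReal
      have : y - x ∉ {w : Euc m | r₁ / 2 ≤ ‖w‖} := fun h => hyU ⟨hy, h⟩
      rw [indicator_of_notMem this, add_zero] at a2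
      calc F y ≤ f₁ y + (Cc * (‖y - x‖ ^ κ * r₁ ^ (α - m - κ))) *
          (‖y - x‖ ^ (-β - m) * ‖y - z₂‖ ^ (-σ - m)) := hF'.trans (by gcongr)
        _ = _ := by simp only [hf₂, a3]; ring
  have j1 : ∫⁻ y in S₂, ENNReal.ofReal (f₁ y) ≤ ENNReal.ofReal (B₂ * A₂ * M) := by
    refine (setLIntegral_ofReal_le mS₂ (by positivity) (fun y _ => le_rfl)
      (hI₂ z₂ ρ hρ0)).trans (ENNReal.ofReal_le_ofReal ?_)
    calc _ = B₂ * (|g₂| * r₂ ^ (-β - m) * ρ ^ (-σ)) := by ring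
      _ ≤ B₂ * (A₂ * M) := by gcongr
      _ = _ := by ring
  have j2 : ∫⁻ y in S₂, ENNReal.ofReal (f₂ y) ≤ ENNReal.ofReal (Cc * B₃ * A₃ * M) := by
    refine (setLIntegral_ofReal_le mS₂ (by positivity) (fun y _ => le_rfl)
      (hI₃ z₂ x ρ hρ0 (by rw [n₂]; linarith))).trans (ENNReal.ofReal_le_ofReal ?_)
    rw [n₂]
    calc _ = Cc * B₃ * (r₁ ^ (α - m - κ) * (r₂ ^ (σ + δ - m) * ρ ^ (-σ))) := by ring
      _ ≤ Cc * B₃ * (A₃ * M) := by gcongr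
      _ = _ := by ring
  have j3 : ∫⁻ y in S₂, U.indicator (fun y => ENNReal.ofReal (f₃ y)) y ≤
      ENNReal.ofReal (A₄ * M) := by
    refine (setLIntegral_le_lintegral _ _).trans ?_
    rw [lintegral_indicator mU]
    exact hT₄'
  have mf₁ : Measurable fun y => ENNReal.ofReal (f₁ y) := by fun_prop
  have mf₂ : Measurable fun y => ENNReal.ofReal (f₂ y) := by fun_prop
  have i2 : ∫⁻ y in S₂, ENNReal.ofReal (F y) ≤
      ENNReal.ofReal ((B₂ * A₂ + Cc * B₃ * A₃ + A₄) * M) := by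
    have := nontrivial_euc m
    calc _ ≤ ∫⁻ y in S₂, (ENNReal.ofReal (f₁ y) + ENNReal.ofReal (f₂ y) +
          U.indicator (fun y => ENNReal.ofReal (f₃ y)) y) := by
          refine lintegral_mono_ae ?_
          filter_upwards [ae_restrict_of_ae (Measure.ae_ne volume x),
            ae_restrict_mem mS₂] with y hy hyS
          exact hpt y hyS hy
      _ = (∫⁻ y in S₂, ENNReal.ofReal (f₁ y)) + (∫⁻ y in S₂, ENNReal.ofReal (f₂ y)) +
          (∫⁻ y in S₂, U.indicator (fun y => ENNReal.ofReal (f₃ y)) y) :=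
          (lintegral_add_left (mf₁.add mf₂) _).trans (congrArg (· + _)
            (lintegral_add_left mf₁ _))
      _ ≤ _ := add_le_add (add_le_add j1 j2) j3
      _ = _ := by
          rw [← ENNReal.ofReal_add (by positivity) (by positivity),
            ← ENNReal.ofReal_add (by positivity) (by positivity)]
          congr 1; ring
  rw [← setLIntegral_univ]
  have := setLIntegral_le_add (S := univ) (fun y _ => lt_or_ge ‖y - z₂‖ ρ) (by positivity)
    (by positivity) i1 i2
  rwa [← add_mul] at this

/-! ### Powers of the symbol as integrated differences -/

lemma two_sub_two_cos_nonneg (u : ℝ) : 0 ≤ 2 - 2 * Real.cos u := by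
  linarith [Real.cos_le_one u]

lemma two_sub_two_cos_le_sq (u : ℝ) : 2 - 2 * Real.cos u ≤ u ^ 2 := by
  linarith [Real.one_sub_sq_div_two_le_cos (x := u)]

lemma two_sub_two_cos_le_four (u : ℝ) : 2 - 2 * Real.cos u ≤ 4 := by
  linarith [Real.neg_one_le_cos u]

lemma norm_one_sub_exp_eq (u : ℝ) :
    ‖1 - Complex.exp (u * Complex.I)‖ = (2 - 2 * Real.cos u) ^ (1 / 2 : ℝ) := by
  rw [← Real.sqrt_eq_rpow, Complex.norm_def]
  congr 1
  rw [Complex.exp_mul_I, ← Complex.ofReal_cos, ← Complex.ofReal_sin, Complex.normSq_apply]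
  simp [-Complex.ofReal_cos, -Complex.ofReal_sin]
  nlinarith [Real.sin_sq_add_cos_sq u]

/-- With `z = e^(iu)` the sum is `z^(-N) (1 - z)^(2N)` by the binomial theorem, and `(1 - z)² = -z
(2 - 2 cos u)`. -/
lemma sum_symmDiffCoeff_mul_exp (N : ℕ) (u : ℝ) :
    ∑ i ∈ Finset.range (2 * N + 1), (symmDiffCoeff N i : ℂ) *
        Complex.exp ((((i - N : ℝ) * u : ℝ) : ℂ) * Complex.I) =
      (((-1) ^ N * (2 - 2 * Real.cos u) ^ N : ℝ) : ℂ) := by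
  set z := Complex.exp (u * Complex.I) with hz
  have hz0 : z ≠ 0 := Complex.exp_ne_zero _
  have h1 : ∀ i ∈ Finset.range (2 * N + 1), (symmDiffCoeff N i : ℂ) *
      Complex.exp ((((i - N : ℝ) * u : ℝ) : ℂ) * Complex.I) =
      (z ^ N)⁻¹ * ((-z) ^ i * 1 ^ (2 * N - i) * ((2 * N).choose i : ℂ)) := by
    intro i _
    have : Complex.exp ((((i - N : ℝ) * u : ℝ) : ℂ) * Complex.I) = z ^ i * (z ^ N)⁻¹ := by
      rw [hz, ← Complex.exp_nat_mul, ← Complex.exp_nat_mul, ← Complex.exp_neg, ← Complex.exp_add]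
      congr 1; push_cast; ring
    rw [this, symmDiffCoeff, neg_pow z]
    push_cast; ring
  rw [Finset.sum_congr rfl h1, ← Finset.mul_sum, ← add_pow]
  have h2 : (-z + 1) ^ 2 = z * (-((2 - 2 * Real.cos u : ℝ) : ℂ)) := by
    have h3 : (2 : ℂ) * Complex.cos u = z + z⁻¹ := by
      rw [Complex.two_cos, hz, ← Complex.exp_neg, neg_mul]
    push_cast
    rw [h3]; field_simp; ring
  rw [pow_mul, h2, mul_pow, neg_pow, ← mul_assoc, inv_mul_cancel₀ (pow_ne_zero _ hz0)]
  push_cast; ring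

/-- At the origin the weight is `O(‖h‖^(2ν))` and `θ < 2ν` helps; at infinity it is bounded and `θ >
0` helps. -/
lemma lintegral_cosWeight_lt_top {m : ℕ} [NeZero m] {ν θ : ℝ} (hν : 0 < ν) (hθ : 0 < θ)
    (hθν : θ < 2 * ν) (e : Euc m) (he : ‖e‖ = 1) :
    ∫⁻ h : Euc m, ENNReal.ofReal
      ((2 - 2 * Real.cos (2 * Real.pi * inner ℝ e h)) ^ ν * ‖h‖ ^ (-θ - m)) < ⊤ := by
  obtain ⟨C₁, hC₁, H₁⟩ := exists_lintegral_ball_le (m := m) (p := 2 * ν - θ) (by linarith)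
  obtain ⟨C₂, hC₂, H₂⟩ := exists_lintegral_compl_ball_le (m := m) (p := θ) hθ
  have nt := nontrivial_euc m
  have b1 := setLIntegral_ofReal_le (μ := (volume : Measure (Euc m)))
    (S := {h : Euc m | ‖h - 0‖ < 1})
    (f := fun h => (2 - 2 * Real.cos (2 * Real.pi * inner ℝ e h)) ^ ν * ‖h‖ ^ (-θ - m))
    (g := fun h => ‖h - 0‖ ^ (2 * ν - θ - m)) (A := (2 * Real.pi) ^ (2 * ν))
    (measurableSet_lt (by fun_prop) (by fun_prop)) (by positivity) (by
      intro h _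
      rw [sub_zero]
      rcases eq_or_ne h 0 with rfl | hh
      · simp only [inner_zero_right, mul_zero, Real.cos_zero, mul_one, sub_self,
          Real.zero_rpow hν.ne', zero_mul]
        positivity
      have hh' : 0 < ‖h‖ := norm_pos_iff.2 hh
      have h1 : 2 - 2 * Real.cos (2 * Real.pi * inner ℝ e h) ≤ (2 * Real.pi * ‖h‖) ^ 2 := by
        refine (two_sub_two_cos_le_sq _).trans ?_
        rw [sq_le_sq, abs_mul, abs_of_pos Real.two_pi_pos, abs_mul, abs_of_pos Real.two_pi_pos,
          abs_norm]
        refine mul_le_mul_of_nonneg_left ?_ Real.two_pi_pos.le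
        simpa [he] using abs_real_inner_le_norm e h
      calc (2 - 2 * Real.cos (2 * Real.pi * inner ℝ e h)) ^ ν * ‖h‖ ^ (-θ - m)
          ≤ ((2 * Real.pi * ‖h‖) ^ 2) ^ ν * ‖h‖ ^ (-θ - m) :=
            mul_le_mul_of_nonneg_right
              (Real.rpow_le_rpow (two_sub_two_cos_nonneg _) h1 hν.le) (by positivity)
        _ = _ := by
            rw [← Real.rpow_natCast, ← Real.rpow_mul (by positivity),
              Real.mul_rpow (by positivity) hh'.le, mul_assoc]
            push_cast
            rw [← Real.rpow_add hh']
            congr 2; ring) (H₁ 0 1 one_pos)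
  have b2 := setLIntegral_ofReal_le (μ := (volume : Measure (Euc m)))
    (S := {h : Euc m | 1 ≤ ‖h - 0‖})
    (f := fun h => (2 - 2 * Real.cos (2 * Real.pi * inner ℝ e h)) ^ ν * ‖h‖ ^ (-θ - m))
    (g := fun h => ‖h - 0‖ ^ (-θ - m)) (A := 4 ^ ν)
    (measurableSet_le (by fun_prop) (by fun_prop)) (by positivity) (by
      intro h _
      rw [sub_zero]
      exact mul_le_mul_of_nonneg_right (Real.rpow_le_rpow (two_sub_two_cos_nonneg _)
        (two_sub_two_cos_le_four _) hν.le) (by positivity)) (H₂ 0 1 one_pos)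
  have := setLIntegral_le_add (S := univ) (fun h _ => lt_or_ge ‖h - 0‖ 1)
    (by positivity) (by positivity) b1 b2
  rw [Measure.restrict_univ] at this
  exact this.trans_lt ENNReal.ofReal_lt_top

lemma lintegral_cosWeight_pos {m : ℕ} [NeZero m] {ν θ : ℝ} (e : Euc m) (he : ‖e‖ = 1) :
    0 < ∫⁻ h : Euc m, ENNReal.ofReal
      ((2 - 2 * Real.cos (2 * Real.pi * inner ℝ e h)) ^ ν * ‖h‖ ^ (-θ - m)) := by
  have nt := nontrivial_euc m
  rw [lintegral_pos_iff_support (by fun_prop)]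
  have hsub : {h : Euc m | 0 < 2 - 2 * Real.cos (2 * Real.pi * inner ℝ e h)} ∩ {0}ᶜ ⊆
      Function.support fun h : Euc m => ENNReal.ofReal
      ((2 - 2 * Real.cos (2 * Real.pi * inner ℝ e h)) ^ ν * ‖h‖ ^ (-θ - m)) := by
    rintro h ⟨h1, h2⟩
    rw [Function.mem_support, ne_eq, ENNReal.ofReal_eq_zero, not_le]
    have h2' : 0 < ‖h‖ := norm_pos_iff.2 h2
    have h1' : 0 < 2 - 2 * Real.cos (2 * Real.pi * inner ℝ e h) := h1
    positivity
  refine lt_of_lt_of_le (IsOpen.measure_pos _ ?_ ?_) (measure_mono hsub)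
  · exact (isOpen_lt (by fun_prop) (by fun_prop)).inter isOpen_compl_singleton
  -- At `h = e/2` the phase is `π`, so the weight attains its maximum `4`.
  · refine ⟨(1 / 2 : ℝ) • e, ?_, ?_⟩
    · rw [Set.mem_ofPred_eq, inner_smul_right, real_inner_self_eq_norm_sq, he]
      have : 2 * Real.pi * (1 / 2 * 1 ^ 2) = Real.pi := by ring
      rw [this, Real.cos_pi]; norm_num
    · rw [mem_compl_singleton_iff]
      refine smul_ne_zero (by norm_num) ?_
      rw [← norm_pos_iff, he]; exact one_pos

lemma lintegral_cosWeight_rotate {m : ℕ} {ν p : ℝ} {e e' : Euc m} (he : ‖e‖ = ‖e'‖) :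
    ∫⁻ h : Euc m, ENNReal.ofReal
      ((2 - 2 * Real.cos (2 * Real.pi * inner ℝ e h)) ^ ν * ‖h‖ ^ p) =
    ∫⁻ h : Euc m, ENNReal.ofReal
      ((2 - 2 * Real.cos (2 * Real.pi * inner ℝ e' h)) ^ ν * ‖h‖ ^ p) := by
  set R := (ℝ ∙ (e - e'))ᗮ.reflection with hR
  have hRe : R e = e' := Submodule.reflection_sub he
  rw [← (LinearIsometryEquiv.measurePreserving R).lintegral_comp_emb
    R.toHomeomorph.measurableEmbedding (fun h => ENNReal.ofReal
      ((2 - 2 * Real.cos (2 * Real.pi * inner ℝ e' h)) ^ ν * ‖h‖ ^ p))]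
  refine lintegral_congr fun h => ?_
  rw [← hRe, LinearIsometryEquiv.inner_map_map, LinearIsometryEquiv.norm_map]

/-- As a function of `ξ` the integral is invariant under reflections and homogeneous of degree `θ`,
hence a multiple of `‖ξ‖^θ`. The value of the constant is never needed, only that it is finite and
positive. -/
lemma exists_lintegral_cosWeight_eq {m : ℕ} [NeZero m] {ν θ : ℝ} (hν : 0 < ν) (hθ : 0 < θ)
    (hθν : θ < 2 * ν) :
    ∃ c : ℝ, 0 < c ∧ ∀ ξ : Euc m, ∫⁻ h : Euc m, ENNReal.ofReal
      ((2 - 2 * Real.cos (2 * Real.pi * inner ℝ ξ h)) ^ ν * ‖h‖ ^ (-θ - m)) =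
        ENNReal.ofReal (c * (2 * Real.pi * ‖ξ‖) ^ θ) := by
  have nt := nontrivial_euc m
  obtain ⟨e, he⟩ := exists_norm_eq (Euc m) zero_le_one
  set G : Euc m → ℝ≥0∞ := fun ξ => ∫⁻ h : Euc m, ENNReal.ofReal
      ((2 - 2 * Real.cos (2 * Real.pi * inner ℝ ξ h)) ^ ν * ‖h‖ ^ (-θ - m)) with hG
  have hfin : G e < ⊤ := lintegral_cosWeight_lt_top hν hθ hθν e he
  have hpos : 0 < G e := lintegral_cosWeight_pos e he
  have hp : 0 < (2 * Real.pi) ^ θ := by positivity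
  refine ⟨(G e).toReal / (2 * Real.pi) ^ θ,
    div_pos (ENNReal.toReal_pos hpos.ne' hfin.ne) hp, fun ξ => ?_⟩
  rw [Real.mul_rpow (by positivity) (norm_nonneg _), ← mul_assoc, div_mul_cancel₀ _ hp.ne']
  rcases eq_or_ne ξ 0 with rfl | hξ
  · simp [Real.zero_rpow hν.ne', Real.zero_rpow hθ.ne']
  have hr : 0 < ‖ξ‖ := norm_pos_iff.2 hξ
  change G ξ = _
  have h1 : G ξ = G (‖ξ‖ • e) := by
    refine lintegral_cosWeight_rotate ?_
    rw [norm_smul, he, norm_norm, mul_one]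
  have h2 := lintegral_comp_smul_euc (fun h : Euc m => ENNReal.ofReal
      ((2 - 2 * Real.cos (2 * Real.pi * inner ℝ e h)) ^ ν * ‖h‖ ^ (-θ - m))) hr.ne'
  have h3 : G (‖ξ‖ • e) = ENNReal.ofReal (‖ξ‖ ^ (θ + m)) * (ENNReal.ofReal (‖ξ‖ ^ (-(m:ℝ))) * G e) := by
    rw [abs_of_pos hr] at h2
    rw [hG]
    simp only
    rw [← h2, ← lintegral_const_mul' _ _ ENNReal.ofReal_ne_top]
    refine lintegral_congr fun h => ?_
    rw [← ENNReal.ofReal_mul (by positivity), real_inner_smul_left, inner_smul_right, norm_smul,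
      norm_norm, Real.mul_rpow hr.le (norm_nonneg h)]
    congr 1
    have : ‖ξ‖ ^ (θ + m) * ‖ξ‖ ^ (-θ - m) = 1 := by rw [← Real.rpow_add hr]; ring_nf; simp
    linear_combination -(2 - 2 * Real.cos (2 * Real.pi * (‖ξ‖ * inner ℝ e h))) ^ ν *
      ‖h‖ ^ (-θ - m) * this
  rw [h1, h3, ← mul_assoc, ← ENNReal.ofReal_mul (by positivity), ← Real.rpow_add hr,
    mul_comm (G e).toReal, ENNReal.ofReal_mul (by positivity), ENNReal.ofReal_toReal hfin.ne]
  congr 3; ring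

lemma fourierInv_eq_exp {m : ℕ} (g : Euc m → ℂ) (x : Euc m) :
    𝓕⁻ g x = ∫ ξ, Complex.exp ((2 * Real.pi * inner ℝ ξ x : ℝ) * Complex.I) * g ξ := by
  rw [Real.fourierInv_eq']
  simp

/-- If the trigonometric polynomial `∑ cᵢ e^{iλᵢu}` vanishes at `u = 0` to an order higher than `θ`
and its integral against `‖h‖^{-θ-m}` is `κ (2π‖ξ‖)^θ`, then the multiplier `(2π‖ξ‖)^θ` is
given by the corresponding integrated difference. -/
lemma integrated_difference_eq {m : ℕ} [NeZero m] {ι : Type*} (s : Finset ι) (c l : ι → ℝ)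
    {ν θ κ : ℝ} (hν : 0 < ν) (hθ : 0 < θ) (hθν : θ < 2 * ν)
    (hP : ∀ u : ℝ, ‖∑ i ∈ s, (c i : ℂ) * Complex.exp ((l i * u : ℝ) * Complex.I)‖ ≤
      (2 - 2 * Real.cos u) ^ ν)
    (hκ : ∀ ξ : Euc m, ∫ h : Euc m, ((‖h‖ ^ (-θ - m) : ℝ) : ℂ) * ∑ i ∈ s, (c i : ℂ) *
      Complex.exp ((l i * (2 * Real.pi * inner ℝ ξ h) : ℝ) * Complex.I) =
        ((κ * (2 * Real.pi * ‖ξ‖) ^ θ : ℝ) : ℂ))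
    {g : Euc m → ℂ} (hg : Integrable g) (hgθ : Integrable fun ξ => ‖ξ‖ ^ θ * ‖g ξ‖) (x : Euc m) :
    Integrable (fun h : Euc m => ((‖h‖ ^ (-θ - m) : ℝ) : ℂ) *
      ∑ i ∈ s, (c i : ℂ) * 𝓕⁻ g (x + l i • h)) ∧
    ∫ h : Euc m, ((‖h‖ ^ (-θ - m) : ℝ) : ℂ) * ∑ i ∈ s, (c i : ℂ) * 𝓕⁻ g (x + l i • h) =
      κ * 𝓕⁻ (fun ξ => (((2 * Real.pi * ‖ξ‖) ^ θ : ℝ) : ℂ) * g ξ) x := by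
  obtain ⟨c₀, hc₀, hG⟩ := exists_lintegral_cosWeight_eq (m := m) hν hθ hθν
  set P : ℝ → ℂ := fun u => ∑ i ∈ s, (c i : ℂ) * Complex.exp ((l i * u : ℝ) * Complex.I) with hPdef
  have hPc : Continuous P := by fun_prop
  set E : Euc m → ℂ := fun ξ => Complex.exp ((2 * Real.pi * inner ℝ ξ x : ℝ) * Complex.I) with hE
  have hEc : Continuous E := by fun_prop
  have hEn : ∀ ξ, ‖E ξ‖ = 1 := fun ξ => Complex.norm_exp_ofReal_mul_I _
  set F : Euc m × Euc m → ℂ := fun q =>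
    ((‖q.2‖ ^ (-θ - m) : ℝ) : ℂ) * P (2 * Real.pi * inner ℝ q.1 q.2) * (E q.1 * g q.1) with hF
  have hFm : AEStronglyMeasurable F ((volume : Measure (Euc m)).prod volume) := by
    refine AEStronglyMeasurable.mul ?_ ?_
    · refine AEStronglyMeasurable.mul ?_ ?_
      · exact Measurable.aestronglyMeasurable (by fun_prop)
      · exact (hPc.comp (by fun_prop)).aestronglyMeasurable
    · exact (hEc.aestronglyMeasurable.mul hg.aestronglyMeasurable).comp_fst
  have hw : ∀ ξ, Integrable fun h : Euc m => ((2 - 2 * Real.cos (2 * Real.pi * inner ℝ ξ h)) ^ ν *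
      ‖h‖ ^ (-θ - m) : ℝ) := by
    intro ξ
    refine ⟨Measurable.aestronglyMeasurable (by fun_prop), ?_⟩
    rw [hasFiniteIntegral_iff_ofReal (Filter.Eventually.of_forall fun h =>
      mul_nonneg (Real.rpow_nonneg (two_sub_two_cos_nonneg _) _) (by positivity)), hG ξ]
    exact ENNReal.ofReal_lt_top
  have hwI : ∀ ξ, ∫ h : Euc m, ((2 - 2 * Real.cos (2 * Real.pi * inner ℝ ξ h)) ^ ν *
      ‖h‖ ^ (-θ - m) : ℝ) = c₀ * (2 * Real.pi * ‖ξ‖) ^ θ := by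
    intro ξ
    rw [integral_eq_lintegral_of_nonneg_ae (Filter.Eventually.of_forall fun h =>
      mul_nonneg (Real.rpow_nonneg (two_sub_two_cos_nonneg _) _) (by positivity))
      (hw ξ).aestronglyMeasurable, hG ξ, ENNReal.toReal_ofReal (by positivity)]
  have hFle : ∀ ξ h, ‖F (ξ, h)‖ ≤ (2 - 2 * Real.cos (2 * Real.pi * inner ℝ ξ h)) ^ ν *
      ‖h‖ ^ (-θ - m) * ‖g ξ‖ := by
    intro ξ h
    rw [hF, norm_mul, norm_mul, norm_mul, hEn, one_mul, Complex.norm_real, Real.norm_eq_abs,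
      abs_of_nonneg (by positivity), mul_comm (‖h‖ ^ _)]
    exact mul_le_mul_of_nonneg_right (mul_le_mul_of_nonneg_right (hP _) (by positivity))
      (norm_nonneg _)
  have hF1 : ∀ ξ, Integrable fun h => F (ξ, h) := by
    intro ξ
    refine ((hw ξ).mul_const ‖g ξ‖).mono' ?_ (Filter.Eventually.of_forall (hFle ξ))
    refine AEStronglyMeasurable.mul (AEStronglyMeasurable.mul
      (Measurable.aestronglyMeasurable (by fun_prop))
      (hPc.comp (by fun_prop)).aestronglyMeasurable) (aestronglyMeasurable_const (b := E ξ * g ξ))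
  -- Fubini applies because the integral in `h` at frequency `ξ` is at most `c₀ (2π‖ξ‖)^θ ‖g ξ‖`,
  -- integrable by `hgθ`.
  have hFint : Integrable F ((volume : Measure (Euc m)).prod volume) := by
    rw [integrable_prod_iff hFm]
    refine ⟨Filter.Eventually.of_forall hF1, ?_⟩
    refine (hgθ.const_mul (c₀ * (2 * Real.pi) ^ θ)).mono' hFm.norm.integral_prod_right'
      (Filter.Eventually.of_forall fun ξ => ?_)
    rw [Real.norm_eq_abs, abs_of_nonneg (integral_nonneg fun _ => norm_nonneg _)]
    refine (integral_mono (hF1 ξ).norm ((hw ξ).mul_const ‖g ξ‖) (hFle ξ)).trans (le_of_eq ?_)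
    rw [integral_mul_const, hwI, Real.mul_rpow (by positivity) (norm_nonneg _)]
    ring
  have hEg : ∀ v, Integrable fun ξ : Euc m =>
      Complex.exp ((2 * Real.pi * inner ℝ ξ v : ℝ) * Complex.I) * g ξ := by
    intro v
    refine hg.norm.mono' (AEStronglyMeasurable.mul
      (Continuous.aestronglyMeasurable (by fun_prop)) hg.aestronglyMeasurable)
      (Filter.Eventually.of_forall fun ξ => ?_)
    rw [norm_mul, Complex.norm_exp_ofReal_mul_I, one_mul]
  have hleft : ∀ h : Euc m, ((‖h‖ ^ (-θ - m) : ℝ) : ℂ) * ∑ i ∈ s, (c i : ℂ) * 𝓕⁻ g (x + l i • h) =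
      ∫ ξ, F (ξ, h) := by
    intro h
    have : ∀ ξ, F (ξ, h) = ((‖h‖ ^ (-θ - m) : ℝ) : ℂ) * ∑ i ∈ s, (c i : ℂ) *
        (Complex.exp ((2 * Real.pi * inner ℝ ξ (x + l i • h) : ℝ) * Complex.I) * g ξ) := by
      intro ξ
      simp only [hF, hPdef]
      rw [mul_assoc, Finset.sum_mul]
      congr 1
      refine Finset.sum_congr rfl fun i _ => ?_
      rw [mul_assoc, hE]
      simp only
      rw [← mul_assoc (Complex.exp _) _ (g ξ), ← Complex.exp_add, inner_add_right,
        inner_smul_right]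
      congr 3; push_cast; ring
    simp_rw [this]
    rw [integral_const_mul, integral_finsetSum _ fun i _ => (hEg _).const_mul _]
    congr 1
    refine Finset.sum_congr rfl fun i _ => ?_
    rw [integral_const_mul, fourierInv_eq_exp]
  simp_rw [hleft]
  refine ⟨hFint.integral_prod_right, ?_⟩
  rw [← integral_integral_swap (f := fun ξ h => F (ξ, h)) hFint, fourierInv_eq_exp,
    ← integral_const_mul]
  refine integral_congr_ae (Filter.Eventually.of_forall fun ξ => ?_)
  simp only [hF]
  rw [integral_mul_const]
  have := hκ ξ
  simp only [hPdef]
  rw [this]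
  simp only [hE]
  push_cast; ring

lemma exists_symmDiff_representation {m : ℕ} [NeZero m] {N : ℕ} {θ : ℝ} (hN : 0 < N) (hθ : 0 < θ)
    (hθN : θ < 2 * N) :
    ∃ κ : ℝ, ∀ g : Euc m → ℂ, Integrable g → (Integrable fun ξ => ‖ξ‖ ^ θ * ‖g ξ‖) → ∀ x,
    Integrable (fun h : Euc m => ((‖h‖ ^ (-θ - m) : ℝ) : ℂ) *
      ∑ i ∈ Finset.range (2 * N + 1), (symmDiffCoeff N i : ℂ) * 𝓕⁻ g (x + (i - N : ℝ) • h)) ∧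
    𝓕⁻ (fun ξ => (((2 * Real.pi * ‖ξ‖) ^ θ : ℝ) : ℂ) * g ξ) x =
      κ * ∫ h : Euc m, ((‖h‖ ^ (-θ - m) : ℝ) : ℂ) *
        ∑ i ∈ Finset.range (2 * N + 1), (symmDiffCoeff N i : ℂ) * 𝓕⁻ g (x + (i - N : ℝ) • h) := by
  have hN' : (0 : ℝ) < N := Nat.cast_pos.2 hN
  obtain ⟨c₀, hc₀, hG⟩ := exists_lintegral_cosWeight_eq (m := m) hN' hθ hθN
  have hc : (((-1) ^ N * c₀ : ℝ) : ℂ) ≠ 0 := by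
    rw [Complex.ofReal_ne_zero]; positivity
  refine ⟨((-1) ^ N * c₀)⁻¹, fun g hg hgθ x => ?_⟩
  have := integrated_difference_eq (m := m) (Finset.range (2 * N + 1)) (symmDiffCoeff N)
    (fun i => (i - N : ℝ)) (κ := (-1) ^ N * c₀) hN' hθ hθN (fun u => by
      rw [sum_symmDiffCoeff_mul_exp, Complex.norm_real, Real.norm_eq_abs, abs_mul, abs_pow,
        abs_neg, abs_one, one_pow, one_mul, Real.rpow_natCast,
        abs_of_nonneg (pow_nonneg (two_sub_two_cos_nonneg u) N)]) (fun ξ => by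
      simp_rw [sum_symmDiffCoeff_mul_exp, ← Complex.ofReal_mul]
      rw [integral_complex_ofReal]
      congr 1
      simp_rw [mul_left_comm (_ : ℝ) ((-1) ^ N : ℝ)]
      rw [integral_const_mul, mul_assoc]
      congr 1
      rw [integral_eq_lintegral_of_nonneg_ae (Filter.Eventually.of_forall fun h => mul_nonneg
        (by positivity) (pow_nonneg (two_sub_two_cos_nonneg _) _))
        (Measurable.aestronglyMeasurable (by fun_prop))]
      have := hG ξ
      simp_rw [Real.rpow_natCast, mul_comm (_ ^ N : ℝ)] at this
      rw [this, ENNReal.toReal_ofReal (by positivity)]) hg hgθ x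
  refine ⟨this.1, ?_⟩
  rw [this.2, ← mul_assoc, ← Complex.ofReal_mul, inv_mul_cancel₀ (by positivity),
    Complex.ofReal_one, one_mul]

/-- A plain first difference corresponds to `|1 - e^(iu)| = (2 - 2 cos u)^(1/2)`, that is `ν = 1/2`,
which is why `θ < 1` is required. It serves the commutators, where the product structure of a single
increment matters. -/
lemma exists_difference_representation {m : ℕ} [NeZero m] {θ : ℝ} (hθ : 0 < θ) (hθ1 : θ < 1) :
    ∃ κ : ℝ, ∀ g : Euc m → ℂ, Integrable g → (Integrable fun ξ => ‖ξ‖ ^ θ * ‖g ξ‖) → ∀ x,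
    Integrable (fun h : Euc m => ((‖h‖ ^ (-θ - m) : ℝ) : ℂ) * (𝓕⁻ g x - 𝓕⁻ g (x + h))) ∧
    𝓕⁻ (fun ξ => (((2 * Real.pi * ‖ξ‖) ^ θ : ℝ) : ℂ) * g ξ) x =
      κ * ∫ h : Euc m, ((‖h‖ ^ (-θ - m) : ℝ) : ℂ) * (𝓕⁻ g x - 𝓕⁻ g (x + h)) := by
  obtain ⟨c₀, hc₀, hG⟩ := exists_lintegral_cosWeight_eq (m := m) one_pos hθ (by linarith)
  obtain ⟨c₁, hc₁, hG₁⟩ := exists_lintegral_cosWeight_eq (m := m) (ν := 1 / 2) (by norm_num) hθ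
    (by linarith)
  have hsum : ∀ z : ℕ → ℂ, ∑ i ∈ Finset.range 2, (((-1 : ℝ) ^ i : ℝ) : ℂ) * z i = z 0 - z 1 := by
    intro z; simp [Finset.sum_range_succ]; ring
  refine ⟨(c₀ / 2)⁻¹, fun g hg hgθ x => ?_⟩
  have := integrated_difference_eq (m := m) (Finset.range 2) (fun i => (-1) ^ i)
    (fun i => (i : ℝ)) (ν := 1 / 2) (κ := c₀ / 2) (by norm_num) hθ (by linarith) (fun u => by
      rw [hsum, ← norm_one_sub_exp_eq]; simp) (fun ξ => by
      simp_rw [hsum]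
      simp only [Nat.cast_zero, zero_mul, Complex.ofReal_zero, Complex.exp_zero, Nat.cast_one,
        one_mul]
      set K : Euc m → ℂ := fun h => ((‖h‖ ^ (-θ - m) : ℝ) : ℂ) *
        (1 - Complex.exp ((2 * Real.pi * inner ℝ ξ h : ℝ) * Complex.I)) with hK
      have hKi : Integrable K := by
        refine ⟨Measurable.aestronglyMeasurable (by fun_prop), ?_⟩
        have : ∀ h, ‖K h‖ = (2 - 2 * Real.cos (2 * Real.pi * inner ℝ ξ h)) ^ (1 / 2 : ℝ) *
            ‖h‖ ^ (-θ - m) := by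
          intro h
          rw [hK, norm_mul, norm_one_sub_exp_eq, Complex.norm_real, Real.norm_eq_abs,
            abs_of_nonneg (by positivity), mul_comm]
        simp_rw [hasFiniteIntegral_iff_norm, this]
        rw [hG₁ ξ]
        exact ENNReal.ofReal_lt_top
      have h1 : ∫ h, K h = ∫ h, K (-h) := (integral_neg_eq_self K volume).symm
      -- Averaging over `h` and `-h` removes the odd imaginary part and leaves the cosine weight
      -- with `ν = 1`; this explains the constant `c₀ / 2`.
      have h2 : ∫ h, K h = (1 / 2) * ∫ h, (K h + K (-h)) := by
        rw [integral_add hKi hKi.comp_neg, ← h1]; ring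
      have h3 : ∀ h, K h + K (-h) = (((2 - 2 * Real.cos (2 * Real.pi * inner ℝ ξ h)) ^ (1 : ℝ) *
            ‖h‖ ^ (-θ - m) : ℝ) : ℂ) := by
        intro h
        simp only [hK]
        rw [norm_neg, inner_neg_right, Real.rpow_one, mul_neg]
        generalize 2 * Real.pi * inner ℝ ξ h = u
        rw [Complex.ofReal_mul (2 - 2 * Real.cos u), Complex.ofReal_sub,
          Complex.ofReal_mul 2, Complex.ofReal_cos, Complex.ofReal_ofNat, Complex.two_cos]
        push_cast; ring_nf
      rw [h2]
      simp_rw [h3]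
      rw [integral_complex_ofReal, integral_eq_lintegral_of_nonneg_ae
        (Filter.Eventually.of_forall fun h => mul_nonneg
        (Real.rpow_nonneg (two_sub_two_cos_nonneg _) _) (by positivity))
        (Measurable.aestronglyMeasurable (by fun_prop)), hG ξ,
        ENNReal.toReal_ofReal (by positivity)]
      push_cast; ring) hg hgθ x
  simp_rw [hsum] at this
  simp only [Nat.cast_zero, zero_smul, add_zero, Nat.cast_one, one_smul] at this
  refine ⟨this.1, ?_⟩
  rw [this.2, ← mul_assoc, ← Complex.ofReal_mul, inv_mul_cancel₀ (by positivity),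
    Complex.ofReal_one, one_mul]

/-! ### Fractional Laplacians of Schwartz functions: continuity, integrability, composition -/

lemma norm_fourierInv_le {m : ℕ} (g : Euc m → ℂ) (x : Euc m) : ‖𝓕⁻ g x‖ ≤ ∫ ξ, ‖g ξ‖ := by
  rw [fourierInv_eq_exp]
  refine (norm_integral_le_integral_norm _).trans (le_of_eq ?_)
  simp_rw [norm_mul, Complex.norm_exp_ofReal_mul_I, one_mul]

lemma continuous_fourier {m : ℕ} {g : Euc m → ℂ} (hg : Integrable g) : Continuous (𝓕 g) :=
  VectorFourier.fourierIntegral_continuous Real.continuous_fourierChar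
    (by change Continuous fun p : Euc m × Euc m => inner ℝ p.1 p.2; fun_prop) hg

lemma continuous_fourierInv {m : ℕ} {g : Euc m → ℂ} (hg : Integrable g) : Continuous (𝓕⁻ g) := by
  have : 𝓕⁻ g = fun x => 𝓕 g (-x) := funext fun x => Real.fourierInv_eq_fourier_neg g x
  rw [this]
  exact (continuous_fourier hg).comp continuous_neg

lemma rpow_le_one_add_pow_ceil {r p : ℝ} (hr : 0 ≤ r) (hp : 0 ≤ p) : r ^ p ≤ 1 + r ^ ⌈p⌉₊ := by
  rcases le_total r 1 with h | h
  · have := Real.rpow_le_one hr h hp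
    have : 0 ≤ r ^ ⌈p⌉₊ := by positivity
    linarith
  · have h1 : r ^ p ≤ r ^ (⌈p⌉₊ : ℝ) := Real.rpow_le_rpow_of_exponent_le h (Nat.le_ceil p)
    rw [Real.rpow_natCast] at h1
    linarith

lemma integrable_norm_rpow_mul_schwartz {m : ℕ} {p : ℝ} (hp : 0 ≤ p) (g : 𝓢(Euc m, ℂ)) :
    Integrable fun ξ => ‖ξ‖ ^ p * ‖g ξ‖ := by
  have h0 := g.integrable_pow_mul volume 0
  have h1 := g.integrable_pow_mul volume ⌈p⌉₊
  refine (h0.add h1).mono' ?_ (Filter.Eventually.of_forall fun ξ => ?_)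
  · exact (Measurable.aestronglyMeasurable (by fun_prop)).mul
      g.continuous.norm.aestronglyMeasurable
  · rw [Real.norm_eq_abs, abs_of_nonneg (by positivity)]
    have := mul_le_mul_of_nonneg_right (rpow_le_one_add_pow_ceil (norm_nonneg ξ) hp)
      (norm_nonneg (g ξ))
    simp only [Pi.add_apply, pow_zero]
    linarith

lemma integrable_symbol_mul {m : ℕ} {p : ℝ} {g : Euc m → ℂ} (hg : AEStronglyMeasurable g)
    (hp : Integrable fun ξ => ‖ξ‖ ^ p * ‖g ξ‖) :
    Integrable fun ξ : Euc m => (((2 * Real.pi * ‖ξ‖) ^ p : ℝ) : ℂ) * g ξ := by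
  refine (hp.const_mul ((2 * Real.pi) ^ p)).mono' ?_ (Filter.Eventually.of_forall fun ξ => ?_)
  · exact (Measurable.aestronglyMeasurable (by fun_prop)).mul hg
  · rw [norm_mul, Complex.norm_real, Real.norm_eq_abs, abs_of_nonneg (by positivity),
      Real.mul_rpow (by positivity) (norm_nonneg _), mul_assoc]

lemma integrable_norm_rpow_mul_symbol {m : ℕ} {p q : ℝ} (hp : 0 ≤ p) (hq : 0 ≤ q)
    (g : 𝓢(Euc m, ℂ)) :
    Integrable fun ξ : Euc m => ‖ξ‖ ^ q * ‖(((2 * Real.pi * ‖ξ‖) ^ p : ℝ) : ℂ) * g ξ‖ := by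
  refine ((integrable_norm_rpow_mul_schwartz (add_nonneg hq hp) g).const_mul
    ((2 * Real.pi) ^ p)).congr (Filter.Eventually.of_forall fun ξ => ?_)
  simp only
  rw [norm_mul, Complex.norm_real, Real.norm_eq_abs, abs_of_nonneg (by positivity),
    Real.mul_rpow (by positivity) (norm_nonneg _), Real.rpow_add_of_nonneg (norm_nonneg _) hq hp]
  ring

lemma integrable_symbol_mul_schwartz {m : ℕ} {p : ℝ} (hp : 0 ≤ p) (g : 𝓢(Euc m, ℂ)) :
    Integrable fun ξ : Euc m => (((2 * Real.pi * ‖ξ‖) ^ p : ℝ) : ℂ) * g ξ :=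
  integrable_symbol_mul g.continuous.aestronglyMeasurable (integrable_norm_rpow_mul_schwartz hp g)

lemma fracLaplacian_schwartz {m : ℕ} (p : ℝ) (a : 𝓢(Euc m, ℂ)) :
    fracLaplacian p a = 𝓕⁻ (fun ξ : Euc m => (((2 * Real.pi * ‖ξ‖) ^ p : ℝ) : ℂ) * (𝓕 a : 𝓢(Euc m, ℂ)) ξ) := by
  rw [fracLaplacian, SchwartzMap.fourier_coe]

lemma continuous_fracLaplacian {m : ℕ} {p : ℝ} (hp : 0 ≤ p) (a : 𝓢(Euc m, ℂ)) :
    Continuous (fracLaplacian p a) := by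
  rw [fracLaplacian_schwartz]
  exact continuous_fourierInv (integrable_symbol_mul_schwartz hp _)

lemma exists_norm_fracLaplacian_le {m : ℕ} (p : ℝ) (a : 𝓢(Euc m, ℂ)) :
    ∃ C, ∀ x, ‖fracLaplacian p a x‖ ≤ C := by
  rw [fracLaplacian_schwartz]
  exact ⟨_, norm_fourierInv_le _⟩

/-- The fundamental theorem of calculus along the segment, then Tonelli and translation invariance.
-/
lemma lintegral_enorm_fwdDiff_le {m : ℕ} {f : Euc m → ℂ} (hf : ContDiff ℝ 1 f) (h : Euc m) :
    ∫⁻ x, ‖fwdDiff h f x‖ₑ ≤ ∫⁻ x, ‖fderiv ℝ f x h‖ₑ := by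
  have hc : Continuous fun x => fderiv ℝ f x h :=
    (hf.continuous_fderiv one_ne_zero).clm_apply continuous_const
  have h1 : ∀ x, ‖fwdDiff h f x‖ₑ ≤ ∫⁻ t in Ioc (0 : ℝ) 1, ‖fderiv ℝ f (x + t • h) h‖ₑ := by
    intro x
    have hd : ∀ t : ℝ, HasDerivAt (fun t : ℝ => f (x + t • h)) (fderiv ℝ f (x + t • h) h) t := by
      intro t
      have e1 : HasDerivAt (fun t : ℝ => x + t • h) h t := by
        simpa using ((hasDerivAt_id t).smul_const h).const_add x
      exact ((hf.differentiable one_ne_zero _).hasFDerivAt).comp_hasDerivAt t e1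
    have hi := intervalIntegral.integral_eq_sub_of_hasDerivAt (a := 0) (b := 1)
      (fun t _ => hd t) ((hc.comp (by fun_prop : Continuous fun t : ℝ => x + t • h)).intervalIntegrable _ _)
    have : fwdDiff h f x = ∫ t in (0:ℝ)..1, fderiv ℝ f (x + t • h) h := by
      rw [hi]; simp [fwdDiff]
    rw [this, intervalIntegral.integral_of_le zero_le_one]
    exact enorm_integral_le_lintegral_enorm _
  calc ∫⁻ x, ‖fwdDiff h f x‖ₑ
      ≤ ∫⁻ x, ∫⁻ t in Ioc (0 : ℝ) 1, ‖fderiv ℝ f (x + t • h) h‖ₑ := lintegral_mono h1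
    _ = ∫⁻ t in Ioc (0 : ℝ) 1, ∫⁻ x, ‖fderiv ℝ f (x + t • h) h‖ₑ := by
        refine lintegral_lintegral_swap ?_
        refine Measurable.aemeasurable ?_
        exact ((hc.comp (by fun_prop :
          Continuous fun q : Euc m × ℝ => q.1 + q.2 • h)).enorm).measurable
    _ = ∫⁻ t in Ioc (0 : ℝ) 1, ∫⁻ x, ‖fderiv ℝ f x h‖ₑ := by
        refine lintegral_congr fun t => ?_
        exact lintegral_add_right_eq_self (fun x => ‖fderiv ℝ f x h‖ₑ) (t • h)
    _ = _ := by simp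

lemma lintegral_enorm_fwdDiff_iterate_le {m : ℕ} (h : Euc m) (n : ℕ) {f : Euc m → ℂ}
    (hf : ContDiff ℝ (⊤ : ℕ∞) f) :
    ∫⁻ x, ‖(fwdDiff h)^[n] f x‖ₑ ≤ ∫⁻ x, ‖iteratedFDeriv ℝ n f x (fun _ => h)‖ₑ := by
  induction n generalizing f with
  | zero => simp
  | succ n ih =>
    have hs : ContDiff ℝ (⊤ : ℕ∞) (fun x => f (x + h)) := hf.comp (contDiff_id.add contDiff_const)
    have hfw : fwdDiff h f = (fun x => f (x + h)) - f := rfl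
    set F : Euc m → ℂ := fun x => iteratedFDeriv ℝ n f x (fun _ => h) with hF
    have hFc : ContDiff ℝ 1 F := by
      have := hf.iteratedFDeriv_right (i := n) (m := 1) (by exact_mod_cast le_top)
      exact (ContinuousMultilinearMap.apply ℝ (fun _ : Fin n => Euc m) ℂ
        (fun _ => h)).contDiff.comp this
    rw [Function.iterate_succ_apply]
    refine (ih (f := fwdDiff h f) (hfw ▸ hs.sub hf)).trans ?_
    have e1 : ∀ x, iteratedFDeriv ℝ n (fwdDiff h f) x (fun _ => h) = fwdDiff h F x := by
      intro x
      rw [hfw, iteratedFDeriv_sub_apply (hs.contDiffAt.of_le (by exact_mod_cast le_top))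
        (hf.contDiffAt.of_le (by exact_mod_cast le_top)), iteratedFDeriv_comp_add_right]
      rfl
    simp_rw [e1]
    refine (lintegral_enorm_fwdDiff_le hFc h).trans (le_of_eq ?_)
    refine lintegral_congr fun x => ?_
    rw [DifferentiableAt.iteratedFDeriv_succ_apply_left'
      ((hf.differentiable_iteratedFDeriv (by exact_mod_cast ENat.natCast_lt_top n)) x)]
    rfl

lemma sum_symmDiffCoeff_eq_fwdDiff_shift {m : ℕ} (N : ℕ) (f : Euc m → ℂ) (x h : Euc m) :
    ∑ i ∈ Finset.range (2 * N + 1), (symmDiffCoeff N i : ℂ) * f (x + (i - N : ℝ) • h) =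
      (fwdDiff h)^[2 * N] f (x + (-(N : ℝ)) • h) := by
  rw [fwdDiff_iter_eq_sum_shift]
  refine Finset.sum_congr rfl fun i hi => ?_
  have hi' : i ≤ 2 * N := Nat.lt_succ_iff.1 (Finset.mem_range.1 hi)
  have h1 : (-1 : ℤ) ^ (2 * N - i) = (-1) ^ i := by
    rcases Nat.even_or_odd i with hi2 | hi2
    · rw [hi2.neg_one_pow, ((Nat.even_sub hi').2 (by simp [hi2])).neg_one_pow]
    · rw [hi2.neg_one_pow, (Nat.Even.sub_odd hi' (even_two_mul N) hi2).neg_one_pow]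
  have h2 : x + (i - N : ℝ) • h = x + (-(N : ℝ)) • h + i • h := by
    rw [sub_smul, neg_smul, ← Nat.cast_smul_eq_nsmul ℝ i h]; abel
  rw [h1, h2, symmDiffCoeff, zsmul_eq_mul]
  push_cast; ring

lemma exists_lintegral_symmDiff_le {m : ℕ} (N : ℕ) (a : 𝓢(Euc m, ℂ)) :
    ∃ K : ℝ, 0 ≤ K ∧ ∀ h : Euc m, ∫⁻ x, ‖∑ i ∈ Finset.range (2 * N + 1), (symmDiffCoeff N i : ℂ) *
      a (x + (i - N : ℝ) • h)‖ₑ ≤ ENNReal.ofReal (K * ‖h‖ ^ (2 * N)) := by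
  have hi := a.integrable_pow_mul_iteratedFDeriv volume 0 (2 * N)
  simp only [pow_zero, one_mul] at hi
  refine ⟨∫ x, ‖iteratedFDeriv ℝ (2 * N) a x‖, integral_nonneg fun _ => norm_nonneg _,
    fun h => ?_⟩
  simp_rw [sum_symmDiffCoeff_eq_fwdDiff_shift]
  rw [lintegral_add_right_eq_self (fun x => ‖(fwdDiff h)^[2 * N] (⇑a) x‖ₑ)]
  refine (lintegral_enorm_fwdDiff_iterate_le h (2 * N) (a.smooth ⊤)).trans ?_
  rw [mul_comm (∫ _, _), ENNReal.ofReal_mul (by positivity),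
    ofReal_integral_eq_lintegral_ofReal hi (Filter.Eventually.of_forall fun _ => norm_nonneg _),
    ← lintegral_const_mul' _ _ ENNReal.ofReal_ne_top]
  refine lintegral_mono fun x => ?_
  rw [← ENNReal.ofReal_mul (by positivity), ← ofReal_norm]
  refine ENNReal.ofReal_le_ofReal ?_
  have := (iteratedFDeriv ℝ (2 * N) a x).le_opNorm (fun _ => h)
  rw [Finset.prod_const, Finset.card_univ, Fintype.card_fin] at this
  linarith

lemma exists_lintegral_symmDiff_le' {m : ℕ} (N : ℕ) (a : 𝓢(Euc m, ℂ)) :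
    ∃ K : ℝ, 0 ≤ K ∧ ∀ h : Euc m, ∫⁻ x, ‖∑ i ∈ Finset.range (2 * N + 1), (symmDiffCoeff N i : ℂ) *
      a (x + (i - N : ℝ) • h)‖ₑ ≤ ENNReal.ofReal K := by
  refine ⟨∑ i ∈ Finset.range (2 * N + 1), |symmDiffCoeff N i| * ∫ x, ‖a x‖, by positivity,
    fun h => ?_⟩
  calc ∫⁻ x, ‖∑ i ∈ Finset.range (2 * N + 1), (symmDiffCoeff N i : ℂ) * a (x + (i - N : ℝ) • h)‖ₑ
      ≤ ∫⁻ x, ∑ i ∈ Finset.range (2 * N + 1),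
          ENNReal.ofReal |symmDiffCoeff N i| * ‖a (x + (i - N : ℝ) • h)‖ₑ := by
        refine lintegral_mono fun x => ?_
        refine (enorm_sum_le _ _).trans (le_of_eq ?_)
        refine Finset.sum_congr rfl fun i _ => ?_
        rw [enorm_mul, ← ofReal_norm, Complex.norm_real, Real.norm_eq_abs]
    _ = ∑ i ∈ Finset.range (2 * N + 1), ENNReal.ofReal (|symmDiffCoeff N i| * ∫ x, ‖a x‖) := by
        rw [lintegral_finsetSum]
        · refine Finset.sum_congr rfl fun i _ => ?_
          rw [lintegral_const_mul' _ _ ENNReal.ofReal_ne_top,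
            lintegral_add_right_eq_self (fun x => ‖a x‖ₑ), ENNReal.ofReal_mul (abs_nonneg _),
            ofReal_integral_norm_eq_lintegral_enorm a.integrable]
        · intro i _
          exact ((a.continuous.comp (by fun_prop)).enorm.measurable).const_mul _
    _ = _ := (ENNReal.ofReal_sum_of_nonneg fun i _ => by positivity).symm

lemma fourierInv_fourier_schwartz {m : ℕ} (a : 𝓢(Euc m, ℂ)) : 𝓕⁻ (⇑(𝓕 a : 𝓢(Euc m, ℂ))) = a := by
  rw [← SchwartzMap.fourierInv_coe, FourierTransform.fourierInv_fourier_eq]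

/-- The symbol is not smooth at the origin in general, so the image need not be Schwartz and its
decay has to be proved. The difference representation does this: the `2N`-th difference has `L¹`
norm at most `K₁ ‖h‖^(2N)` and at most `K₂`, and `‖h‖^(-θ-m)` integrates the minimum of the two. -/
lemma integrable_fracLaplacian {m : ℕ} [NeZero m] {θ : ℝ} (hθ : 0 < θ) (a : 𝓢(Euc m, ℂ)) :
    Integrable (fracLaplacian θ a) := by
  obtain ⟨N, hN⟩ := exists_nat_gt θ
  have hN0 : 0 < N := by
    have : (0 : ℝ) < N := hθ.trans hN
    exact_mod_cast this
  have hθN : θ < 2 * N := by linarith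
  obtain ⟨κ, hκ⟩ := exists_symmDiff_representation (m := m) hN0 hθ hθN
  obtain ⟨K₁, hK₁, H₁⟩ := exists_lintegral_symmDiff_le N a
  obtain ⟨K₂, hK₂, H₂⟩ := exists_lintegral_symmDiff_le' N a
  obtain ⟨C₁, hC₁, B₁⟩ := exists_lintegral_ball_le (m := m) (p := 2 * N - θ) (by linarith)
  obtain ⟨C₂, hC₂, B₂⟩ := exists_lintegral_compl_ball_le (m := m) (p := θ) hθ
  refine ⟨(continuous_fracLaplacian hθ.le a).aestronglyMeasurable, ?_⟩
  set S : Euc m → Euc m → ℂ := fun x h => ∑ i ∈ Finset.range (2 * N + 1),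
    (symmDiffCoeff N i : ℂ) * a (x + (i - N : ℝ) • h) with hS
  have hSc : Continuous fun q : Euc m × Euc m => S q.1 q.2 := by
    refine continuous_finsetSum _ fun i _ => continuous_const.mul (a.continuous.comp (by fun_prop))
  have hrep : ∀ x, ‖fracLaplacian θ a x‖ₑ ≤
      ‖(κ : ℂ)‖ₑ * ∫⁻ h, ENNReal.ofReal (‖h‖ ^ (-θ - m)) * ‖S x h‖ₑ := by
    intro x
    have := (hκ (𝓕 a : 𝓢(Euc m, ℂ)) (𝓕 a : 𝓢(Euc m, ℂ)).integrable (integrable_norm_rpow_mul_schwartz hθ.le (𝓕 a : 𝓢(Euc m, ℂ))) x).2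
    rw [fracLaplacian_schwartz, this, enorm_mul, fourierInv_fourier_schwartz]
    refine mul_le_mul_right ?_ _
    refine (enorm_integral_le_lintegral_enorm _).trans (le_of_eq (lintegral_congr fun h => ?_))
    rw [enorm_mul, ← ofReal_norm, Complex.norm_real, Real.norm_eq_abs,
      abs_of_nonneg (by positivity)]
  have hswap : ∫⁻ x, ∫⁻ h, ENNReal.ofReal (‖h‖ ^ (-θ - m)) * ‖S x h‖ₑ =
      ∫⁻ h : Euc m, ENNReal.ofReal (‖h‖ ^ (-θ - m)) * ∫⁻ x, ‖S x h‖ₑ := by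
    rw [lintegral_lintegral_swap]
    · exact lintegral_congr fun h => lintegral_const_mul' _ _ ENNReal.ofReal_ne_top
    · refine Measurable.aemeasurable (Measurable.mul ?_ hSc.enorm.measurable)
      fun_prop
  have nt := nontrivial_euc m
  have b1 : ∫⁻ h in {h : Euc m | ‖h - 0‖ < 1},
      ENNReal.ofReal (‖h‖ ^ (-θ - m)) * ∫⁻ x, ‖S x h‖ₑ ≤
        ENNReal.ofReal (K₁ * (C₁ * 1 ^ (2 * N - θ))) := by
    refine le_trans (lintegral_mono_ae ?_) (setLIntegral_ofReal_le
      (measurableSet_lt (by fun_prop) (by fun_prop)) hK₁ (fun h _ => le_rfl) (B₁ 0 1 one_pos))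
    filter_upwards [ae_restrict_of_ae (Measure.ae_ne volume (0 : Euc m))] with h hh
    have hh' : 0 < ‖h‖ := norm_pos_iff.2 hh
    refine (mul_le_mul_right (H₁ h) _).trans (le_of_eq ?_)
    rw [← ENNReal.ofReal_mul (by positivity), sub_zero, show (2 * N - θ - m : ℝ) =
      ((2 * N : ℕ) : ℝ) + (-θ - m) by push_cast; ring, Real.rpow_add hh', Real.rpow_natCast]
    congr 1; ring
  have b2 : ∫⁻ h in {h : Euc m | 1 ≤ ‖h - 0‖},
      ENNReal.ofReal (‖h‖ ^ (-θ - m)) * ∫⁻ x, ‖S x h‖ₑ ≤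
        ENNReal.ofReal (K₂ * (C₂ * 1 ^ (-θ))) := by
    refine le_trans (lintegral_mono fun h => ?_) (setLIntegral_ofReal_le
      (measurableSet_le (by fun_prop) (by fun_prop)) hK₂ (fun h _ => le_rfl) (B₂ 0 1 one_pos))
    refine (mul_le_mul_right (H₂ h) _).trans (le_of_eq ?_)
    rw [← ENNReal.ofReal_mul (by positivity), sub_zero, mul_comm]
  have htot := setLIntegral_le_add (S := univ) (fun h _ => lt_or_ge ‖h - 0‖ 1)
    (by positivity) (by positivity) b1 b2
  rw [Measure.restrict_univ] at htot
  calc ∫⁻ x, ‖fracLaplacian θ a x‖ₑ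
      ≤ ∫⁻ x, ‖(κ : ℂ)‖ₑ * ∫⁻ h, ENNReal.ofReal (‖h‖ ^ (-θ - m)) * ‖S x h‖ₑ :=
        lintegral_mono hrep
    _ = ‖(κ : ℂ)‖ₑ * ∫⁻ x, ∫⁻ h, ENNReal.ofReal (‖h‖ ^ (-θ - m)) * ‖S x h‖ₑ :=
        lintegral_const_mul' _ _ enorm_ne_top
    _ < ⊤ := by
        rw [hswap]
        exact ENNReal.mul_lt_top enorm_lt_top (htot.trans_lt ENNReal.ofReal_lt_top)

lemma fourier_fracLaplacian {m : ℕ} [NeZero m] {θ : ℝ} (hθ : 0 < θ) (a : 𝓢(Euc m, ℂ)) :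
    𝓕 (fracLaplacian θ a) = fun ξ : Euc m => (((2 * Real.pi * ‖ξ‖) ^ θ : ℝ) : ℂ) * (𝓕 a : 𝓢(Euc m, ℂ)) ξ := by
  have hc : Continuous fun ξ : Euc m => (((2 * Real.pi * ‖ξ‖) ^ θ : ℝ) : ℂ) * (𝓕 a : 𝓢(Euc m, ℂ)) ξ := by
    refine Continuous.mul ?_ (𝓕 a : 𝓢(Euc m, ℂ)).continuous
    refine Complex.continuous_ofReal.comp (Continuous.rpow_const (by fun_prop) fun _ => Or.inr hθ.le)
  have hL1 := integrable_fracLaplacian hθ a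
  rw [fracLaplacian_schwartz] at hL1 ⊢
  refine hc.fourier_fourierInv_eq (integrable_symbol_mul_schwartz hθ.le _) ?_
  rw [show 𝓕 (fun ξ : Euc m => (((2 * Real.pi * ‖ξ‖) ^ θ : ℝ) : ℂ) * (𝓕 a : 𝓢(Euc m, ℂ)) ξ) = fun x =>
    𝓕⁻ (fun ξ : Euc m => (((2 * Real.pi * ‖ξ‖) ^ θ : ℝ) : ℂ) * (𝓕 a : 𝓢(Euc m, ℂ)) ξ) (-x) from
      funext fun x => by rw [Real.fourierInv_eq_fourier_neg, neg_neg]]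
  exact hL1.comp_neg

lemma fracLaplacian_fracLaplacian {m : ℕ} [NeZero m] {θ β : ℝ} (hθ : 0 < θ) (hβ : 0 ≤ β)
    (a : 𝓢(Euc m, ℂ)) :
    fracLaplacian β (fracLaplacian θ a) = fracLaplacian (θ + β) a := by
  rw [fracLaplacian, fourier_fracLaplacian hθ, fracLaplacian_schwartz]
  congr 1; ext ξ
  rw [Real.rpow_add_of_nonneg (by positivity) hθ.le hβ]
  push_cast; ring

/-! ### Riesz potentials invert fractional Laplacians -/

lemma integral_rpow_mul_exp_neg_pi_mul {q ρ : ℝ} (hq : 0 < q) (hρ : 0 < ρ) :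
    IntegrableOn (fun s : ℝ => s ^ (q - 1) * Real.exp (-(Real.pi * ρ ^ 2 * s))) (Ioi 0) ∧
    ∫ s in Ioi (0 : ℝ), s ^ (q - 1) * Real.exp (-(Real.pi * ρ ^ 2 * s)) =
      (1 / Real.pi) ^ q * Real.Gamma q * ρ ^ (-(2 * q)) := by
  have hr : 0 < Real.pi * ρ ^ 2 := by positivity
  have h1 := Real.integral_rpow_mul_exp_neg_mul_Ioi hq hr
  have h2 : (1 / (Real.pi * ρ ^ 2)) ^ q * Real.Gamma q =
      (1 / Real.pi) ^ q * Real.Gamma q * ρ ^ (-(2 * q)) := by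
    rw [one_div, mul_inv, Real.mul_rpow (by positivity) (by positivity), ← Real.rpow_natCast ρ,
      ← Real.rpow_neg hρ.le, ← Real.rpow_mul hρ.le, one_div]
    push_cast
    rw [show -2 * q = -(2 * q) by ring]
    ring
  refine ⟨Integrable.of_integral_ne_zero ?_, h1.trans h2⟩
  rw [h1]
  have := Real.Gamma_pos_of_pos hq
  positivity

lemma integral_rpow_mul_exp_neg_pi_div {q ρ : ℝ} (hq : 0 < q) (hρ : 0 < ρ) :
    IntegrableOn (fun s : ℝ => s ^ (-q - 1) * Real.exp (-(Real.pi * ρ ^ 2 / s))) (Ioi 0) ∧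
    ∫ s in Ioi (0 : ℝ), s ^ (-q - 1) * Real.exp (-(Real.pi * ρ ^ 2 / s)) =
      (1 / Real.pi) ^ q * Real.Gamma q * ρ ^ (-(2 * q)) := by
  obtain ⟨h1, h2⟩ := integral_rpow_mul_exp_neg_pi_mul hq hρ
  have h3 := integral_comp_rpow_Ioi
    (fun s : ℝ => s ^ (q - 1) * Real.exp (-(Real.pi * ρ ^ 2 * s))) (p := -1) (by norm_num)
  have h4 := (integrableOn_Ioi_comp_rpow_iff
    (fun s : ℝ => s ^ (q - 1) * Real.exp (-(Real.pi * ρ ^ 2 * s))) (p := -1) (by norm_num)).2 h1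
  have h5 : ∀ s ∈ Ioi (0 : ℝ), (|(-1 : ℝ)| * s ^ (-1 - 1 : ℝ)) •
      ((s ^ (-1 : ℝ)) ^ (q - 1) * Real.exp (-(Real.pi * ρ ^ 2 * s ^ (-1 : ℝ)))) =
      s ^ (-q - 1) * Real.exp (-(Real.pi * ρ ^ 2 / s)) := by
    intro s hs
    have hs' : (0 : ℝ) < s := hs
    rw [← Real.rpow_mul hs'.le, abs_neg, abs_one, one_mul, smul_eq_mul, ← mul_assoc,
      ← Real.rpow_add hs', Real.rpow_neg_one, div_eq_mul_inv]
    congr 2; ring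
  exact ⟨h4.congr_fun h5 measurableSet_Ioi,
    by rw [← h2, ← h3]; exact (setIntegral_congr_fun measurableSet_Ioi h5).symm⟩

/-- The multiplication formula `∫ 𝓕φ · u = ∫ φ · 𝓕u` for a Gaussian `φ`, modulated so that its
transform is centred at `x`. -/
lemma integral_gaussian_mul {m : ℕ} {u : Euc m → ℂ} (hu : Integrable u) {s : ℝ} (hs : 0 < s)
    (x : Euc m) :
    ∫ z, ((s ^ (-(m / 2 : ℝ)) * Real.exp (-(Real.pi * ‖x - z‖ ^ 2 / s)) : ℝ) : ℂ) * u z =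
      ∫ ξ, ((Real.exp (-(Real.pi * ‖ξ‖ ^ 2 * s)) : ℝ) : ℂ) *
        (Complex.exp ((2 * Real.pi * inner ℝ ξ x : ℝ) * Complex.I) * 𝓕 u ξ) := by
  have hb : 0 < ((Real.pi * s : ℝ) : ℂ).re := by rw [Complex.ofReal_re]; positivity
  set φ : Euc m → ℂ := fun v => Complex.exp (-((Real.pi * s : ℝ) : ℂ) * ‖v‖ ^ 2 +
    2 * Real.pi * Complex.I * (inner ℝ x v : ℝ)) with hφ
  have hφi : Integrable φ := GaussianFourier.integrable_cexp_neg_mul_sq_norm_add hb _ x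
  have hF := fun w => fourier_gaussian_innerProductSpace' (V := Euc m) hb x w
  have key := VectorFourier.integral_fourierIntegral_smul_eq_flip (μ := (volume : Measure (Euc m)))
    (ν := (volume : Measure (Euc m))) (L := innerₗ (Euc m)) (f := φ) (g := u)
    Real.continuous_fourierChar
    (by change Continuous fun p : Euc m × Euc m => inner ℝ p.1 p.2; fun_prop) hφi hu
  rw [flip_innerₗ] at key
  change ∫ z, 𝓕 φ z • u z = ∫ ξ, φ ξ • 𝓕 u ξ at key
  calc _ = ∫ z, 𝓕 φ z • u z := by
        refine integral_congr_ae (Filter.Eventually.of_forall fun z => ?_)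
        simp only [hφ]
        rw [hF z, finrank_euclideanSpace_fin, smul_eq_mul]
        congr 1
        have h1 : ((Real.pi : ℂ) / ((Real.pi * s : ℝ) : ℂ)) ^ ((m : ℂ) / 2) =
            ((s ^ (-(m / 2 : ℝ)) : ℝ) : ℂ) := by
          have : (Real.pi : ℂ) / ((Real.pi * s : ℝ) : ℂ) = ((s⁻¹ : ℝ) : ℂ) := by
            push_cast
            rw [div_mul_eq_div_div, div_self (by exact_mod_cast Real.pi_ne_zero), one_div]
          rw [this, show ((m : ℂ) / 2) = ((m / 2 : ℝ) : ℂ) by push_cast; rfl,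
            ← Complex.ofReal_cpow (by positivity), Real.inv_rpow hs.le, Real.rpow_neg hs.le]
        rw [h1]
        push_cast
        congr 2
        have h2 : (Real.pi : ℂ) ≠ 0 := by exact_mod_cast Real.pi_ne_zero
        have h3 : (s : ℂ) ≠ 0 := by exact_mod_cast hs.ne'
        field_simp
    _ = ∫ ξ, φ ξ • 𝓕 u ξ := key
    _ = _ := by
        refine integral_congr_ae (Filter.Eventually.of_forall fun ξ => ?_)
        simp only [hφ]
        rw [smul_eq_mul, ← mul_assoc]
        congr 1
        rw [Complex.ofReal_exp, ← Complex.exp_add, real_inner_comm]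
        congr 1; push_cast; ring

/-- Near `x` the kernel is integrable and `u` bounded; elsewhere the kernel is bounded and `u`
integrable. -/
lemma integrable_norm_rpow_sub_mul {m : ℕ} [NeZero m] {τ : ℝ} (hτ : 0 < τ) (hτm : τ < m)
    {u : Euc m → ℂ} (hu : Integrable u) {M : ℝ} (hM : ∀ z, ‖u z‖ ≤ M) (x : Euc m) :
    Integrable fun z => ‖x - z‖ ^ (τ - m) * ‖u z‖ := by
  obtain ⟨C, hC, H⟩ := exists_lintegral_ball_le (m := m) hτ
  have hmeas : AEStronglyMeasurable fun z => ‖x - z‖ ^ (τ - m) * ‖u z‖ :=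
    (Measurable.aestronglyMeasurable (by fun_prop)).mul hu.aestronglyMeasurable.norm
  have hM0 : 0 ≤ M := (norm_nonneg _).trans (hM 0)
  refine ⟨hmeas, ?_⟩
  rw [hasFiniteIntegral_iff_ofReal (Filter.Eventually.of_forall fun z => by positivity)]
  have b1 : ∫⁻ z in {z : Euc m | ‖z - x‖ < 1}, ENNReal.ofReal (‖x - z‖ ^ (τ - m) * ‖u z‖) ≤
      ENNReal.ofReal (M * (C * 1 ^ τ)) := by
    refine setLIntegral_ofReal_le (measurableSet_lt (by fun_prop) (by fun_prop)) hM0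
      (fun z _ => ?_) (H x 1 one_pos)
    rw [norm_sub_rev, mul_comm]
    exact mul_le_mul_of_nonneg_right (hM z) (by positivity)
  have b2 : ∫⁻ z in {z : Euc m | 1 ≤ ‖z - x‖}, ENNReal.ofReal (‖x - z‖ ^ (τ - m) * ‖u z‖) ≤
      ENNReal.ofReal (1 * ∫ z, ‖u z‖) := by
    refine setLIntegral_ofReal_le (measurableSet_le (by fun_prop) (by fun_prop)) zero_le_one
      (g := fun z => ‖u z‖) (fun z hz => ?_) ?_
    · rw [norm_sub_rev]
      exact mul_le_mul_of_nonneg_right (Real.rpow_le_one_of_one_le_of_nonpos hz (by linarith))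
        (norm_nonneg _)
    · rw [ofReal_integral_eq_lintegral_ofReal hu.norm
        (Filter.Eventually.of_forall fun _ => norm_nonneg _)]
      exact setLIntegral_le_lintegral _ _
  have htot := setLIntegral_le_add (S := univ) (fun h _ => lt_or_ge ‖h - x‖ 1)
    (by positivity) (by positivity) b1 b2
  rw [Measure.restrict_univ] at htot
  exact htot.trans_lt ENNReal.ofReal_lt_top

/-- Integrate the Gaussian identity for `u = (-Δ)^(τ/2) a` against `s^(τ/2-1) ds`. By the Gamma
integral, the Gaussians in space become `K₂ ‖x - z‖^(τ-m)` and those in frequency become `K₁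
‖ξ‖^(-τ)`. The latter cancels the symbol in `𝓕 u`, and Fourier inversion returns `a x`. -/
lemma exists_rieszPotential_representation {m : ℕ} [NeZero m] {τ : ℝ} (hτ : 0 < τ) (hτm : τ < m) :
    ∃ c : ℝ, ∀ (a : 𝓢(Euc m, ℂ)) (x : Euc m),
      Integrable (fun z => ((‖x - z‖ ^ (τ - m) : ℝ) : ℂ) * fracLaplacian τ a z) ∧
      a x = c * ∫ z, ((‖x - z‖ ^ (τ - m) : ℝ) : ℂ) * fracLaplacian τ a z := by
  have nt := nontrivial_euc m
  set K₁ : ℝ := (1 / Real.pi) ^ (τ / 2) * Real.Gamma (τ / 2) with hK₁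
  set K₂ : ℝ := (1 / Real.pi) ^ ((m - τ) / 2) * Real.Gamma ((m - τ) / 2) with hK₂
  have hK₁0 : 0 < K₁ := by
    have := Real.Gamma_pos_of_pos (half_pos hτ)
    positivity
  have hA : ((K₁ * (2 * Real.pi) ^ τ : ℝ) : ℂ) ≠ 0 := by
    rw [Complex.ofReal_ne_zero]; positivity
  refine ⟨K₂ / (K₁ * (2 * Real.pi) ^ τ), fun a x => ?_⟩
  set u := fracLaplacian τ a with hu
  have hui : Integrable u := integrable_fracLaplacian hτ a
  obtain ⟨M, hM⟩ := exists_norm_fracLaplacian_le τ a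
  have hint := integrable_norm_rpow_sub_mul hτ hτm hui hM x
  have hint' : Integrable (fun z => ((‖x - z‖ ^ (τ - m) : ℝ) : ℂ) * u z) := by
    refine hint.mono' ((Measurable.aestronglyMeasurable (by fun_prop)).mul
      hui.aestronglyMeasurable) (Filter.Eventually.of_forall fun z => ?_)
    rw [norm_mul, Complex.norm_real, Real.norm_eq_abs, abs_of_nonneg (by positivity)]
  refine ⟨hint', ?_⟩
  set μ : Measure ℝ := volume.restrict (Ioi 0) with hμ
  have hμ0 : ∀ᵐ s ∂μ, s ∈ Ioi (0 : ℝ) := ae_restrict_mem measurableSet_Ioi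
  -- the two sides of the Gaussian identity, integrated in `s`
  set L : ℝ × Euc m → ℂ := fun q => ((q.1 ^ (-((m - τ) / 2) - 1) *
    Real.exp (-(Real.pi * ‖x - q.2‖ ^ 2 / q.1)) : ℝ) : ℂ) * u q.2 with hL
  set R : ℝ × Euc m → ℂ := fun q => ((q.1 ^ (τ / 2 - 1) *
    Real.exp (-(Real.pi * ‖q.2‖ ^ 2 * q.1)) : ℝ) : ℂ) *
      (Complex.exp ((2 * Real.pi * inner ℝ q.2 x : ℝ) * Complex.I) * 𝓕 u q.2) with hR
  have hFu : 𝓕 u = fun ξ : Euc m => (((2 * Real.pi * ‖ξ‖) ^ τ : ℝ) : ℂ) *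
      (𝓕 a : 𝓢(Euc m, ℂ)) ξ := fourier_fracLaplacian hτ a
  have hFui : Integrable (𝓕 u) := hFu ▸ integrable_symbol_mul_schwartz hτ.le _
  have hLm : AEStronglyMeasurable L (μ.prod volume) :=
    (Measurable.aestronglyMeasurable (by fun_prop)).mul hui.aestronglyMeasurable.comp_snd
  have hRm : AEStronglyMeasurable R (μ.prod volume) :=
    (Measurable.aestronglyMeasurable (by fun_prop)).mul
      ((Continuous.aestronglyMeasurable (by fun_prop)).mul hFui.aestronglyMeasurable.comp_snd)
  have hq : 0 < ((m : ℝ) - τ) / 2 := by linarith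
  have hwL : ∀ z, z ≠ x → Integrable (fun s : ℝ => s ^ (-((m - τ) / 2) - 1) *
      Real.exp (-(Real.pi * ‖x - z‖ ^ 2 / s))) μ ∧ ∫ s, s ^ (-((m - τ) / 2) - 1) *
      Real.exp (-(Real.pi * ‖x - z‖ ^ 2 / s)) ∂μ = K₂ * ‖x - z‖ ^ (τ - m) := by
    intro z hz
    have := integral_rpow_mul_exp_neg_pi_div hq (norm_pos_iff.2 (sub_ne_zero.2 hz.symm))
    rw [show -(2 * (((m : ℝ) - τ) / 2)) = τ - m by ring] at this
    exact this
  have hwR : ∀ ξ : Euc m, ξ ≠ 0 → Integrable (fun s : ℝ => s ^ (τ / 2 - 1) *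
      Real.exp (-(Real.pi * ‖ξ‖ ^ 2 * s))) μ ∧ ∫ s, s ^ (τ / 2 - 1) *
      Real.exp (-(Real.pi * ‖ξ‖ ^ 2 * s)) ∂μ = K₁ * ‖ξ‖ ^ (-τ) := by
    intro ξ hξ
    have := integral_rpow_mul_exp_neg_pi_mul (half_pos hτ) (norm_pos_iff.2 hξ)
    rw [show -(2 * (τ / 2)) = -τ by ring] at this
    exact this
  have hLi : Integrable L (μ.prod volume) := by
    rw [integrable_prod_iff' hLm]
    have hn : ∀ z, ∀ᵐ s ∂μ, ‖L (s, z)‖ = s ^ (-((m - τ) / 2) - 1) *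
      Real.exp (-(Real.pi * ‖x - z‖ ^ 2 / s)) * ‖u z‖ := by
      intro z
      filter_upwards [hμ0] with s hs
      have hs' : (0 : ℝ) < s := hs
      rw [hL, norm_mul, Complex.norm_real, Real.norm_eq_abs, abs_of_nonneg (by positivity)]
    refine ⟨?_, ?_⟩
    · filter_upwards [Measure.ae_ne volume x] with z hz
      exact (hwL z hz).1.ofReal.mul_const (u z)
    · refine (hint.const_mul K₂).congr ?_
      filter_upwards [Measure.ae_ne volume x] with z hz
      rw [integral_congr_ae (hn z), integral_mul_const, (hwL z hz).2]
      ring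
  have hRi : Integrable R (μ.prod volume) := by
    rw [integrable_prod_iff' hRm]
    have hn : ∀ ξ, ∀ᵐ s ∂μ, ‖R (s, ξ)‖ = s ^ (τ / 2 - 1) *
      Real.exp (-(Real.pi * ‖ξ‖ ^ 2 * s)) * ‖𝓕 u ξ‖ := by
      intro z
      filter_upwards [hμ0] with s hs
      have hs' : (0 : ℝ) < s := hs
      rw [hR, norm_mul, norm_mul, Complex.norm_exp_ofReal_mul_I, one_mul, Complex.norm_real,
        Real.norm_eq_abs, abs_of_nonneg (by positivity)]
    refine ⟨?_, ?_⟩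
    · filter_upwards [Measure.ae_ne volume (0 : Euc m)] with ξ hξ
      exact (hwR ξ hξ).1.ofReal.mul_const (Complex.exp ((2 * Real.pi * inner ℝ ξ x : ℝ) * Complex.I) * 𝓕 u ξ)
    · refine ((𝓕 a : 𝓢(Euc m, ℂ)).integrable.norm.const_mul (K₁ * (2 * Real.pi) ^ τ)).congr ?_
      filter_upwards [Measure.ae_ne volume (0 : Euc m)] with ξ hξ
      have hξ' : 0 < ‖ξ‖ := norm_pos_iff.2 hξ
      rw [integral_congr_ae (hn ξ), integral_mul_const, (hwR ξ hξ).2, hFu, norm_mul,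
        Complex.norm_real, Real.norm_eq_abs, abs_of_nonneg (by positivity),
        Real.mul_rpow (by positivity) hξ'.le, Real.rpow_neg hξ'.le]
      have : ‖ξ‖ ^ τ ≠ 0 := (Real.rpow_pos_of_pos hξ' τ).ne'
      field_simp
  have e1 : ∫ s, (∫ z, L (s, z)) ∂μ = K₂ * ∫ z, ((‖x - z‖ ^ (τ - m) : ℝ) : ℂ) * u z := by
    rw [integral_integral_swap (f := fun s z => L (s, z)) hLi, ← integral_const_mul]
    refine integral_congr_ae ?_
    filter_upwards [Measure.ae_ne volume x] with z hz
    simp only [hL]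
    rw [integral_mul_const, integral_complex_ofReal, (hwL z hz).2]
    push_cast; ring
  have e2 : ∫ s, (∫ ξ, R (s, ξ)) ∂μ = ((K₁ * (2 * Real.pi) ^ τ : ℝ) : ℂ) * a x := by
    rw [integral_integral_swap (f := fun s ξ => R (s, ξ)) hRi]
    have ha : a x = ∫ ξ, Complex.exp ((2 * Real.pi * inner ℝ ξ x : ℝ) * Complex.I) *
        (𝓕 a : 𝓢(Euc m, ℂ)) ξ := by
      rw [← fourierInv_eq_exp, fourierInv_fourier_schwartz]
    rw [ha, ← integral_const_mul]
    refine integral_congr_ae ?_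
    filter_upwards [Measure.ae_ne volume (0 : Euc m)] with ξ hξ
    have hξ' : 0 < ‖ξ‖ := norm_pos_iff.2 hξ
    simp only [hR]
    rw [integral_mul_const, integral_complex_ofReal, (hwR ξ hξ).2, congrFun hFu ξ,
      Real.mul_rpow (by positivity) hξ'.le, Real.rpow_neg hξ'.le]
    have : ((‖ξ‖ ^ τ : ℝ) : ℂ) ≠ 0 :=
      Complex.ofReal_ne_zero.2 (Real.rpow_pos_of_pos hξ' τ).ne'
    push_cast
    field_simp
  have e3 : ∫ s, (∫ z, L (s, z)) ∂μ = ∫ s, (∫ ξ, R (s, ξ)) ∂μ := by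
    refine integral_congr_ae ?_
    filter_upwards [hμ0] with s hs
    have hs' : (0 : ℝ) < s := hs
    have := congrArg (((s ^ (τ / 2 - 1) : ℝ) : ℂ) * ·) (integral_gaussian_mul hui hs' x)
    simp only [← integral_const_mul] at this
    refine Eq.trans ?_ (this.trans ?_)
    · refine integral_congr_ae (Filter.Eventually.of_forall fun z => ?_)
      simp only [hL]
      rw [show -(((m : ℝ) - τ) / 2) - 1 = (τ / 2 - 1) + -(m / 2) by ring, Real.rpow_add hs']
      push_cast; ring
    · refine integral_congr_ae (Filter.Eventually.of_forall fun ξ => ?_)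
      simp only [hR]
      push_cast; ring
  rw [e1, e2] at e3
  push_cast at e3 hA ⊢
  rw [div_mul_eq_mul_div, e3, mul_div_cancel_left₀ _ hA]

/-! ### Splitting the fractional Laplacian of the remainder; commutators as integrals -/

lemma exists_schwartz_eq_mul {m : ℕ} (a b : 𝓢(Euc m, ℂ)) :
    ∃ c : 𝓢(Euc m, ℂ), ⇑c = fun x => a x * b x :=
  ⟨SchwartzMap.smulLeftCLM ℂ a b, by
    ext x; rw [SchwartzMap.smulLeftCLM_apply_apply a.hasTemperateGrowth, smul_eq_mul]⟩

lemma fourier_eq_exp {m : ℕ} (g : Euc m → ℂ) (x : Euc m) :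
    𝓕 g x = ∫ ξ, Complex.exp ((-2 * Real.pi * inner ℝ ξ x : ℝ) * Complex.I) * g ξ := by
  rw [Real.fourier_eq']
  simp

lemma fourier_mul_fourierInv {m : ℕ} {a g : Euc m → ℂ} (ha : Integrable a) (hg : Integrable g)
    (ξ : Euc m) :
    𝓕 (fun x => a x * 𝓕⁻ g x) ξ = ∫ η, g η * 𝓕 a (ξ - η) := by
  have hi : Integrable (fun q : Euc m × Euc m => Complex.exp
      ((-2 * Real.pi * inner ℝ q.1 (ξ - q.2) : ℝ) * Complex.I) * (a q.1 * g q.2))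
      ((volume : Measure (Euc m)).prod volume) := by
    refine (ha.mul_prod hg).norm.mono' ((Continuous.aestronglyMeasurable (by fun_prop)).mul
      (ha.mul_prod hg).aestronglyMeasurable) (Filter.Eventually.of_forall fun q => ?_)
    rw [norm_mul, Complex.norm_exp_ofReal_mul_I, one_mul]
  have hsw := integral_integral_swap (f := fun x η => Complex.exp
      ((-2 * Real.pi * inner ℝ x (ξ - η) : ℝ) * Complex.I) * (a x * g η)) hi
  rw [fourier_eq_exp]
  refine Eq.trans ?_ (hsw.trans ?_)
  · refine integral_congr_ae (Filter.Eventually.of_forall fun x => ?_)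
    simp only
    rw [fourierInv_eq_exp, ← integral_const_mul, ← integral_const_mul]
    refine integral_congr_ae (Filter.Eventually.of_forall fun η => ?_)
    simp only
    have : Complex.exp ((-2 * Real.pi * inner ℝ x (ξ - η) : ℝ) * Complex.I) =
        Complex.exp ((-2 * Real.pi * inner ℝ x ξ : ℝ) * Complex.I) *
          Complex.exp ((2 * Real.pi * inner ℝ η x : ℝ) * Complex.I) := by
      rw [← Complex.exp_add, inner_sub_right, real_inner_comm η x]
      congr 1; push_cast; ring
    rw [this]; ring
  · refine integral_congr_ae (Filter.Eventually.of_forall fun η => ?_)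
    simp only
    rw [fourier_eq_exp, ← integral_const_mul]
    refine integral_congr_ae (Filter.Eventually.of_forall fun x => ?_)
    simp only; ring

/-- The product `a (-Δ)^(α/2) b` need not be Schwartz. Its transform is a convolution, and the
weight `1 + ‖ξ‖` is submultiplicative, so weighted integrability passes from the factors to the
convolution. This makes symbols of order `β ≤ 1` applicable. -/
lemma integrable_one_add_norm_mul_fourier {m : ℕ} (a : 𝓢(Euc m, ℂ)) {g : Euc m → ℂ}
    (hg : Integrable g) (hg1 : Integrable fun η => ‖η‖ * ‖g η‖) :
    Integrable fun ξ => (1 + ‖ξ‖) * ‖𝓕 (fun x => a x * 𝓕⁻ g x) ξ‖ := by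
  have hf : Integrable fun x => a x * 𝓕⁻ g x := by
    refine a.integrable.mul_bdd
      (continuous_fourierInv hg).aestronglyMeasurable
      (Filter.Eventually.of_forall fun x => norm_fourierInv_le g x)
  have h1 : Integrable fun η => (1 + ‖η‖) * ‖g η‖ := by
    simp_rw [add_mul, one_mul]; exact hg.norm.add hg1
  have h2 : Integrable fun η => (1 + ‖η‖) * ‖(𝓕 a : 𝓢(Euc m, ℂ)) η‖ := by
    simp_rw [add_mul, one_mul]
    refine (𝓕 a : 𝓢(Euc m, ℂ)).integrable.norm.add ?_
    simpa using (𝓕 a : 𝓢(Euc m, ℂ)).integrable_pow_mul volume 1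
  have hconv := h1.convolution_integrand (ContinuousLinearMap.mul ℝ ℝ) h2
  refine hconv.integral_prod_left.mono' ?_ ?_
  · exact ((by fun_prop : Continuous fun ξ : Euc m => 1 + ‖ξ‖).mul
      (continuous_fourier hf).norm).aestronglyMeasurable
  · filter_upwards [hconv.prod_right_ae] with ξ hξ
    rw [norm_mul, norm_norm, Real.norm_eq_abs, abs_of_nonneg (by positivity),
      fourier_mul_fourierInv a.integrable hg, ← SchwartzMap.fourier_coe]
    refine (mul_le_mul_of_nonneg_left (norm_integral_le_integral_norm _)
      (by positivity)).trans ?_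
    rw [← integral_const_mul]
    refine integral_mono_of_nonneg (Filter.Eventually.of_forall fun η => by positivity) hξ
      (Filter.Eventually.of_forall fun η => ?_)
    simp only [ContinuousLinearMap.mul_apply', norm_mul]
    have h3 : 1 + ‖ξ‖ ≤ (1 + ‖η‖) * (1 + ‖ξ - η‖) := by
      have := norm_le_norm_add_norm_sub' ξ η
      nlinarith [norm_nonneg η, norm_nonneg (ξ - η)]
    calc (1 + ‖ξ‖) * (‖g η‖ * ‖(𝓕 a : 𝓢(Euc m, ℂ)) (ξ - η)‖)
        ≤ (1 + ‖η‖) * (1 + ‖ξ - η‖) * (‖g η‖ * ‖(𝓕 a : 𝓢(Euc m, ℂ)) (ξ - η)‖) :=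
          mul_le_mul_of_nonneg_right h3 (by positivity)
      _ = _ := by ring

lemma integrable_mul_fracLaplacian {m : ℕ} {α : ℝ} (hα : 0 ≤ α) (a b : 𝓢(Euc m, ℂ)) :
    Integrable fun x => a x * fracLaplacian α b x := by
  obtain ⟨C, hC⟩ := exists_norm_fracLaplacian_le α b
  exact a.integrable.mul_bdd (continuous_fracLaplacian hα b).aestronglyMeasurable
    (Filter.Eventually.of_forall hC)

lemma integrable_norm_rpow_mul_fourier_mul_fracLaplacian {m : ℕ} {α β : ℝ} (hα : 0 ≤ α)
    (hβ : 0 ≤ β) (hβ1 : β ≤ 1) (a b : 𝓢(Euc m, ℂ)) :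
    Integrable fun ξ => ‖ξ‖ ^ β * ‖𝓕 (fun x => a x * fracLaplacian α b x) ξ‖ := by
  have h1 := integrable_norm_rpow_mul_symbol hα zero_le_one (𝓕 b : 𝓢(Euc m, ℂ))
  simp only [Real.rpow_one] at h1
  have h2 := integrable_one_add_norm_mul_fourier a
    (integrable_symbol_mul_schwartz hα (𝓕 b : 𝓢(Euc m, ℂ))) h1
  rw [← fracLaplacian_schwartz] at h2
  refine h2.mono' ?_ (Filter.Eventually.of_forall fun ξ => ?_)
  · exact ((Continuous.rpow_const (by fun_prop) fun _ => Or.inr hβ).mul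
      (continuous_fourier (integrable_mul_fracLaplacian hα a b)).norm).aestronglyMeasurable
  · rw [Real.norm_eq_abs, abs_of_nonneg (by positivity)]
    refine mul_le_mul_of_nonneg_right ?_ (norm_nonneg _)
    rcases le_total ‖ξ‖ 1 with h | h
    · linarith [Real.rpow_le_one (norm_nonneg ξ) h hβ, norm_nonneg ξ]
    · have := Real.rpow_le_rpow_of_exponent_le h hβ1
      rw [Real.rpow_one] at this
      linarith

lemma integrable_exp_mul {m : ℕ} {w : Euc m → ℂ} (hw : Integrable w) (v : Euc m) (r : ℝ) :
    Integrable fun ξ : Euc m => Complex.exp ((r * inner ℝ ξ v : ℝ) * Complex.I) * w ξ := by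
  refine hw.norm.mono' (AEStronglyMeasurable.mul
    (Continuous.aestronglyMeasurable (by fun_prop)) hw.aestronglyMeasurable)
    (Filter.Eventually.of_forall fun ξ => ?_)
  rw [norm_mul, Complex.norm_exp_ofReal_mul_I, one_mul]

lemma fracLaplacian_sub {m : ℕ} {β : ℝ} {f g : Euc m → ℂ} (hf : Integrable f) (hg : Integrable g)
    (hfβ : Integrable fun ξ => ‖ξ‖ ^ β * ‖𝓕 f ξ‖) (hgβ : Integrable fun ξ => ‖ξ‖ ^ β * ‖𝓕 g ξ‖)
    (x : Euc m) :
    fracLaplacian β (fun x => f x - g x) x = fracLaplacian β f x - fracLaplacian β g x := by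
  have h1 : 𝓕 (fun x => f x - g x) = fun ξ => 𝓕 f ξ - 𝓕 g ξ := by
    ext ξ
    simp_rw [fourier_eq_exp, mul_sub]
    exact integral_sub (integrable_exp_mul hf ξ _) (integrable_exp_mul hg ξ _)
  simp only [fracLaplacian]
  rw [h1]
  simp_rw [fourierInv_eq_exp, mul_sub]
  exact integral_sub
    (integrable_exp_mul (integrable_symbol_mul (continuous_fourier hf).aestronglyMeasurable hfβ) x _)
    (integrable_exp_mul (integrable_symbol_mul (continuous_fourier hg).aestronglyMeasurable hgβ) x _)

/-- Linearity, the composition rule for `(-Δ)^(α/2)(ab)`, and adding and subtracting `a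
(-Δ)^((α+β)/2) b` and its mirror image. The work lies in checking that each term separately has
enough integrable frequency decay. -/
lemma fracLaplacian_leibnizRemainder {m : ℕ} [NeZero m] {α β : ℝ} (hα : 0 < α) (hβ : 0 ≤ β)
    (hβ1 : β ≤ 1) (a b : 𝓢(Euc m, ℂ)) (x : Euc m) :
    fracLaplacian β (leibnizRemainder α a b) x = leibnizRemainder (α + β) a b x +
      (a x * fracLaplacian (α + β) b x -
        fracLaplacian β (fun y => a y * fracLaplacian α b y) x) +
      (b x * fracLaplacian (α + β) a x -
        fracLaplacian β (fun y => b y * fracLaplacian α a y) x) := by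
  obtain ⟨c, hc⟩ := exists_schwartz_eq_mul a b
  have i1 := integrable_fracLaplacian hα c
  have w1 : Integrable fun ξ => ‖ξ‖ ^ β * ‖𝓕 (fracLaplacian α c) ξ‖ := by
    rw [fourier_fracLaplacian hα]
    exact integrable_norm_rpow_mul_symbol hα.le hβ _
  have i2 := integrable_mul_fracLaplacian hα.le a b
  have w2 := integrable_norm_rpow_mul_fourier_mul_fracLaplacian hα.le hβ hβ1 a b
  have i3 := integrable_mul_fracLaplacian hα.le b a
  have w3 := integrable_norm_rpow_mul_fourier_mul_fracLaplacian hα.le hβ hβ1 b a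
  have i12 : Integrable fun x => fracLaplacian α c x - a x * fracLaplacian α b x := i1.sub i2
  have w12 : Integrable fun ξ => ‖ξ‖ ^ β *
      ‖𝓕 (fun x => fracLaplacian α c x - a x * fracLaplacian α b x) ξ‖ := by
    refine (w1.add w2).mono' ?_ (Filter.Eventually.of_forall fun ξ => ?_)
    · exact ((Continuous.rpow_const (by fun_prop) fun _ => Or.inr hβ).mul
        (continuous_fourier i12).norm).aestronglyMeasurable
    · have : 𝓕 (fun x => fracLaplacian α c x - a x * fracLaplacian α b x) ξ =
          𝓕 (fracLaplacian α c) ξ - 𝓕 (fun x => a x * fracLaplacian α b x) ξ := by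
        simp_rw [fourier_eq_exp, mul_sub]
        exact integral_sub (integrable_exp_mul i1 _ _) (integrable_exp_mul i2 _ _)
      rw [Real.norm_eq_abs, abs_of_nonneg (by positivity), this, Pi.add_apply, ← mul_add]
      exact mul_le_mul_of_nonneg_left (norm_sub_le _ _) (by positivity)
  have e : leibnizRemainder α a b = fun x => (fracLaplacian α c x - a x * fracLaplacian α b x) -
      b x * fracLaplacian α a x := by
    ext y; rw [leibnizRemainder, hc]
  rw [e, fracLaplacian_sub i12 i3 w12 w3, fracLaplacian_sub i1 i2 w1 w2,
    fracLaplacian_fracLaplacian hα hβ, leibnizRemainder, hc]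
  ring

/-- With `u = (-Δ)^(α/2) b`, subtract the difference representations of `u`, multiplied by `a x`,
and of `a u`; what remains is `a(x)(u(x) - u(x+h)) - (a(x)u(x) - a(x+h)u(x+h)) = (a(x+h) - a(x))
u(x+h)`. -/
lemma exists_commutator_representation {m : ℕ} [NeZero m] {α β : ℝ} (hα : 0 ≤ α) (hβ : 0 < β)
    (hβ1 : β < 1) :
    ∃ κ : ℝ, ∀ (a b : 𝓢(Euc m, ℂ)) (x : Euc m),
    Integrable (fun h : Euc m => ((‖h‖ ^ (-β - m) : ℝ) : ℂ) *
      ((a (x + h) - a x) * fracLaplacian α b (x + h))) ∧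
    a x * fracLaplacian (α + β) b x - fracLaplacian β (fun y => a y * fracLaplacian α b y) x =
      κ * ∫ h : Euc m, ((‖h‖ ^ (-β - m) : ℝ) : ℂ) *
        ((a (x + h) - a x) * fracLaplacian α b (x + h)) := by
  obtain ⟨κ, hκ⟩ := exists_difference_representation (m := m) hβ hβ1
  refine ⟨κ, fun a b x => ?_⟩
  set f : Euc m → ℂ := fun y => a y * fracLaplacian α b y with hf
  have hfc : Continuous f := a.continuous.mul (continuous_fracLaplacian hα b)
  have hfi : Integrable f := integrable_mul_fracLaplacian hα a b
  have w0 : Integrable fun ξ => ‖ξ‖ ^ (0 : ℝ) * ‖𝓕 f ξ‖ :=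
    integrable_norm_rpow_mul_fourier_mul_fracLaplacian hα le_rfl zero_le_one a b
  simp only [Real.rpow_zero, one_mul] at w0
  have hFi : Integrable (𝓕 f) :=
    (integrable_norm_iff (continuous_fourier hfi).aestronglyMeasurable).1 w0
  have wβ : Integrable fun ξ => ‖ξ‖ ^ β * ‖𝓕 f ξ‖ :=
    integrable_norm_rpow_mul_fourier_mul_fracLaplacian hα hβ.le hβ1.le a b
  obtain ⟨f1, f2⟩ := hκ (𝓕 f) hFi wβ x
  rw [hfc.fourierInv_fourier_eq hfi hFi] at f1 f2
  obtain ⟨u1, u2⟩ := hκ _ (integrable_symbol_mul_schwartz hα (𝓕 b : 𝓢(Euc m, ℂ)))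
    (integrable_norm_rpow_mul_symbol hα hβ.le (𝓕 b : 𝓢(Euc m, ℂ))) x
  rw [← fracLaplacian_schwartz] at u1 u2
  have hu : fracLaplacian (α + β) b = 𝓕⁻ (fun ξ : Euc m => (((2 * Real.pi * ‖ξ‖) ^ β : ℝ) : ℂ) *
      ((((2 * Real.pi * ‖ξ‖) ^ α : ℝ) : ℂ) * (𝓕 b : 𝓢(Euc m, ℂ)) ξ)) := by
    rw [fracLaplacian_schwartz]
    congr 1; ext ξ
    rw [Real.rpow_add_of_nonneg (by positivity) hα hβ.le]
    push_cast; ring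
  have hh : ∀ h : Euc m, ((‖h‖ ^ (-β - m) : ℝ) : ℂ) *
      ((a (x + h) - a x) * fracLaplacian α b (x + h)) =
      a x * (((‖h‖ ^ (-β - m) : ℝ) : ℂ) * (fracLaplacian α b x - fracLaplacian α b (x + h))) -
      ((‖h‖ ^ (-β - m) : ℝ) : ℂ) * (f x - f (x + h)) := by
    intro h; simp only [hf]; ring
  simp_rw [hh]
  refine ⟨(u1.const_mul _).sub f1, ?_⟩
  rw [integral_sub (u1.const_mul _) f1, integral_const_mul, hu, u2]
  simp only [fracLaplacian] at f2 ⊢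
  rw [f2]
  ring

/-! ### From kernel bounds to Riesz potentials -/

lemma lintegral_rotate {X : Type*} [MeasurableSpace X] {μ : Measure X} [SFinite μ]
    {F : X × X × X → ℝ≥0∞} (hF : Measurable F) :
    ∫⁻ h, ∫⁻ z₁, ∫⁻ z₂, F (h, z₁, z₂) ∂μ ∂μ ∂μ = ∫⁻ z₁, ∫⁻ z₂, ∫⁻ h, F (h, z₁, z₂) ∂μ ∂μ ∂μ := by
  rw [lintegral_lintegral_swap]
  · refine lintegral_congr fun z₁ => ?_
    rw [lintegral_lintegral_swap]
    exact (hF.comp (by fun_prop : Measurable fun q : X × X => (q.1, z₁, q.2))).aemeasurable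
  · refine Measurable.aemeasurable ?_
    exact (hF.comp (by fun_prop :
      Measurable fun q : (X × X) × X => (q.1.1, q.1.2, q.2))).lintegral_prod_right'

lemma rieszConst_pos {m : ℕ} {s : ℝ} (hs : 0 < s) (hsm : s < m) : 0 < rieszConst m s := by
  have h1 := Real.Gamma_pos_of_pos (half_pos hs)
  have h2 : 0 < Real.Gamma (((m : ℝ) - s) / 2) := Real.Gamma_pos_of_pos (by linarith)
  rw [rieszConst]; positivity

lemma lintegral_eq_rieszPotential {m : ℕ} {s : ℝ} (hs : 0 < s) (hsm : s < m)
    (f : Euc m → ℝ≥0∞) (x : Euc m) :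
    ∫⁻ y, ENNReal.ofReal (‖x - y‖ ^ (s - m)) * f y =
      ENNReal.ofReal (rieszConst m s)⁻¹ * rieszPotential s f x := by
  have hc := rieszConst_pos hs hsm
  rw [rieszPotential, if_neg hs.ne', ← mul_assoc, ← ENNReal.ofReal_mul (by positivity),
    inv_mul_cancel₀ hc.ne', ENNReal.ofReal_one, one_mul]

lemma rieszPotential_const_mul {m : ℕ} {s : ℝ} {c : ℝ≥0∞} (hc : c ≠ ⊤)
    (f : Euc m → ℝ≥0∞) (x : Euc m) :
    rieszPotential s (fun y => c * f y) x = c * rieszPotential s f x := by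
  unfold rieszPotential
  split_ifs
  · rfl
  · simp_rw [mul_left_comm _ c]
    rw [lintegral_const_mul' _ _ hc, mul_left_comm]

/-- The sum of iterated Riesz potentials which controls all bilinear expressions below. -/
noncomputable def potentialSum {m : ℕ} (δ Θ : ℝ) (f g : Euc m → ℝ≥0∞) (x : Euc m) : ℝ≥0∞ :=
  rieszPotential δ f x * rieszPotential (Θ - δ) g x +
  rieszPotential (Θ - δ) f x * rieszPotential δ g x +
  rieszPotential δ (fun y => rieszPotential δ f y * rieszPotential (Θ - 2 * δ) g y) x

lemma lintegral_lintegral_mul_mul {X : Type*} [MeasurableSpace X] {μ : Measure X}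
    {p q f g : X → ℝ≥0∞} (hp : Measurable p) (hq : Measurable q) (hf : Measurable f)
    (hg : Measurable g) :
    ∫⁻ z₁, ∫⁻ z₂, p z₁ * q z₂ * (f z₁ * g z₂) ∂μ ∂μ = (∫⁻ z, p z * f z ∂μ) * ∫⁻ z, q z * g z ∂μ := by
  rw [← lintegral_mul_const _ (by fun_prop : Measurable fun z => p z * f z)]
  refine lintegral_congr fun z₁ => ?_
  rw [← lintegral_const_mul _ (by fun_prop : Measurable fun z => q z * g z)]
  exact lintegral_congr fun z₂ => by ring

/-- Tonelli, term by term. The bounds `0 < δ`, `2δ < Θ < m` keep all three orders `δ`, `Θ - δ`, `Θ -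
2δ` inside `(0, m)`, where the normalising constants are positive and can be divided out. -/
lemma exists_lintegral_rieszMajorant_le {m : ℕ} {δ Θ : ℝ} (hδ : 0 < δ) (hδΘ : 2 * δ < Θ)
    (hΘm : Θ < m) :
    ∃ C : ℝ≥0, ∀ f g : Euc m → ℝ≥0∞, Measurable f → Measurable g → ∀ x,
      ∫⁻ z₁, ∫⁻ z₂, rieszMajorant δ Θ x z₁ z₂ * (f z₁ * g z₂) ≤ C * potentialSum δ Θ f g x := by
  set c₁ := ENNReal.ofReal (rieszConst m δ)⁻¹ with hc₁
  set c₂ := ENNReal.ofReal (rieszConst m (Θ - δ))⁻¹ with hc₂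
  set c₃ := ENNReal.ofReal (rieszConst m (Θ - 2 * δ))⁻¹ with hc₃
  have t₁ : c₁ ≠ ⊤ := ENNReal.ofReal_ne_top
  have t₂ : c₂ ≠ ⊤ := ENNReal.ofReal_ne_top
  have t₃ : c₃ ≠ ⊤ := ENNReal.ofReal_ne_top
  have hC : c₁ * c₂ + c₁ * (c₁ * c₃) ≠ ⊤ := ENNReal.add_ne_top.2
    ⟨ENNReal.mul_ne_top t₁ t₂, ENNReal.mul_ne_top t₁ (ENNReal.mul_ne_top t₁ t₃)⟩
  refine ⟨(c₁ * c₂ + c₁ * (c₁ * c₃)).toNNReal, fun f g hf hg x => ?_⟩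
  rw [ENNReal.coe_toNNReal hC]
  have J₁ := fun (u : Euc m → ℝ≥0∞) y => lintegral_eq_rieszPotential hδ (by linarith) u y
  have J₂ := fun (u : Euc m → ℝ≥0∞) y =>
    lintegral_eq_rieszPotential (s := Θ - δ) (by linarith) (by linarith) u y
  have J₃ := fun (u : Euc m → ℝ≥0∞) y =>
    lintegral_eq_rieszPotential (s := Θ - 2 * δ) (by linarith) (by linarith) u y
  have hK : ∀ p : ℝ, ∀ y : Euc m, Measurable fun z : Euc m => ENNReal.ofReal (‖y - z‖ ^ p) :=
    fun p y => by fun_prop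
  have hT₁ : ∫⁻ z₁, ∫⁻ z₂, ENNReal.ofReal (‖x - z₁‖ ^ (δ - m)) *
      ENNReal.ofReal (‖x - z₂‖ ^ (Θ - δ - m)) * (f z₁ * g z₂) =
      c₁ * c₂ * (rieszPotential δ f x * rieszPotential (Θ - δ) g x) := by
    rw [lintegral_lintegral_mul_mul (hK _ x) (hK _ x) hf hg, J₁, J₂]; ring
  have hT₂ : ∫⁻ z₁, ∫⁻ z₂, ENNReal.ofReal (‖x - z₁‖ ^ (Θ - δ - m)) *
      ENNReal.ofReal (‖x - z₂‖ ^ (δ - m)) * (f z₁ * g z₂) =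
      c₁ * c₂ * (rieszPotential (Θ - δ) f x * rieszPotential δ g x) := by
    rw [lintegral_lintegral_mul_mul (hK _ x) (hK _ x) hf hg, J₁, J₂]; ring
  set F : Euc m × Euc m × Euc m → ℝ≥0∞ := fun q => ENNReal.ofReal (‖x - q.1‖ ^ (δ - m)) *
    (ENNReal.ofReal (‖q.1 - q.2.1‖ ^ (δ - m)) * ENNReal.ofReal (‖q.1 - q.2.2‖ ^ (Θ - 2 * δ - m))) *
      (f q.2.1 * g q.2.2) with hF
  have hFm : Measurable F := by fun_prop
  have hT₃ : ∫⁻ z₁, ∫⁻ z₂, (∫⁻ w, ENNReal.ofReal (‖x - w‖ ^ (δ - m)) *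
      (ENNReal.ofReal (‖w - z₁‖ ^ (δ - m)) * ENNReal.ofReal (‖w - z₂‖ ^ (Θ - 2 * δ - m)))) *
        (f z₁ * g z₂) =
      c₁ * (c₁ * c₃) *
        rieszPotential δ (fun y => rieszPotential δ f y * rieszPotential (Θ - 2 * δ) g y) x := by
    have e1 : ∀ z₁ z₂, (∫⁻ w, ENNReal.ofReal (‖x - w‖ ^ (δ - m)) *
      (ENNReal.ofReal (‖w - z₁‖ ^ (δ - m)) * ENNReal.ofReal (‖w - z₂‖ ^ (Θ - 2 * δ - m)))) *
        (f z₁ * g z₂) = ∫⁻ w, F (w, z₁, z₂) := by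
      intro z₁ z₂
      rw [← lintegral_mul_const _ (by fun_prop)]
    simp_rw [e1]
    rw [← lintegral_rotate hFm, mul_assoc, ← rieszPotential_const_mul (ENNReal.mul_ne_top t₁ t₃),
      ← J₁]
    refine lintegral_congr fun w => ?_
    have e2 : ∫⁻ z₁, ∫⁻ z₂, F (w, z₁, z₂) = ENNReal.ofReal (‖x - w‖ ^ (δ - m)) *
        ∫⁻ z₁, ∫⁻ z₂, ENNReal.ofReal (‖w - z₁‖ ^ (δ - m)) *
          ENNReal.ofReal (‖w - z₂‖ ^ (Θ - 2 * δ - m)) * (f z₁ * g z₂) := by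
      rw [← lintegral_const_mul' _ _ ENNReal.ofReal_ne_top]
      refine lintegral_congr fun z₁ => ?_
      rw [← lintegral_const_mul' _ _ ENNReal.ofReal_ne_top]
      exact lintegral_congr fun z₂ => by rw [hF]; ring
    rw [e2, lintegral_lintegral_mul_mul (hK _ w) (hK _ w) hf hg, J₁, J₃]
    ring
  have hsplit : ∫⁻ z₁, ∫⁻ z₂, rieszMajorant δ Θ x z₁ z₂ * (f z₁ * g z₂) =
      c₁ * c₂ * (rieszPotential δ f x * rieszPotential (Θ - δ) g x) +
      c₁ * c₂ * (rieszPotential (Θ - δ) f x * rieszPotential δ g x) +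
      c₁ * (c₁ * c₃) *
        rieszPotential δ (fun y => rieszPotential δ f y * rieszPotential (Θ - 2 * δ) g y) x := by
    rw [← hT₁, ← hT₂, ← hT₃, ← lintegral_add_left (by fun_prop), ← lintegral_add_left (by fun_prop)]
    refine lintegral_congr fun z₁ => ?_
    rw [← lintegral_add_left (by fun_prop), ← lintegral_add_left (by fun_prop)]
    exact lintegral_congr fun z₂ => by rw [rieszMajorant]; ring
  rw [hsplit, potentialSum, mul_add, mul_add]
  refine add_le_add (add_le_add ?_ ?_) ?_
  · exact mul_le_mul_left le_self_add _
  · exact mul_le_mul_left le_self_add _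
  · exact mul_le_mul_left le_add_self _

/-- A bilinear form whose kernel is dominated by `rieszMajorant` off the diagonals is dominated by
`potentialSum`. -/
lemma exists_lintegral_kernel_le {m : ℕ} [NeZero m] {δ Θ : ℝ} (hδ : 0 < δ) (hδΘ : 2 * δ < Θ)
    (hΘm : Θ < m) (C : ℝ) :
    ∃ C' : ℝ≥0, ∀ (x : Euc m) (k : Euc m → Euc m → ℝ≥0∞),
      (∀ z₁ z₂, z₁ ≠ x → z₂ ≠ x → z₁ ≠ z₂ →
        k z₁ z₂ ≤ ENNReal.ofReal C * rieszMajorant δ Θ x z₁ z₂) →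
      ∀ f g : Euc m → ℝ≥0∞, Measurable f → Measurable g →
        ∫⁻ z₁, ∫⁻ z₂, k z₁ z₂ * (f z₁ * g z₂) ≤ C' * potentialSum δ Θ f g x := by
  have nt := nontrivial_euc m
  obtain ⟨C₀, h₀⟩ := exists_lintegral_rieszMajorant_le hδ hδΘ hΘm
  refine ⟨C.toNNReal * C₀, fun x k hk f g hf hg => ?_⟩
  calc ∫⁻ z₁, ∫⁻ z₂, k z₁ z₂ * (f z₁ * g z₂)
      ≤ ∫⁻ z₁, ∫⁻ z₂, ENNReal.ofReal C * (rieszMajorant δ Θ x z₁ z₂ * (f z₁ * g z₂)) := by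
        refine lintegral_mono_ae ?_
        filter_upwards [Measure.ae_ne volume x] with z₁ hz₁
        refine lintegral_mono_ae ?_
        filter_upwards [Measure.ae_ne volume x, Measure.ae_ne volume z₁] with z₂ hz₂ hz₁₂
        rw [← mul_assoc (ENNReal.ofReal C)]
        exact mul_le_mul_left (hk z₁ z₂ hz₁ hz₂ hz₁₂.symm) _
    _ = ENNReal.ofReal C * ∫⁻ z₁, ∫⁻ z₂, rieszMajorant δ Θ x z₁ z₂ * (f z₁ * g z₂) := by
        simp_rw [lintegral_const_mul' _ _ ENNReal.ofReal_ne_top]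
    _ ≤ ENNReal.ofReal C * (C₀ * potentialSum δ Θ f g x) := mul_le_mul_right (h₀ f g hf hg x) _
    _ = _ := by rw [ENNReal.coe_mul, mul_assoc]; rfl

/-! ### The pointwise bound for the Leibniz remainder -/

lemma integral_sub_sub {X : Type*} [MeasurableSpace X] {μ : Measure X} {f g k : X → ℂ}
    (hf : Integrable f μ) (hg : Integrable g μ) (hk : Integrable k μ) :
    ∫ x, (f x - g x - k x) ∂μ = ∫ x, f x ∂μ - ∫ x, g x ∂μ - ∫ x, k x ∂μ := by
  rw [← integral_sub hf hg]
  exact integral_sub (hf.sub hg) hk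

lemma sum_symmDiffCoeff {N : ℕ} (hN : 0 < N) :
    ∑ i ∈ Finset.range (2 * N + 1), (symmDiffCoeff N i : ℂ) = 0 := by
  have := sum_symmDiffCoeff_mul_exp N 0
  simpa [hN.ne'] using this

/-- Expanding the product of increments gives the differences of `ab`, `-a(x)` times those of `b`,
`-b(x)` times those of `a`, and a constant `a(x) b(x)` that drops out because the coefficients sum
to zero. -/
lemma exists_leibnizRemainder_representation {m : ℕ} [NeZero m] {N : ℕ} {θ : ℝ} (hN : 0 < N)
    (hθ : 0 < θ) (hθN : θ < 2 * N) :
    ∃ κ : ℝ, ∀ (a b : 𝓢(Euc m, ℂ)) (x : Euc m), leibnizRemainder θ a b x =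
      κ * ∫ h : Euc m, ((‖h‖ ^ (-θ - m) : ℝ) : ℂ) * ∑ i ∈ Finset.range (2 * N + 1),
        (symmDiffCoeff N i : ℂ) *
          ((a (x + (i - N : ℝ) • h) - a x) * (b (x + (i - N : ℝ) • h) - b x)) := by
  obtain ⟨κ, hκ⟩ := exists_symmDiff_representation (m := m) hN hθ hθN
  refine ⟨κ, fun a b x => ?_⟩
  obtain ⟨c, hc⟩ := exists_schwartz_eq_mul a b
  have key : ∀ f : 𝓢(Euc m, ℂ), _ := fun f => hκ (𝓕 f : 𝓢(Euc m, ℂ))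
    (𝓕 f : 𝓢(Euc m, ℂ)).integrable (integrable_norm_rpow_mul_schwartz hθ.le _) x
  simp_rw [fourierInv_fourier_schwartz, ← fracLaplacian_schwartz] at key
  obtain ⟨a1, a2⟩ := key a
  obtain ⟨b1, b2⟩ := key b
  obtain ⟨c1, c2⟩ := key c
  have hpt : ∀ h : Euc m, ((‖h‖ ^ (-θ - m) : ℝ) : ℂ) * ∑ i ∈ Finset.range (2 * N + 1),
        (symmDiffCoeff N i : ℂ) *
          ((a (x + (i - N : ℝ) • h) - a x) * (b (x + (i - N : ℝ) • h) - b x)) =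
      ((‖h‖ ^ (-θ - m) : ℝ) : ℂ) * (∑ i ∈ Finset.range (2 * N + 1),
        (symmDiffCoeff N i : ℂ) * c (x + (i - N : ℝ) • h)) -
      a x * (((‖h‖ ^ (-θ - m) : ℝ) : ℂ) * ∑ i ∈ Finset.range (2 * N + 1),
        (symmDiffCoeff N i : ℂ) * b (x + (i - N : ℝ) • h)) -
      b x * (((‖h‖ ^ (-θ - m) : ℝ) : ℂ) * ∑ i ∈ Finset.range (2 * N + 1),
        (symmDiffCoeff N i : ℂ) * a (x + (i - N : ℝ) • h)) := by
    intro h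
    have h1 : ∀ i ∈ Finset.range (2 * N + 1), (symmDiffCoeff N i : ℂ) *
          ((a (x + (i - N : ℝ) • h) - a x) * (b (x + (i - N : ℝ) • h) - b x)) =
        (symmDiffCoeff N i : ℂ) * c (x + (i - N : ℝ) • h) -
        a x * ((symmDiffCoeff N i : ℂ) * b (x + (i - N : ℝ) • h)) -
        b x * ((symmDiffCoeff N i : ℂ) * a (x + (i - N : ℝ) • h)) +
        symmDiffCoeff N i * (a x * b x) := by
      intro i _; rw [hc]; ring
    rw [Finset.sum_congr rfl h1, Finset.sum_add_distrib, Finset.sum_sub_distrib,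
      Finset.sum_sub_distrib, ← Finset.sum_mul, sum_symmDiffCoeff hN, ← Finset.mul_sum,
      ← Finset.mul_sum]
    ring
  simp_rw [hpt]
  rw [integral_sub_sub c1 (b1.const_mul _) (a1.const_mul _), integral_const_mul, integral_const_mul, leibnizRemainder,
    ← hc, a2, b2, c2]
  ring

lemma enorm_ofReal_complex (r : ℝ) : ‖(r : ℂ)‖ₑ = ENNReal.ofReal |r| := by
  rw [← ofReal_norm, Complex.norm_real, Real.norm_eq_abs]

/-- The value of a bilinear form with a kernel of finite rank is bounded by its integral form. -/
lemma enorm_sum_mul_integral_le {m : ℕ} {ι : Type*} (s : Finset ι) (c : ι → ℝ)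
    (p q : ι → Euc m → ℝ) {A B : Euc m → ℂ}
    (hA : ∀ i ∈ s, Integrable fun z => (p i z : ℂ) * A z)
    (hB : ∀ i ∈ s, Integrable fun z => (q i z : ℂ) * B z) :
    ‖∑ i ∈ s, (c i : ℂ) * ((∫ z, (p i z : ℂ) * A z) * ∫ z, (q i z : ℂ) * B z)‖ₑ ≤
      ∫⁻ z₁, ∫⁻ z₂, ENNReal.ofReal |∑ i ∈ s, c i * (p i z₁ * q i z₂)| * (‖A z₁‖ₑ * ‖B z₂‖ₑ) := by
  have e1 : ∀ z₁, ∑ i ∈ s, (c i : ℂ) * (((p i z₁ : ℂ) * A z₁) * ∫ z, (q i z : ℂ) * B z) =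
      ∫ z₂, ((∑ i ∈ s, c i * (p i z₁ * q i z₂) : ℝ) : ℂ) * (A z₁ * B z₂) := by
    intro z₁
    have : ∀ z₂, ((∑ i ∈ s, c i * (p i z₁ * q i z₂) : ℝ) : ℂ) * (A z₁ * B z₂) =
        ∑ i ∈ s, (c i * ((p i z₁ : ℂ) * A z₁)) * ((q i z₂ : ℂ) * B z₂) := by
      intro z₂
      rw [Complex.ofReal_sum, Finset.sum_mul]
      refine Finset.sum_congr rfl fun i _ => ?_
      push_cast; ring
    simp_rw [this]
    rw [integral_finsetSum _ fun i hi => (hB i hi).const_mul _]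
    refine Finset.sum_congr rfl fun i _ => ?_
    rw [integral_const_mul]; ring
  have e2 : ∑ i ∈ s, (c i : ℂ) * ((∫ z, (p i z : ℂ) * A z) * ∫ z, (q i z : ℂ) * B z) =
      ∫ z₁, ∫ z₂, ((∑ i ∈ s, c i * (p i z₁ * q i z₂) : ℝ) : ℂ) * (A z₁ * B z₂) := by
    simp_rw [← e1]
    rw [integral_finsetSum _ fun i hi => ((hA i hi).mul_const _).const_mul _]
    refine Finset.sum_congr rfl fun i _ => ?_
    rw [integral_const_mul, integral_mul_const]
  rw [e2]
  refine (enorm_integral_le_lintegral_enorm _).trans (lintegral_mono fun z₁ => ?_)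
  refine (enorm_integral_le_lintegral_enorm _).trans (lintegral_mono fun z₂ => ?_)
  rw [enorm_mul, enorm_mul, enorm_ofReal_complex]

lemma measurable_enorm_fracLaplacian {m : ℕ} {p : ℝ} (hp : 0 ≤ p) (a : 𝓢(Euc m, ℂ)) :
    Measurable fun z => ‖fracLaplacian p a z‖ₑ :=
  (continuous_fracLaplacian hp a).enorm.measurable

/-- Differences of a Schwartz function through its fractional Laplacian. -/
lemma exists_sub_representation {m : ℕ} [NeZero m] {τ : ℝ} (hτ : 0 < τ) (hτm : τ < m) :
    ∃ c : ℝ, ∀ (a : 𝓢(Euc m, ℂ)) (x y : Euc m),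
      Integrable (fun z => ((‖y - z‖ ^ (τ - m) - ‖x - z‖ ^ (τ - m) : ℝ) : ℂ) *
        fracLaplacian τ a z) ∧
      a y - a x = c * ∫ z, ((‖y - z‖ ^ (τ - m) - ‖x - z‖ ^ (τ - m) : ℝ) : ℂ) *
        fracLaplacian τ a z := by
  obtain ⟨c, hc⟩ := exists_rieszPotential_representation (m := m) hτ hτm
  refine ⟨c, fun a x y => ?_⟩
  have h := fun z => (Complex.ofReal_sub (‖y - z‖ ^ (τ - m)) (‖x - z‖ ^ (τ - m)))
  simp_rw [h, sub_mul]
  refine ⟨(hc a y).1.sub (hc a x).1, ?_⟩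
  rw [integral_sub (hc a y).1 (hc a x).1, mul_sub, ← (hc a y).2, ← (hc a x).2]

/-- Absolute values are taken only after the sum over the shifts has been collected into one kernel;
summand by summand, the cancellation of order `2N` would be lost. -/
lemma exists_enorm_leibnizRemainder_le {m : ℕ} [NeZero m] {α τ₁ τ₂ δ : ℝ} (hα : 0 < α)
    (hτ₁m : τ₁ < m) (hτ₂m : τ₂ < m) (hτ₁α : τ₁ ≤ α) (hτ₂α : τ₂ ≤ α) (hδ : 0 < δ) (hδ₁ : δ < τ₁)
    (hδ₁' : δ ≤ 1 + τ₁ - α) (hδ₂ : δ < τ₂) (hδ₂' : δ ≤ 1 + τ₂ - α) (hδΘ : 2 * δ < τ₁ + τ₂ - α) :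
    ∃ C : ℝ≥0, ∀ (a b : 𝓢(Euc m, ℂ)) (x : Euc m), ‖leibnizRemainder α a b x‖ₑ ≤
      C * potentialSum δ (τ₁ + τ₂ - α) (fun z => ‖fracLaplacian τ₁ a z‖ₑ)
        (fun z => ‖fracLaplacian τ₂ b z‖ₑ) x := by
  obtain ⟨N, hN⟩ := exists_nat_gt α
  have hN0 : 0 < N := by
    have : (0 : ℝ) < N := hα.trans hN
    exact_mod_cast this
  have hαN : α < 2 * N := by linarith
  have hτ₁ := hδ.trans hδ₁
  have hτ₂ := hδ.trans hδ₂
  obtain ⟨κ, hκ⟩ := exists_leibnizRemainder_representation (m := m) hN0 hα hαN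
  obtain ⟨c₁, hc₁⟩ := exists_sub_representation (m := m) hτ₁ hτ₁m
  obtain ⟨c₂, hc₂⟩ := exists_sub_representation (m := m) hτ₂ hτ₂m
  obtain ⟨C, hC, hker⟩ := exists_leibnizKernel_le (m := m) hN0 hα hαN hτ₁m hτ₂m hτ₁α hτ₂α hδ hδ₁
    hδ₁' hδ₂ hδ₂'
  obtain ⟨C', hC'⟩ := exists_lintegral_kernel_le (m := m) hδ hδΘ (by linarith) C
  refine ⟨‖(κ * (c₁ * c₂) : ℂ)‖₊ * C', fun a b x => ?_⟩
  set A := fracLaplacian τ₁ a with hA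
  set B := fracLaplacian τ₂ b with hB
  have mA := measurable_enorm_fracLaplacian hτ₁.le a
  have mB := measurable_enorm_fracLaplacian hτ₂.le b
  set S : Euc m → Euc m → Euc m → ℝ := fun h z₁ z₂ => ∑ i ∈ Finset.range (2 * N + 1),
    symmDiffCoeff N i * ((‖x + (i - N : ℝ) • h - z₁‖ ^ (τ₁ - m) - ‖x - z₁‖ ^ (τ₁ - m)) *
      (‖x + (i - N : ℝ) • h - z₂‖ ^ (τ₂ - m) - ‖x - z₂‖ ^ (τ₂ - m))) with hS
  have hstep : ∀ h : Euc m, ‖((‖h‖ ^ (-α - m) : ℝ) : ℂ) * ∑ i ∈ Finset.range (2 * N + 1),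
        (symmDiffCoeff N i : ℂ) *
          ((a (x + (i - N : ℝ) • h) - a x) * (b (x + (i - N : ℝ) • h) - b x))‖ₑ ≤
      ‖(c₁ * c₂ : ℂ)‖ₑ * ∫⁻ z₁, ∫⁻ z₂,
        ENNReal.ofReal (|S h z₁ z₂| * ‖h‖ ^ (-α - m)) * (‖A z₁‖ₑ * ‖B z₂‖ₑ) := by
    intro h
    have e1 : ∑ i ∈ Finset.range (2 * N + 1), (symmDiffCoeff N i : ℂ) *
          ((a (x + (i - N : ℝ) • h) - a x) * (b (x + (i - N : ℝ) • h) - b x)) =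
        (c₁ * c₂) * ∑ i ∈ Finset.range (2 * N + 1), (symmDiffCoeff N i : ℂ) *
          ((∫ z, ((‖x + (i - N : ℝ) • h - z‖ ^ (τ₁ - m) - ‖x - z‖ ^ (τ₁ - m) : ℝ) : ℂ) * A z) *
          ∫ z, ((‖x + (i - N : ℝ) • h - z‖ ^ (τ₂ - m) - ‖x - z‖ ^ (τ₂ - m) : ℝ) : ℂ) * B z) := by
      rw [Finset.mul_sum]
      refine Finset.sum_congr rfl fun i _ => ?_
      rw [(hc₁ a x _).2, (hc₂ b x _).2]; ring
    rw [e1, mul_left_comm, enorm_mul, enorm_mul ((‖h‖ ^ (-α - m) : ℝ) : ℂ), enorm_ofReal_complex,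
      abs_of_nonneg (by positivity)]
    refine mul_le_mul_right ?_ _
    refine (mul_le_mul_right (enorm_sum_mul_integral_le _ _ _ _ (fun i _ => (hc₁ a x _).1)
      (fun i _ => (hc₂ b x _).1)) _).trans (le_of_eq ?_)
    rw [← lintegral_const_mul' _ _ ENNReal.ofReal_ne_top]
    refine lintegral_congr fun z₁ => ?_
    rw [← lintegral_const_mul' _ _ ENNReal.ofReal_ne_top]
    refine lintegral_congr fun z₂ => ?_
    rw [← mul_assoc, ← ENNReal.ofReal_mul (by positivity), mul_comm (‖h‖ ^ _)]
  set F : Euc m × Euc m × Euc m → ℝ≥0∞ := fun q =>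
    ENNReal.ofReal (|S q.1 q.2.1 q.2.2| * ‖q.1‖ ^ (-α - m)) * (‖A q.2.1‖ₑ * ‖B q.2.2‖ₑ) with hF
  have hSm : Measurable fun q : Euc m × Euc m × Euc m => |S q.1 q.2.1 q.2.2| := by
    refine Measurable.abs (Finset.measurable_fun_sum _ fun i _ => ?_)
    fun_prop
  have hFm : Measurable F := by
    have m1 : Measurable fun q : Euc m × Euc m × Euc m => ‖A q.2.1‖ₑ := mA.comp (by fun_prop)
    have m2 : Measurable fun q : Euc m × Euc m × Euc m => ‖B q.2.2‖ₑ := mB.comp (by fun_prop)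
    exact (Measurable.ennreal_ofReal (hSm.mul (by fun_prop))).mul (m1.mul m2)
  rw [hκ a b x, enorm_mul]
  calc ‖(κ : ℂ)‖ₑ * ‖∫ h : Euc m, ((‖h‖ ^ (-α - m) : ℝ) : ℂ) * ∑ i ∈ Finset.range (2 * N + 1),
        (symmDiffCoeff N i : ℂ) *
          ((a (x + (i - N : ℝ) • h) - a x) * (b (x + (i - N : ℝ) • h) - b x))‖ₑ
      ≤ ‖(κ : ℂ)‖ₑ * ∫⁻ h, ‖(c₁ * c₂ : ℂ)‖ₑ * ∫⁻ z₁, ∫⁻ z₂, F (h, z₁, z₂) :=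
        mul_le_mul_right ((enorm_integral_le_lintegral_enorm _).trans (lintegral_mono hstep)) _
    _ = ‖(κ * (c₁ * c₂) : ℂ)‖ₑ * ∫⁻ z₁, ∫⁻ z₂, ∫⁻ h, F (h, z₁, z₂) := by
        rw [lintegral_const_mul' _ _ enorm_ne_top, lintegral_rotate hFm, ← mul_assoc, ← enorm_mul]
    _ = ‖(κ * (c₁ * c₂) : ℂ)‖ₑ * ∫⁻ z₁, ∫⁻ z₂,
          (∫⁻ h : Euc m, ENNReal.ofReal (|S h z₁ z₂| * ‖h‖ ^ (-α - m))) *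
            (‖A z₁‖ₑ * ‖B z₂‖ₑ) := by
        congr 1
        refine lintegral_congr fun z₁ => lintegral_congr fun z₂ => ?_
        simp only [hF]
        rw [lintegral_mul_const']
        exact ENNReal.mul_ne_top enorm_ne_top enorm_ne_top
    _ ≤ ‖(κ * (c₁ * c₂) : ℂ)‖ₑ * (C' * potentialSum δ (τ₁ + τ₂ - α) (fun z => ‖A z‖ₑ)
          (fun z => ‖B z‖ₑ) x) := by
        refine mul_le_mul_right (hC' x _ (fun z₁ z₂ h₁ h₂ _ => ?_) _ _ mA mB) _
        refine le_trans (le_of_eq ?_) (hker x z₁ z₂ h₁ h₂)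
        simp only [hS, sub_add_eq_add_sub]
    _ = _ := by rw [ENNReal.coe_mul, mul_assoc]; rfl

/-! ### Pointwise bounds for the commutators -/

lemma closedMajorant_comm (m : ℕ) (δ Θ r₁ r₂ d : ℝ) :
    closedMajorant m δ Θ r₁ r₂ d = closedMajorant m δ Θ r₂ r₁ d := by
  rw [closedMajorant, closedMajorant, min_comm, max_comm]

lemma exists_lintegral_closedMajorant_le {m : ℕ} [NeZero m] {δ Θ : ℝ} (hδ : 0 < δ)
    (hδΘ : 2 * δ < Θ) (hΘm : Θ < m) {C : ℝ} (hC : 0 ≤ C) :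
    ∃ C' : ℝ≥0, ∀ (x : Euc m) (k : Euc m → Euc m → ℝ≥0∞),
      (∀ z₁ z₂, z₁ ≠ x → z₂ ≠ x → z₁ ≠ z₂ → k z₁ z₂ ≤
        ENNReal.ofReal (C * closedMajorant m δ Θ ‖x - z₁‖ ‖x - z₂‖ ‖z₁ - z₂‖)) →
      ∀ f g : Euc m → ℝ≥0∞, Measurable f → Measurable g →
        ∫⁻ z₁, ∫⁻ z₂, k z₁ z₂ * (f z₁ * g z₂) ≤ C' * potentialSum δ Θ f g x := by
  obtain ⟨C₁, hC₁, h₁⟩ := exists_closedMajorant_le (m := m) (δ := δ) (Θ := Θ) (by linarith)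
    (by linarith)
  obtain ⟨C', h'⟩ := exists_lintegral_kernel_le (m := m) hδ hδΘ hΘm (C * C₁)
  refine ⟨C', fun x k hk f g hf hg => h' x k (fun z₁ z₂ e₁ e₂ e₁₂ => ?_) f g hf hg⟩
  refine (hk z₁ z₂ e₁ e₂ e₁₂).trans ?_
  rw [ENNReal.ofReal_mul hC, ENNReal.ofReal_mul hC, mul_assoc]
  exact mul_le_mul_right (h₁ x z₁ z₂ e₁₂) _

lemma enorm_integral_mul_le {m : ℕ} (p : Euc m → ℝ) (A : Euc m → ℂ) :
    ‖∫ z, (p z : ℂ) * A z‖ₑ ≤ ∫⁻ z, ENNReal.ofReal |p z| * ‖A z‖ₑ := by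
  refine (enorm_integral_le_lintegral_enorm _).trans (le_of_eq (lintegral_congr fun z => ?_))
  rw [enorm_mul, enorm_ofReal_complex]

lemma exists_enorm_commutator_le_lintegral {m : ℕ} [NeZero m] {α β τ : ℝ} (hα : 0 ≤ α)
    (hβ : 0 < β) (hβ1 : β < 1) (hτ : 0 < τ) (hτm : τ < m) :
    ∃ C : ℝ≥0, ∀ (a b : 𝓢(Euc m, ℂ)) (x : Euc m),
      ‖a x * fracLaplacian (α + β) b x - fracLaplacian β (fun y => a y * fracLaplacian α b y) x‖ₑ ≤
      C * ∫⁻ z₁, ∫⁻ z₂, ENNReal.ofReal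
        (|‖x - z₂‖ ^ (τ - m) - ‖z₁ - z₂‖ ^ (τ - m)| * ‖x - z₁‖ ^ (-β - m)) *
          (‖fracLaplacian α b z₁‖ₑ * ‖fracLaplacian τ a z₂‖ₑ) := by
  obtain ⟨κ, hκ⟩ := exists_commutator_representation (m := m) hα hβ hβ1
  obtain ⟨c, hc⟩ := exists_sub_representation (m := m) hτ hτm
  refine ⟨‖(κ * c : ℂ)‖₊, fun a b x => ?_⟩
  set A := fracLaplacian τ a
  set u := fracLaplacian α b
  rw [(hκ a b x).2, enorm_mul]
  calc ‖(κ : ℂ)‖ₑ * ‖∫ h : Euc m, ((‖h‖ ^ (-β - m) : ℝ) : ℂ) * ((a (x + h) - a x) * u (x + h))‖ₑ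
      ≤ ‖(κ : ℂ)‖ₑ * ∫⁻ h : Euc m, ‖((‖x + h - x‖ ^ (-β - m) : ℝ) : ℂ) *
          ((a (x + h) - a x) * u (x + h))‖ₑ := by
        refine mul_le_mul_right ((enorm_integral_le_lintegral_enorm _).trans (le_of_eq ?_)) _
        simp_rw [add_sub_cancel_left]
    _ = ‖(κ : ℂ)‖ₑ * ∫⁻ y : Euc m, ‖((‖y - x‖ ^ (-β - m) : ℝ) : ℂ) * ((a y - a x) * u y)‖ₑ := by
        rw [lintegral_add_left_eq_self (fun y : Euc m =>
          ‖((‖y - x‖ ^ (-β - m) : ℝ) : ℂ) * ((a y - a x) * u y)‖ₑ) x]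
    _ ≤ ‖(κ : ℂ)‖ₑ * ∫⁻ z₁, ‖(c : ℂ)‖ₑ * ∫⁻ z₂, ENNReal.ofReal
        (|‖x - z₂‖ ^ (τ - m) - ‖z₁ - z₂‖ ^ (τ - m)| * ‖x - z₁‖ ^ (-β - m)) *
          (‖u z₁‖ₑ * ‖A z₂‖ₑ) := by
        refine mul_le_mul_right (lintegral_mono fun y => ?_) _
        rw [(hc a x y).2, enorm_mul, enorm_mul, enorm_mul, enorm_ofReal_complex,
          abs_of_nonneg (by positivity)]
        calc ENNReal.ofReal (‖y - x‖ ^ (-β - m)) * (‖(c : ℂ)‖ₑ *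
              ‖∫ z, ((‖y - z‖ ^ (τ - m) - ‖x - z‖ ^ (τ - m) : ℝ) : ℂ) * A z‖ₑ * ‖u y‖ₑ)
            = ‖(c : ℂ)‖ₑ * (ENNReal.ofReal (‖y - x‖ ^ (-β - m)) * ‖u y‖ₑ *
              ‖∫ z, ((‖y - z‖ ^ (τ - m) - ‖x - z‖ ^ (τ - m) : ℝ) : ℂ) * A z‖ₑ) := by ring
          _ ≤ ‖(c : ℂ)‖ₑ * (ENNReal.ofReal (‖y - x‖ ^ (-β - m)) * ‖u y‖ₑ *
              ∫⁻ z, ENNReal.ofReal |‖y - z‖ ^ (τ - m) - ‖x - z‖ ^ (τ - m)| * ‖A z‖ₑ) :=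
              mul_le_mul_right (mul_le_mul_right (enorm_integral_mul_le _ _) _) _
          _ = _ := by
              rw [← lintegral_const_mul' _ _ (ENNReal.mul_ne_top ENNReal.ofReal_ne_top
                enorm_ne_top)]
              congr 1
              refine lintegral_congr fun z => ?_
              rw [ENNReal.ofReal_mul (abs_nonneg _), abs_sub_comm, norm_sub_rev y x]
              ring
    _ = _ := by
        rw [lintegral_const_mul' _ _ enorm_ne_top, ← mul_assoc, ← enorm_mul]; rfl

lemma exists_enorm_commutator_le {m : ℕ} [NeZero m] {α β τ δ : ℝ} (hα : 0 ≤ α)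
    (hβ : 0 < β) (hτm : τ < m) (hδ : 0 < δ) (hδβ : δ ≤ 1 - β) (hδΘ : 2 * δ < τ - β) :
    ∃ C : ℝ≥0, ∀ (a b : 𝓢(Euc m, ℂ)) (x : Euc m),
      ‖a x * fracLaplacian (α + β) b x - fracLaplacian β (fun y => a y * fracLaplacian α b y) x‖ₑ ≤
      C * potentialSum δ (τ - β) (fun z => ‖fracLaplacian α b z‖ₑ)
        (fun z => ‖fracLaplacian τ a z‖ₑ) x := by
  obtain ⟨C₁, h₁⟩ := exists_enorm_commutator_le_lintegral (m := m) hα hβ (by linarith)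
    (by linarith : 0 < τ) hτm
  obtain ⟨C₂, hC₂, h₂⟩ := exists_commutatorKernel_le (m := m) hβ hτm hδβ (by linarith) hδ
  obtain ⟨C₃, h₃⟩ := exists_lintegral_closedMajorant_le (m := m) hδ hδΘ (by linarith) hC₂.le
  refine ⟨C₁ * C₃, fun a b x => (h₁ a b x).trans ?_⟩
  rw [ENNReal.coe_mul, mul_assoc]
  refine mul_le_mul_right (h₃ x _ (fun z₁ z₂ e₁ e₂ e₁₂ => ?_) _ _
    (measurable_enorm_fracLaplacian hα b) (measurable_enorm_fracLaplacian (by linarith) a)) _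
  exact ENNReal.ofReal_le_ofReal (h₂ x z₁ z₂ e₁ e₂ e₁₂)

/-- The last summand of `potentialSum` is not symmetric in `f` and `g`, so exchanging them is not a
formality. It works because `closedMajorant` is symmetric. -/
lemma exists_enorm_commutator_le_swap {m : ℕ} [NeZero m] {α β τ δ : ℝ} (hα : 0 ≤ α)
    (hβ : 0 < β) (hτm : τ < m) (hδ : 0 < δ) (hδβ : δ ≤ 1 - β) (hδΘ : 2 * δ < τ - β) :
    ∃ C : ℝ≥0, ∀ (a b : 𝓢(Euc m, ℂ)) (x : Euc m),
      ‖a x * fracLaplacian (α + β) b x - fracLaplacian β (fun y => a y * fracLaplacian α b y) x‖ₑ ≤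
      C * potentialSum δ (τ - β) (fun z => ‖fracLaplacian τ a z‖ₑ)
        (fun z => ‖fracLaplacian α b z‖ₑ) x := by
  obtain ⟨C₁, h₁⟩ := exists_enorm_commutator_le_lintegral (m := m) hα hβ (by linarith)
    (by linarith : 0 < τ) hτm
  obtain ⟨C₂, hC₂, h₂⟩ := exists_commutatorKernel_le (m := m) hβ hτm hδβ (by linarith) hδ
  obtain ⟨C₃, h₃⟩ := exists_lintegral_closedMajorant_le (m := m) hδ hδΘ (by linarith) hC₂.le
  refine ⟨C₁ * C₃, fun a b x => (h₁ a b x).trans ?_⟩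
  have mA := measurable_enorm_fracLaplacian (by linarith : 0 ≤ τ) a
  have mu := measurable_enorm_fracLaplacian hα b
  have mk : Measurable fun q : Euc m × Euc m => ENNReal.ofReal
      (|‖x - q.2‖ ^ (τ - m) - ‖q.1 - q.2‖ ^ (τ - m)| * ‖x - q.1‖ ^ (-β - m)) := by
    refine ((Measurable.abs ?_).mul ?_).ennreal_ofReal <;> fun_prop
  rw [ENNReal.coe_mul, mul_assoc, lintegral_lintegral_swap (mk.mul
      ((mu.comp measurable_fst).mul (mA.comp measurable_snd))).aemeasurable]
  refine mul_le_mul_right (le_trans (le_of_eq ?_) (h₃ x (fun z₁ z₂ => ENNReal.ofReal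
    (|‖x - z₁‖ ^ (τ - m) - ‖z₂ - z₁‖ ^ (τ - m)| * ‖x - z₂‖ ^ (-β - m)))
    (fun z₁ z₂ e₁ e₂ e₁₂ => ?_) _ _ mA mu)) _
  · refine lintegral_congr fun z₁ => lintegral_congr fun z₂ => ?_
    rw [mul_comm ‖fracLaplacian α b z₂‖ₑ]
  · rw [closedMajorant_comm, norm_sub_rev z₁ z₂]
    exact ENNReal.ofReal_le_ofReal (h₂ x z₂ z₁ e₂ e₁ e₁₂.symm)

/-- Absolute convergence of the first difference integral, uniformly in `x`. It supplies the joint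
integrability for the integration by parts in `exists_enorm_commutator_le_of_lt`. -/
lemma exists_lintegral_difference_le {m : ℕ} [NeZero m] {θ : ℝ} (hθ : 0 < θ) (hθ1 : θ < 1)
    {g : Euc m → ℂ} (hg : Integrable g) (hgθ : Integrable fun ξ => ‖ξ‖ ^ θ * ‖g ξ‖) :
    ∃ C : ℝ≥0, ∀ x, ∫⁻ h : Euc m, ENNReal.ofReal (‖h‖ ^ (-θ - m)) *
      ‖𝓕⁻ g (x + h) - 𝓕⁻ g x‖ₑ ≤ C := by
  obtain ⟨c, hc, hG⟩ := exists_lintegral_cosWeight_eq (m := m) (ν := 1 / 2) (by norm_num) hθ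
    (by linarith)
  refine ⟨Real.toNNReal (∫ ξ, c * (2 * Real.pi) ^ θ * (‖ξ‖ ^ θ * ‖g ξ‖)), fun x => ?_⟩
  have h1 : ∀ h, ‖𝓕⁻ g (x + h) - 𝓕⁻ g x‖ₑ ≤ ∫⁻ ξ, ENNReal.ofReal
      ((2 - 2 * Real.cos (2 * Real.pi * inner ℝ ξ h)) ^ (1 / 2 : ℝ)) * ‖g ξ‖ₑ := by
    intro h
    rw [fourierInv_eq_exp, fourierInv_eq_exp,
      ← integral_sub (integrable_exp_mul hg _ _) (integrable_exp_mul hg _ _)]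
    refine (enorm_integral_le_lintegral_enorm _).trans (le_of_eq (lintegral_congr fun ξ => ?_))
    have : Complex.exp ((2 * Real.pi * inner ℝ ξ (x + h) : ℝ) * Complex.I) * g ξ -
        Complex.exp ((2 * Real.pi * inner ℝ ξ x : ℝ) * Complex.I) * g ξ =
        -Complex.exp ((2 * Real.pi * inner ℝ ξ x : ℝ) * Complex.I) *
          (1 - Complex.exp ((2 * Real.pi * inner ℝ ξ h : ℝ) * Complex.I)) * g ξ := by
      have : Complex.exp ((2 * Real.pi * inner ℝ ξ (x + h) : ℝ) * Complex.I) =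
          Complex.exp ((2 * Real.pi * inner ℝ ξ x : ℝ) * Complex.I) *
            Complex.exp ((2 * Real.pi * inner ℝ ξ h : ℝ) * Complex.I) := by
        rw [← Complex.exp_add, inner_add_right]
        congr 1; push_cast; ring
      rw [this]; ring
    rw [this, ← ofReal_norm, ← ofReal_norm, norm_mul, norm_mul, norm_neg,
      Complex.norm_exp_ofReal_mul_I, one_mul, norm_one_sub_exp_eq,
      ENNReal.ofReal_mul (Real.rpow_nonneg (two_sub_two_cos_nonneg _) _)]
  have hgm : AEMeasurable fun q : Euc m × Euc m => ‖g q.2‖ₑ := by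
    exact hg.aestronglyMeasurable.enorm.comp_snd
  calc ∫⁻ h : Euc m, ENNReal.ofReal (‖h‖ ^ (-θ - m)) * ‖𝓕⁻ g (x + h) - 𝓕⁻ g x‖ₑ
      ≤ ∫⁻ h : Euc m, ∫⁻ ξ, ENNReal.ofReal
          ((2 - 2 * Real.cos (2 * Real.pi * inner ℝ ξ h)) ^ (1 / 2 : ℝ) * ‖h‖ ^ (-θ - m)) *
            ‖g ξ‖ₑ := by
        refine lintegral_mono fun h => (mul_le_mul_right (h1 h) _).trans (le_of_eq ?_)
        rw [← lintegral_const_mul' _ _ ENNReal.ofReal_ne_top]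
        refine lintegral_congr fun ξ => ?_
        rw [ENNReal.ofReal_mul (Real.rpow_nonneg (two_sub_two_cos_nonneg _) _)]
        ring
    _ = ∫⁻ ξ, ∫⁻ h : Euc m, ENNReal.ofReal
          ((2 - 2 * Real.cos (2 * Real.pi * inner ℝ ξ h)) ^ (1 / 2 : ℝ) * ‖h‖ ^ (-θ - m)) *
            ‖g ξ‖ₑ := by
        refine lintegral_lintegral_swap ?_
        exact (Measurable.aemeasurable (by fun_prop)).mul hgm
    _ = ∫⁻ ξ, ENNReal.ofReal (c * (2 * Real.pi) ^ θ * (‖ξ‖ ^ θ * ‖g ξ‖)) := by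
        refine lintegral_congr fun ξ => ?_
        rw [lintegral_mul_const' _ _ enorm_ne_top, hG ξ, ← ofReal_norm,
          ← ENNReal.ofReal_mul (by positivity), Real.mul_rpow (by positivity) (norm_nonneg _)]
        congr 1; ring
    _ = _ := by
        rw [← ofReal_integral_eq_lintegral_ofReal (hgθ.const_mul _)
          (Filter.Eventually.of_forall fun ξ => by positivity)]
        rfl

/-- Integration by parts for the quadratic form of a symmetric kernel. -/
lemma enorm_integral_mul_sub_le {X : Type*} [MeasurableSpace X] {μ : Measure X} [SFinite μ]
    {w : X × X → ℝ} {Φ B : X → ℂ} (hw : Measurable w) (hws : ∀ y y', w (y', y) = w (y, y'))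
    (hΦ : Measurable Φ) (hB : Measurable B)
    (hint : Integrable (fun q : X × X => (w q : ℂ) * (Φ q.1 * (B q.1 - B q.2))) (μ.prod μ)) :
    ‖∫ y, ∫ y', (w (y, y') : ℂ) * (Φ y * (B y - B y')) ∂μ ∂μ‖ₑ ≤
      ∫⁻ y, ∫⁻ y', ENNReal.ofReal |w (y, y')| * (‖Φ y - Φ y'‖ₑ * ‖B y'‖ₑ) ∂μ ∂μ := by
  set F₁ : X × X → ℂ := fun q => (w q : ℂ) * ((Φ q.1 - Φ q.2) * B q.2) with hF₁
  have hF₁m : Measurable F₁ := by fun_prop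
  have hn : ∀ q, ‖F₁ q‖ₑ = ENNReal.ofReal |w q| * (‖Φ q.1 - Φ q.2‖ₑ * ‖B q.2‖ₑ) := by
    intro q; rw [hF₁, enorm_mul, enorm_mul, enorm_ofReal_complex]
  have hrhs : ∫⁻ y, ∫⁻ y', ENNReal.ofReal |w (y, y')| * (‖Φ y - Φ y'‖ₑ * ‖B y'‖ₑ) ∂μ ∂μ =
      ∫⁻ q, ‖F₁ q‖ₑ ∂(μ.prod μ) := by
    rw [lintegral_prod _ hF₁m.enorm.aemeasurable]
    simp_rw [hn]
  rw [hrhs]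
  rcases eq_or_ne (∫⁻ q, ‖F₁ q‖ₑ ∂(μ.prod μ)) ⊤ with htop | htop
  · rw [htop]; exact le_top
  have hF₁i : Integrable F₁ (μ.prod μ) := ⟨hF₁m.aestronglyMeasurable, htop.lt_top⟩
  -- The two integrands add up to `w(y,y') (Φ(y)B(y) - Φ(y')B(y'))`, which is antisymmetric under
  -- exchanging `y` and `y'`.
  have hanti : ∫ q, ((w q : ℂ) * (Φ q.1 * (B q.1 - B q.2)) + F₁ q) ∂(μ.prod μ) = 0 := by
    have h1 := integral_prod_swap (μ := μ) (ν := μ)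
      (fun q : X × X => (w q : ℂ) * (Φ q.1 * (B q.1 - B q.2)) + F₁ q)
    have h2 : ∀ q : X × X, (w q.swap : ℂ) * (Φ q.swap.1 * (B q.swap.1 - B q.swap.2)) + F₁ q.swap =
        -((w q : ℂ) * (Φ q.1 * (B q.1 - B q.2)) + F₁ q) := by
      rintro ⟨y, y'⟩
      simp only [hF₁, Prod.swap_prod_mk]
      rw [hws]; ring
    simp_rw [h2] at h1
    rw [integral_neg] at h1
    exact self_eq_neg.1 h1.symm
  rw [integral_add hint hF₁i] at hanti
  rw [integral_integral hint, eq_neg_of_add_eq_zero_left hanti, enorm_neg]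
  exact enorm_integral_le_lintegral_enorm _

lemma exists_fracLaplacian_representation {m : ℕ} [NeZero m] {τ σ : ℝ} (hτ : 0 ≤ τ) (hσ : 0 < σ)
    (hσ1 : σ < 1) :
    ∃ κ : ℝ, ∀ (b : 𝓢(Euc m, ℂ)) (y : Euc m), fracLaplacian (τ + σ) b y =
      κ * ∫ y', ((‖y' - y‖ ^ (-σ - m) : ℝ) : ℂ) * (fracLaplacian τ b y - fracLaplacian τ b y') := by
  obtain ⟨κ, hκ⟩ := exists_difference_representation (m := m) hσ hσ1
  refine ⟨κ, fun b y => ?_⟩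
  have h := (hκ _ (integrable_symbol_mul_schwartz hτ (𝓕 b : 𝓢(Euc m, ℂ)))
    (integrable_norm_rpow_mul_symbol hτ hσ.le (𝓕 b : 𝓢(Euc m, ℂ))) y).2
  rw [← fracLaplacian_schwartz] at h
  have hu : fracLaplacian (τ + σ) b = 𝓕⁻ (fun ξ : Euc m => (((2 * Real.pi * ‖ξ‖) ^ σ : ℝ) : ℂ) *
      ((((2 * Real.pi * ‖ξ‖) ^ τ : ℝ) : ℂ) * (𝓕 b : 𝓢(Euc m, ℂ)) ξ)) := by
    rw [fracLaplacian_schwartz]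
    congr 1; ext ξ
    rw [Real.rpow_add_of_nonneg (by positivity) hτ hσ.le]
    push_cast; ring
  rw [hu, h, ← integral_add_left_eq_self (fun y' : Euc m => ((‖y' - y‖ ^ (-σ - m) : ℝ) : ℂ) *
    (fracLaplacian τ b y - fracLaplacian τ b y')) y]
  simp_rw [add_sub_cancel_left]

/-- With `Φ(y) = ‖y - x‖^(-β-m) (a(y) - a(x))` the commutator is a multiple of `∫ Φ (-Δ)^(α/2) b`.
Write `(-Δ)^(α/2) b` as the first difference integral of order `σ = α - τ` of `(-Δ)^(τ/2) b` and
shift the difference onto `Φ`. Inserting the Riesz representation of the increments of `a` yields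
the double commutator kernel. -/
lemma exists_enorm_commutator_le_of_lt {m : ℕ} [NeZero m] {α β τ δ : ℝ} (hαm : α < m)
    (hβ : 0 < β) (hτα : τ < α) (hδ : 0 < δ) (hδ₁ : β + (α - τ) + δ ≤ 1) (hδΘ : 2 * δ < τ - β) :
    ∃ C : ℝ≥0, ∀ (a b : 𝓢(Euc m, ℂ)) (x : Euc m),
      ‖a x * fracLaplacian (α + β) b x - fracLaplacian β (fun y => a y * fracLaplacian α b y) x‖ₑ ≤
      C * potentialSum δ (τ - β) (fun z => ‖fracLaplacian α a z‖ₑ)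
        (fun z => ‖fracLaplacian τ b z‖ₑ) x := by
  have hτ : 0 < τ := by linarith
  have hα : 0 < α := hτ.trans hτα
  have hβ1 : β < 1 := by linarith
  set σ := α - τ with hσdef
  have hσ : 0 < σ := by linarith
  have hσ1 : σ < 1 := by linarith
  obtain ⟨κ, hκ⟩ := exists_commutator_representation (m := m) hα.le hβ hβ1
  obtain ⟨κ', hκ'⟩ := exists_fracLaplacian_representation (m := m) hτ.le hσ hσ1
  rw [show τ + σ = α by rw [hσdef]; ring] at hκ'
  obtain ⟨c, hc⟩ := exists_sub_representation (m := m) hα hαm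
  obtain ⟨C₂, hC₂, h₂⟩ := exists_doubleCommutatorKernel_le (m := m) hαm hβ hσ hδ hδ₁ (by linarith)
  rw [show α - σ - β = τ - β by rw [hσdef]; ring] at h₂
  obtain ⟨C₃, h₃⟩ := exists_lintegral_closedMajorant_le (m := m) hδ hδΘ (by linarith) hC₂.le
  refine ⟨‖(κ * κ' * c : ℂ)‖₊ * C₃, fun a b x => ?_⟩
  set A := fracLaplacian α a with hA
  set B := fracLaplacian τ b with hB
  set Φ : Euc m → ℂ := fun y => ((‖y - x‖ ^ (-β - m) : ℝ) : ℂ) * (a y - a x) with hΦ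
  set w : Euc m × Euc m → ℝ := fun q => ‖q.2 - q.1‖ ^ (-σ - m) with hw
  have hac : Continuous a := a.continuous
  have hBc : Continuous B := continuous_fracLaplacian hτ.le b
  have hwm : Measurable w := by fun_prop
  have hΦm : Measurable Φ := by fun_prop
  have mA := measurable_enorm_fracLaplacian hα.le a
  have mB := measurable_enorm_fracLaplacian hτ.le b
  have hX : a x * fracLaplacian (α + β) b x -
      fracLaplacian β (fun y => a y * fracLaplacian α b y) x =
      κ * κ' * ∫ y, ∫ y', (w (y, y') : ℂ) * (Φ y * (B y - B y')) := by
    have e1 : ∫ h : Euc m, ((‖h‖ ^ (-β - m) : ℝ) : ℂ) *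
        ((a (x + h) - a x) * fracLaplacian α b (x + h)) = ∫ y, Φ y * fracLaplacian α b y := by
      rw [← integral_add_left_eq_self (fun y => Φ y * fracLaplacian α b y) x]
      simp_rw [hΦ, add_sub_cancel_left, mul_assoc]
    rw [(hκ a b x).2, e1, mul_assoc, ← integral_const_mul (κ' : ℂ)]
    congr 1
    refine integral_congr_ae (Filter.Eventually.of_forall fun y => ?_)
    simp only
    rw [hκ' b y, mul_left_comm, ← integral_const_mul (Φ y)]
    congr 1
    refine integral_congr_ae (Filter.Eventually.of_forall fun y' => ?_)
    simp only [hw]; ring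
  -- joint integrability
  obtain ⟨Ca, hCa⟩ := exists_lintegral_difference_le hβ hβ1 (𝓕 a : 𝓢(Euc m, ℂ)).integrable
    (integrable_norm_rpow_mul_schwartz hβ.le _)
  rw [fourierInv_fourier_schwartz] at hCa
  obtain ⟨Cb, hCb⟩ := exists_lintegral_difference_le hσ hσ1
    (integrable_symbol_mul_schwartz hτ.le (𝓕 b : 𝓢(Euc m, ℂ)))
    (integrable_norm_rpow_mul_symbol hτ.le hσ.le (𝓕 b : 𝓢(Euc m, ℂ)))
  rw [← fracLaplacian_schwartz] at hCb
  have hΦ1 : ∫⁻ y, ‖Φ y‖ₑ ≤ Ca := by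
    rw [← lintegral_add_left_eq_self (fun y => ‖Φ y‖ₑ) x]
    refine le_trans (le_of_eq (lintegral_congr fun h => ?_)) (hCa x)
    rw [hΦ, enorm_mul, enorm_ofReal_complex, add_sub_cancel_left, abs_of_nonneg (by positivity)]
  have hB1 : ∀ y, ∫⁻ y', ENNReal.ofReal (w (y, y')) * ‖B y - B y'‖ₑ ≤ Cb := by
    intro y
    rw [← lintegral_add_left_eq_self (fun y' => ENNReal.ofReal (w (y, y')) * ‖B y - B y'‖ₑ) y]
    refine le_trans (le_of_eq (lintegral_congr fun h => ?_)) (hCb y)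
    simp only [hw]
    rw [add_sub_cancel_left, enorm_sub_rev]
  have hint : Integrable (fun q : Euc m × Euc m => (w q : ℂ) * (Φ q.1 * (B q.1 - B q.2)))
      ((volume : Measure (Euc m)).prod volume) := by
    have hm : Measurable fun q : Euc m × Euc m => (w q : ℂ) * (Φ q.1 * (B q.1 - B q.2)) := by
      have := hBc.measurable
      fun_prop
    refine ⟨hm.aestronglyMeasurable, ?_⟩
    rw [HasFiniteIntegral, lintegral_prod _ hm.enorm.aemeasurable]
    calc ∫⁻ y, ∫⁻ y', ‖(w (y, y') : ℂ) * (Φ y * (B y - B y'))‖ₑ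
        = ∫⁻ y, ‖Φ y‖ₑ * ∫⁻ y', ENNReal.ofReal (w (y, y')) * ‖B y - B y'‖ₑ := by
          refine lintegral_congr fun y => ?_
          rw [← lintegral_const_mul' _ _ enorm_ne_top]
          refine lintegral_congr fun y' => ?_
          rw [enorm_mul, enorm_mul, enorm_ofReal_complex, abs_of_nonneg (by positivity)]
          ring
      _ ≤ ∫⁻ y, ‖Φ y‖ₑ * Cb := lintegral_mono fun y => mul_le_mul_right (hB1 y) _
      _ = (∫⁻ y, ‖Φ y‖ₑ) * Cb := lintegral_mul_const' _ _ ENNReal.coe_ne_top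
      _ ≤ Ca * Cb := mul_le_mul_left hΦ1 _
      _ < ⊤ := ENNReal.mul_lt_top ENNReal.coe_lt_top ENNReal.coe_lt_top
  have hparts := enorm_integral_mul_sub_le hwm (fun y y' => by simp only [hw]; rw [norm_sub_rev])
    hΦm hBc.measurable hint
  set k : Euc m → Euc m → Euc m → ℝ := fun y z y' =>
    (‖x - z‖ ^ (α - m) - ‖y - z‖ ^ (α - m)) * ‖y - x‖ ^ (-β - m) -
      (‖x - z‖ ^ (α - m) - ‖y' - z‖ ^ (α - m)) * ‖y' - x‖ ^ (-β - m) with hk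
  set F : Euc m × Euc m × Euc m → ℝ≥0∞ := fun q =>
    ENNReal.ofReal (|k q.1 q.2.1 q.2.2| * ‖q.1 - q.2.2‖ ^ (-σ - m)) *
      (‖A q.2.1‖ₑ * ‖B q.2.2‖ₑ) with hF
  have hFm : Measurable F := by
    have m1 : Measurable fun q : Euc m × Euc m × Euc m => ‖A q.2.1‖ₑ := mA.comp (by fun_prop)
    have m2 : Measurable fun q : Euc m × Euc m × Euc m => ‖B q.2.2‖ₑ := mB.comp (by fun_prop)
    have m3 : Measurable fun q : Euc m × Euc m × Euc m => |k q.1 q.2.1 q.2.2| := by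
      refine Measurable.abs ?_
      fun_prop
    exact (Measurable.ennreal_ofReal (m3.mul (by fun_prop))).mul (m1.mul m2)
  have hΦdiff : ∀ y y', ‖Φ y - Φ y'‖ₑ ≤ ‖(c : ℂ)‖ₑ *
      ∫⁻ z, ENNReal.ofReal |k y z y'| * ‖A z‖ₑ := by
    intro y y'
    have e1 : Φ y - Φ y' = c * ∫ z, ((-k y z y' : ℝ) : ℂ) * A z := by
      have e2 : ∀ z, ((-k y z y' : ℝ) : ℂ) * A z = ((‖y - x‖ ^ (-β - m) : ℝ) : ℂ) *
          (((‖y - z‖ ^ (α - m) - ‖x - z‖ ^ (α - m) : ℝ) : ℂ) * A z) -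
          ((‖y' - x‖ ^ (-β - m) : ℝ) : ℂ) *
          (((‖y' - z‖ ^ (α - m) - ‖x - z‖ ^ (α - m) : ℝ) : ℂ) * A z) := by
        intro z; simp only [hk]; push_cast; ring
      simp_rw [e2]
      rw [integral_sub ((hc a x y).1.const_mul _) ((hc a x y').1.const_mul _),
        integral_const_mul, integral_const_mul]
      simp only [hΦ]
      rw [(hc a x y).2, (hc a x y').2]
      ring
    rw [e1, enorm_mul]
    refine mul_le_mul_right ((enorm_integral_mul_le _ _).trans (le_of_eq ?_)) _
    simp_rw [abs_neg]
  have hmain : ∫⁻ y, ∫⁻ y', ENNReal.ofReal |w (y, y')| * (‖Φ y - Φ y'‖ₑ * ‖B y'‖ₑ) ≤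
      ‖(c : ℂ)‖ₑ * ∫⁻ z₁, ∫⁻ z₂, (∫⁻ y, ENNReal.ofReal (|k y z₁ z₂| * ‖y - z₂‖ ^ (-σ - m))) *
        (‖A z₁‖ₑ * ‖B z₂‖ₑ) := by
    calc ∫⁻ y, ∫⁻ y', ENNReal.ofReal |w (y, y')| * (‖Φ y - Φ y'‖ₑ * ‖B y'‖ₑ)
        ≤ ∫⁻ y, ∫⁻ y', ‖(c : ℂ)‖ₑ * ∫⁻ z, F (y, z, y') := by
          refine lintegral_mono fun y => lintegral_mono fun y' => ?_
          calc ENNReal.ofReal |w (y, y')| * (‖Φ y - Φ y'‖ₑ * ‖B y'‖ₑ)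
              ≤ ENNReal.ofReal |w (y, y')| * ((‖(c : ℂ)‖ₑ *
                  ∫⁻ z, ENNReal.ofReal |k y z y'| * ‖A z‖ₑ) * ‖B y'‖ₑ) :=
                mul_le_mul_right (mul_le_mul_left (hΦdiff y y') _) _
            _ = ‖(c : ℂ)‖ₑ * ((ENNReal.ofReal |w (y, y')| * ‖B y'‖ₑ) *
                  ∫⁻ z, ENNReal.ofReal |k y z y'| * ‖A z‖ₑ) := by ring
            _ = _ := by
                rw [← lintegral_const_mul' _ _ (ENNReal.mul_ne_top ENNReal.ofReal_ne_top
                  enorm_ne_top)]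
                congr 1
                refine lintegral_congr fun z => ?_
                simp only [hF, hw]
                rw [abs_of_nonneg (by positivity), ENNReal.ofReal_mul (abs_nonneg _),
                  norm_sub_rev y' y]
                ring
      _ = ‖(c : ℂ)‖ₑ * ∫⁻ y, ∫⁻ z, ∫⁻ y', F (y, z, y') := by
          simp_rw [lintegral_const_mul' _ _ (enorm_ne_top (x := (c : ℂ)))]
          congr 1
          refine lintegral_congr fun y => lintegral_lintegral_swap ?_
          exact (hFm.comp (by fun_prop :
            Measurable fun q : Euc m × Euc m => (y, q.2, q.1))).aemeasurable
      _ = _ := by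
          rw [lintegral_rotate hFm]
          congr 1
          refine lintegral_congr fun z₁ => lintegral_congr fun z₂ => ?_
          simp only [hF]
          rw [lintegral_mul_const']
          exact ENNReal.mul_ne_top enorm_ne_top enorm_ne_top
  rw [hX, enorm_mul]
  refine (mul_le_mul_right (hparts.trans (hmain.trans (mul_le_mul_right
    (h₃ x _ (fun z₁ z₂ e₁ e₂ e₁₂ => h₂ x z₁ z₂ e₁ e₂ e₁₂) _ _ mA mB) _))) _).trans (le_of_eq ?_)
  rw [← mul_assoc, ← enorm_mul, ENNReal.coe_mul, mul_assoc (ENNReal.ofNNReal _)]; rfl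

/-! ### Conclusion -/

/-- Order zero means `𝓕⁻ 𝓕`, so this is a pointwise Fourier inversion. It treats `β = 0`, where the
singular integrals for the commutators are not available. -/
lemma fracLaplacian_zero_leibnizRemainder {m : ℕ} [NeZero m] {α : ℝ} (hα : 0 < α)
    (a b : 𝓢(Euc m, ℂ)) (x : Euc m) :
    fracLaplacian 0 (leibnizRemainder α a b) x = leibnizRemainder α a b x := by
  have h0 : ∀ a b : 𝓢(Euc m, ℂ), fracLaplacian 0 (fun y => a y * fracLaplacian α b y) x =
      a x * fracLaplacian α b x := by
    intro a b
    have hfi := integrable_mul_fracLaplacian hα.le a b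
    have w0 := integrable_norm_rpow_mul_fourier_mul_fracLaplacian hα.le le_rfl zero_le_one a b
    simp only [Real.rpow_zero, one_mul] at w0
    have hFi := (integrable_norm_iff (continuous_fourier hfi).aestronglyMeasurable).1 w0
    have hc : Continuous fun y => a y * fracLaplacian α b y :=
      a.continuous.mul (continuous_fracLaplacian hα.le b)
    simp only [fracLaplacian, Real.rpow_zero, Complex.ofReal_one, one_mul] at *
    rw [hc.fourierInv_fourier_eq hfi hFi]
  rw [fracLaplacian_leibnizRemainder hα le_rfl zero_le_one, h0, h0, add_zero]
  ring

lemma rieszPotential_zero {m : ℕ} (f : Euc m → ℝ≥0∞) (x : Euc m) : rieszPotential 0 f x = f x :=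
  if_pos rfl

/-- `potentialSum` as a sum over the three pairs of exponents. -/
lemma potentialSum_eq_sum {m : ℕ} (δ Θ : ℝ) (f g : Euc m → ℝ≥0∞) (x : Euc m) {γ : Fin 3 → ℝ}
    (hγ : ∀ k, γ k = Θ - ![δ, Θ - δ, δ] k - ![Θ - δ, δ, Θ - 2 * δ] k) :
    potentialSum δ Θ f g x = ∑ k, rieszPotential (γ k) (fun y =>
      rieszPotential (![δ, Θ - δ, δ] k) f y * rieszPotential (![Θ - δ, δ, Θ - 2 * δ] k) g y) x := by
  have h0 : γ 0 = 0 := by rw [hγ]; simp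
  have h1 : γ 1 = 0 := by rw [hγ]; simp
  have h2 : γ 2 = δ := by rw [hγ]; simp; ring
  rw [Fin.sum_univ_three, h0, h1, h2, rieszPotential_zero, rieszPotential_zero]
  rfl

lemma exponents_mem {δ Θ τ₁ τ₂ ε : ℝ} (hδ : 0 < δ) (hδΘ : 2 * δ < Θ) (hδε : δ < ε)
    (hΘ₁ : Θ ≤ τ₁) (hΘ₂ : Θ ≤ τ₂) (k : Fin 3) :
    ![δ, Θ - δ, δ] k ∈ Ioo 0 τ₁ ∧ ![Θ - δ, δ, Θ - 2 * δ] k ∈ Ioo 0 τ₂ ∧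
      Θ - ![δ, Θ - δ, δ] k - ![Θ - δ, δ, Θ - 2 * δ] k ∈ Ico 0 ε := by
  fin_cases k <;> refine ⟨⟨?_, ?_⟩, ⟨?_, ?_⟩, ?_, ?_⟩ <;> simp <;> linarith

lemma exists_enorm_fracLaplacian_leibnizRemainder_le {m : ℕ} [NeZero m] {α β τ δ : ℝ}
    (hα : 0 < α) (hαm : α < m) (hβ : 0 ≤ β) (hτ : τ ≤ α) (hδ : 0 < δ)
    (hδ₁ : β + (α - τ) + δ ≤ 1) (hδΘ : 2 * δ < τ - β) :
    ∃ C : ℝ≥0, ∀ (a b : 𝓢(Euc m, ℂ)) (x : Euc m),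
      ‖fracLaplacian β (leibnizRemainder α a b) x‖ₑ ≤
      C * potentialSum δ (τ - β) (fun z => ‖fracLaplacian α a z‖ₑ)
        (fun z => ‖fracLaplacian τ b z‖ₑ) x := by
  obtain ⟨C₁, h₁⟩ := exists_enorm_leibnizRemainder_le (m := m) (α := α + β) (τ₁ := α) (τ₂ := τ)
    (δ := δ) (by linarith) hαm (by linarith) (by linarith) (by linarith) hδ (by linarith)
    (by linarith) (by linarith) (by linarith) (by linarith)
  rw [show α + τ - (α + β) = τ - β by ring] at h₁
  rcases hβ.eq_or_lt with rfl | hβ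
  · refine ⟨C₁, fun a b x => ?_⟩
    rw [fracLaplacian_zero_leibnizRemainder hα]
    simpa using h₁ a b x
  obtain ⟨C₂, h₂⟩ := exists_enorm_commutator_le (m := m) hα.le hβ (by linarith : τ < m) hδ
    (by linarith) hδΘ
  have h₃ : ∃ C₃ : ℝ≥0, ∀ (a b : 𝓢(Euc m, ℂ)) (x : Euc m),
      ‖a x * fracLaplacian (α + β) b x - fracLaplacian β (fun y => a y * fracLaplacian α b y) x‖ₑ ≤
      C₃ * potentialSum δ (τ - β) (fun z => ‖fracLaplacian α a z‖ₑ)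
        (fun z => ‖fracLaplacian τ b z‖ₑ) x := by
    -- For `τ = α` no derivative has to be moved and the direct commutator bound suffices, with the
    -- arguments exchanged.
    rcases hτ.eq_or_lt with rfl | hτ
    · exact exists_enorm_commutator_le_swap hα.le hβ hαm hδ (by linarith) hδΘ
    · exact exists_enorm_commutator_le_of_lt hαm hβ hτ hδ hδ₁ hδΘ
  obtain ⟨C₃, h₃⟩ := h₃
  refine ⟨C₁ + C₃ + C₂, fun a b x => ?_⟩
  rw [fracLaplacian_leibnizRemainder hα hβ.le (by linarith), ENNReal.coe_add, ENNReal.coe_add,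
    add_mul, add_mul]
  refine (enorm_add_le _ _).trans (add_le_add ((enorm_add_le _ _).trans (add_le_add ?_ ?_)) ?_)
  · exact h₁ a b x
  · exact h₃ a b x
  · exact h₂ b a x

theorem lemma4p2 (m : ℕ) (α : ℝ) (hα : 0 < α) (hαm : α < (m : ℝ)) :
    (∀ ε : ℝ, 0 < ε → ∀ τ₁ τ₂ : ℝ,
      τ₁ ∈ Set.Ioc (max (α - 1) 0) α → τ₂ ∈ Set.Ioc (max (α - 1) 0) α → α < τ₁ + τ₂ →
      ∃ (L : ℕ) (s t : Fin L → ℝ),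
        (∀ k, s k ∈ Set.Ioo 0 τ₁ ∧ t k ∈ Set.Ioo 0 τ₂ ∧
          τ₁ + τ₂ - s k - t k - α ∈ Set.Ico 0 ε) ∧
        ∃ C : ℝ≥0, ∀ (a b : 𝓢(EuclideanSpace ℝ (Fin m), ℂ)) (x : EuclideanSpace ℝ (Fin m)),
          ‖leibnizRemainder α a b x‖ₑ ≤
            C * ∑ k, rieszPotential (τ₁ + τ₂ - s k - t k - α)
              (fun y => rieszPotential (s k) (fun z => ‖fracLaplacian τ₁ a z‖ₑ) y *
                rieszPotential (t k) (fun z => ‖fracLaplacian τ₂ b z‖ₑ) y) x) ∧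
    (∃ L : ℕ, ∀ β : ℝ, β ∈ Set.Ico 0 (min α 1) → β ≤ (m : ℝ) - α →
      ∀ τ : ℝ, τ ∈ Set.Ioc (max β (α + β - 1)) α → ∀ ε : ℝ, 0 < ε →
      ∃ s t : Fin L → ℝ,
        (∀ k, s k ∈ Set.Ioo 0 α ∧ t k ∈ Set.Ioo 0 τ ∧ τ - β - s k - t k ∈ Set.Ico 0 ε) ∧
        ∃ C : ℝ≥0, ∀ (a b : 𝓢(EuclideanSpace ℝ (Fin m), ℂ)) (x : EuclideanSpace ℝ (Fin m)),
          ‖fracLaplacian β (leibnizRemainder α a b) x‖ₑ ≤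
            C * ∑ k, rieszPotential (τ - β - s k - t k)
              (fun y => rieszPotential (s k) (fun z => ‖fracLaplacian α a z‖ₑ) y *
                rieszPotential (t k) (fun z => ‖fracLaplacian τ b z‖ₑ) y) x) := by
  have hm : NeZero m := ⟨by rintro rfl; simp only [CharP.cast_eq_zero] at hαm; linarith⟩
  -- Three is the number of summands of `potentialSum`, whatever `β`, `τ` and `ε` are.
  refine ⟨?_, 3, ?_⟩
  · rintro ε hε τ₁ τ₂ ⟨hτ₁, hτ₁α⟩ ⟨hτ₂, hτ₂α⟩ hτ
    rw [max_lt_iff] at hτ₁ hτ₂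
    -- `δ < ε` bounds the outer orders, `2δ < Θ` keeps `Θ - 2δ` positive, and `δ < 1 + τᵢ - α`,
    -- possible as `τᵢ > α - 1`, is what the kernel estimate needs.
    obtain ⟨δ, hδ, hδ'⟩ := exists_between (show 0 < min (min ε ((τ₁ + τ₂ - α) / 2))
      (min (1 + τ₁ - α) (1 + τ₂ - α)) from
        lt_min (lt_min hε (by linarith)) (lt_min (by linarith) (by linarith)))
    simp only [lt_min_iff] at hδ'
    obtain ⟨⟨d1, d2⟩, d3, d4⟩ := hδ'
    obtain ⟨C, hC⟩ := exists_enorm_leibnizRemainder_le (m := m) (δ := δ) hα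
      (hτ₁α.trans_lt hαm) (hτ₂α.trans_lt hαm) hτ₁α hτ₂α hδ (by linarith) (by linarith)
      (by linarith) (by linarith) (by linarith)
    have hγ : ∀ s t : ℝ, τ₁ + τ₂ - s - t - α = (τ₁ + τ₂ - α) - s - t := fun s t => by ring
    refine ⟨3, ![δ, τ₁ + τ₂ - α - δ, δ], ![τ₁ + τ₂ - α - δ, δ, τ₁ + τ₂ - α - 2 * δ],
      fun k => ?_, C, fun a b x => ?_⟩
    · rw [hγ]
      exact exponents_mem hδ (by linarith) d1 (by linarith) (by linarith) k
    · rw [← potentialSum_eq_sum δ (τ₁ + τ₂ - α) _ _ x fun k => hγ _ _]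
      exact hC a b x
  · rintro β ⟨hβ, hβα⟩ - τ ⟨hτ, hτα⟩ ε hε
    rw [max_lt_iff] at hτ
    rw [lt_min_iff] at hβα
    -- The last bound is positive because `τ > α + β - 1`; it keeps the Hölder exponent `β + (α - τ)
    -- + δ` at most `1`.
    obtain ⟨δ, hδ, hδ'⟩ := exists_between (show 0 < min (min ε ((τ - β) / 2)) (1 - β - (α - τ)) from
        lt_min (lt_min hε (by linarith)) (by linarith))
    simp only [lt_min_iff] at hδ'
    obtain ⟨⟨d1, d2⟩, d3⟩ := hδ'
    obtain ⟨C, hC⟩ := exists_enorm_fracLaplacian_leibnizRemainder_le (m := m) (β := β) (τ := τ)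
      (δ := δ) hα hαm hβ hτα hδ (by linarith) (by linarith)
    refine ⟨_, _, fun k => exponents_mem hδ (by linarith : 2 * δ < τ - β) d1 (by linarith)
      (by linarith) k, C, fun a b x => ?_⟩
    rw [← potentialSum_eq_sum δ (τ - β) _ _ x fun k => rfl]
    exact hC a b x
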